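/- Theorem 3. For each $n$ let $\hat M=M+E$ be $n\times n$ symmetric matrices, where $M$ is deterministic and $E$ is random. Suppose $M$ has rank $k=k_n\ge1$ and $M=U\Lambda U^\top$, where $U\in\mathbb R^{n\times k}$ has orthonormal columns and $\Lambda=\mathrm{diag}(\lambda_1,\dots,\lambda_k)$ contains the nonzero eigenvalues of $M$, $|\lambda_1|\ge\dots\ge|\lambda_k|>0$. Write $S_n=\|M\|$ (spectral norm) and $\psi=|\lambda_1/\lambda_k|$. For sequences, $x_n\lesssim y_n$ means that $x_n\le c\,y_n$ for all but finitely many $n$, for some constant $c$ not depending on $n$. For a matrix $N$, $\|N\|_{2\to\infty}$ is the maximum of the Euclidean norms of its rows, and $d_{2\to\infty}(U_1,U_2)=\inf_W\|U_1-U_2W\|_{2\to\infty}$, the infimum being over orthogonal $k\times k$ matrices $W$. Assume: (1) (Signal-to-noise ratio.) There are constants $\beta_\Delta>0$, $N_0$ and quantities $E_n>0$ with $S_n/E_n\gtrsim n^{\beta_\Delta}$ and $\mathbb P(\|E\|\le E_n)\ge1-n^{-6}$ for all $n\ge N_0$. (2) (Row-wise concentration.) There are constants $\delta>1$, $N_0$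 and $C_{2\to\infty}$ such that, for every $n\ge N_0$, every positive integer $r\le\log n$ and every deterministic $u\in\mathbb R^n$, with probability at least $1-n^{-8}$, $\max_{i}|e_i^\top E^ru|\le C_{2\to\infty}E_n^r(\log n)^{\delta r}\|u\|_{\max}$. (3) $\psi=o(S_n/E_n)$. (4) $\hat U_g$ is the output of repeated-sampling randomized SVD: let $G_1,\dots,G_{a_n}$ be independent $n\times\tilde k$ matrices with i.i.d. standard normal entries, independent of $E$, where $\tilde k=\tilde k_n\ge k$; choose $\tilde a$ that maximizes over $a\in\{1,\dots,a_n\}$ the $k$-th largest singular value of $\hat M^gG_a$; then $\hat U_g$ is an $n\times k$ matrix of left singular vectors of $\hat M^gG_{\tilde a}$ for its $k$ largest singular values. (5) One of the following holds: (a) $k$ and $\tilde k$ are fixed; (b) $k$ is fixed and $\tilde k\to\infty$; (c) $k\to\infty$ and $\tilde k\ge c_{\mathrm{gap}}k$ for a fixed $c_{\mathrm{gap}}>1$. (6) $a_n\ge\lceil C\tilde k^{-1}\log n\rceil$ for all large $n$, where $C>0$ is a suitable constant which depends only on $(k,\tilde k)$ in case (a), equals $15$ in case (b), and depends only on $c_{\mathrm{gap}}$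 in case (c); moreover $a_n$ grows at most polynomially in $n$. Let $\vartheta=\max\{1,\tilde k^{-1/2}\log^{1/2}n\}$, and let $g$ be a fixed integer with $g\ge1+(2\beta_\Delta)^{-1}$. Then there is a constant $c$ not depending on $n$ such that, for all sufficiently large $n$, with probability at least $1-n^{-5}$, $$d_{2\to\infty}(\hat U_g,U)\le c\,(\log n)^{\delta^*}\vartheta\,\psi^g\,k^{1/2}\,\frac{E_n}{S_n}\,\|U\|_{2\to\infty}.$$ Here $\delta^*=\delta$ if either $g>1+(2\beta_\Delta)^{-1}$ or $\|U\|_{2\to\infty}\gtrsim n^{-\beta_c/2}$ for some $\beta_c\in[0,1)$; otherwise (so that $g=1+(2\beta_\Delta)^{-1}$), $\delta^*=\delta g+1/2$. -/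

import Mathlib

open Filter MeasureTheory ProbabilityTheory Matrix
open scoped Topology

namespace RSVD

/-! ### Deterministic notions -/

/-- The spectral norm of a square real matrix. -/
noncomputable def specNorm {n : ℕ} (A : Matrix (Fin n) (Fin n) ℝ) : ℝ :=
  ‖Matrix.toEuclideanCLM (𝕜 := ℝ) A‖

/-- The `2 → ∞` norm: the maximum of the Euclidean norms of the rows. -/
noncomputable def twoInfNorm {n d : ℕ} (A : Matrix (Fin n) (Fin d) ℝ) : ℝ :=
  ⨆ i : Fin n, √(∑ j : Fin d, A i j ^ 2)

/-- `d_{2 → ∞}(U₁, U₂) = inf_W ‖U₁ - U₂ W‖_{2 → ∞}`, over orthogonal `d × d` matrices `W`. -/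
noncomputable def twoInfDist {n d : ℕ} (U₁ U₂ : Matrix (Fin n) (Fin d) ℝ) : ℝ :=
  ⨅ W : Matrix.orthogonalGroup (Fin d) ℝ,
    twoInfNorm (U₁ - U₂ * (W : Matrix (Fin d) (Fin d) ℝ))

/-- `singVal Y i` is the `(i + 1)`-th largest singular value of `Y` (with multiplicity). -/
noncomputable def singVal {n m : ℕ} (Y : Matrix (Fin n) (Fin m) ℝ) (i : ℕ) : ℝ :=
  (Matrix.toEuclideanLin Y).singularValues i

/-- `M = U diag(lam) Uᵀ`, where `U` has `k` orthonormal columns and the entries of `lam` are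
nonzero. Thus `M` is symmetric of rank `k`, `lam` lists its nonzero eigenvalues (in any order), and
the columns of `U` are corresponding orthonormal eigenvectors. -/
structure IsReducedEigendecomposition {n k : ℕ} (M : Matrix (Fin n) (Fin n) ℝ)
    (U : Matrix (Fin n) (Fin k) ℝ) (lam : Fin k → ℝ) : Prop where
  orthonormal : Uᵀ * U = 1
  ne_zero : ∀ i, lam i ≠ 0
  eq : M = U * Matrix.diagonal lam * Uᵀ

/-- The ratio of the largest to the smallest modulus of the listed (nonzero) eigenvalues. -/
noncomputable def condNumber {k : ℕ} (lam : Fin k → ℝ) : ℝ :=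
  (⨆ i, |lam i|) / (⨅ i, |lam i|)

/-- The columns of `Uhat` are left singular vectors belonging to the `k` largest singular values of
`Y`: together with right singular vectors (the columns of `V`) they are `k` leading terms of an SVD
of `Y`. -/
structure IsLeadingLeftSingular {n m k : ℕ} (Y : Matrix (Fin n) (Fin m) ℝ)
    (Uhat : Matrix (Fin n) (Fin k) ℝ) : Prop where
  orthonormal : Uhatᵀ * Uhat = 1
  exists_right : ∃ V : Matrix (Fin m) (Fin k) ℝ, Vᵀ * V = 1 ∧
    Y * V = Uhat * Matrix.diagonal (fun i : Fin k => singVal Y i) ∧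
    Yᵀ * Uhat = V * Matrix.diagonal (fun i : Fin k => singVal Y i)

/-- `Uhat` is a possible output of repeated-sampling randomized SVD of `Mhat`, with target rank `k`,
power `g` and sketching matrices `G 0, …, G (a - 1)`: among the sketches `Mhat ^ g * G b`, one with
the largest `k`-th singular value is selected, and `Uhat` consists of `k` leading left singular
vectors of the selected sketch. -/
def IsRSVDOutput {n k m a : ℕ} (Mhat : Matrix (Fin n) (Fin n) ℝ) (g : ℕ)
    (G : Fin a → Matrix (Fin n) (Fin m) ℝ) (Uhat : Matrix (Fin n) (Fin k) ℝ) : Prop :=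
  ∃ s : Fin a, (∀ b : Fin a, singVal (Mhat ^ g * G b) (k - 1) ≤ singVal (Mhat ^ g * G s) (k - 1)) ∧
    IsLeadingLeftSingular (Mhat ^ g * G s) Uhat

/-- `x n ≲ y n`: there is a constant `c` with `x n ≤ c * y n` for all but finitely many `n`. -/
def AsympLE (x y : ℕ → ℝ) : Prop :=
  ∃ c : ℝ, ∀ᶠ n in atTop, x n ≤ c * y n

/-- `ϑ = max {1, m ^ (-1/2) (log n) ^ (1/2)}`. -/
noncomputable def theta (n m : ℕ) : ℝ :=
  max 1 (√(Real.log n) / √(m : ℝ))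

open Classical in
/-- The exponent `δ*`: it is `δ` if `g > 1 + (2β)⁻¹`, or if the sequence `μ` (the `2 → ∞` norms of
the eigenvector matrices) satisfies `μ n ≳ n ^ (-βc / 2)` for some `βc ∈ [0, 1)`; otherwise it is
`δ g + 1/2`. -/
noncomputable def deltaStar (β δ : ℝ) (g : ℕ) (μ : ℕ → ℝ) : ℝ :=
  if 1 + (2 * β)⁻¹ < (g : ℝ) ∨
      ∃ βc : ℝ, 0 ≤ βc ∧ βc < 1 ∧ AsympLE (fun n => (n : ℝ) ^ (-βc / 2)) μ
  then δ else δ * g + 1 / 2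

/-- The three regimes for the rank `k` and the sketching dimension `m`, with the constant `C` in
the requirement `a ≥ ⌈C log n / m⌉` on the number of sketches. It may depend only on the two fixed
dimensions in the first regime, it is `15` in the second one, and it may depend only on the ratio
`cgap` in the third one. -/
def DimensionRegime (Ca : ℕ → ℕ → ℝ) (Cc : ℝ → ℝ) (k m : ℕ → ℕ) (C : ℝ) : Prop :=
  (∃ k₀ m₀ : ℕ, (∀ᶠ n in atTop, k n = k₀ ∧ m n = m₀) ∧ C = Ca k₀ m₀) ∨
  (∃ k₀ : ℕ, (∀ᶠ n in atTop, k n = k₀) ∧ Tendsto m atTop atTop ∧ C = 15) ∨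
  (∃ cgap : ℝ, 1 < cgap ∧ Tendsto k atTop atTop ∧
    (∀ᶠ n in atTop, cgap * (k n : ℝ) ≤ (m n : ℝ)) ∧ C = Cc cgap)

/-! ### Probabilistic notions -/

/-- The property `S` holds with probability at least `p` (for a measurable set of outcomes, this is
`p ≤ P S`). -/
def HoldsWithProb {Ω : Type*} [MeasurableSpace Ω] (P : Measure Ω) (p : ℝ) (S : Ω → Prop) : Prop :=
  ∃ A : Set Ω, MeasurableSet A ∧ p ≤ P.real A ∧ ∀ ω ∈ A, S ω

/-- `E` is a random symmetric matrix. -/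
structure IsRandomSymmetric {Ω : Type*} [MeasurableSpace Ω] {n : ℕ}
    (E : Ω → Matrix (Fin n) (Fin n) ℝ) : Prop where
  measurable : ∀ i j, Measurable fun ω => E ω i j
  symm : ∀ ω, (E ω).IsSymm

/-- `G 0, …, G (a - 1)` are independent `n × m` matrices with independent standard normal entries,
and they are jointly independent of the random matrix `E`. -/
structure IsGaussianSketch {Ω : Type*} [MeasurableSpace Ω] (P : Measure Ω) {n m a : ℕ}
    (G : Fin a → Ω → Matrix (Fin n) (Fin m) ℝ) (E : Ω → Matrix (Fin n) (Fin n) ℝ) : Prop where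
  measurable : ∀ b i j, Measurable fun ω => G b ω i j
  law : ∀ b i j, P.map (fun ω => G b ω i j) = gaussianReal 0 1
  indep_entries :
    iIndepFun (fun (q : Fin a × Fin n × Fin m) (ω : Ω) => G q.1 ω q.2.1 q.2.2) P
  indep_noise :
    IndepFun (fun (ω : Ω) (q : Fin a × Fin n × Fin m) => G q.1 ω q.2.1 q.2.2)
      (fun (ω : Ω) (p : Fin n × Fin n) => E ω p.1 p.2) P

/-- Signal-to-noise assumption: `S_n / E_n ≳ n ^ β` with `S_n = ‖M‖`, and `‖E‖ ≤ E_n` with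
probability at least `1 - n ^ (-6)` for all large `n`. -/
structure SignalToNoise {Ω : ℕ → Type*} [∀ n, MeasurableSpace (Ω n)] (P : ∀ n, Measure (Ω n))
    (M : ∀ n, Matrix (Fin n) (Fin n) ℝ) (E : ∀ n, Ω n → Matrix (Fin n) (Fin n) ℝ)
    (En : ℕ → ℝ) (β : ℝ) : Prop where
  beta_pos : 0 < β
  snr : AsympLE (fun n => (n : ℝ) ^ β) (fun n => specNorm (M n) / En n)
  noise : ∃ N₀ : ℕ, ∀ n ≥ N₀, 0 < En n ∧
    HoldsWithProb (P n) (1 - 1 / (n : ℝ) ^ 6) (fun ω => specNorm (E n ω) ≤ En n)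

/-- Row-wise concentration assumption: for all large `n`, every positive integer `r ≤ log n` and
every deterministic vector `u`, with probability at least `1 - n ^ (-8)`,
`max_i |e_iᵀ E ^ r u| ≤ C E_n ^ r (log n) ^ (δ r) ‖u‖_max`. (The norm of `u : Fin n → ℝ` is the
maximum of the moduli of its entries.) -/
structure RowwiseConcentration {Ω : ℕ → Type*} [∀ n, MeasurableSpace (Ω n)]
    (P : ∀ n, Measure (Ω n)) (E : ∀ n, Ω n → Matrix (Fin n) (Fin n) ℝ)
    (En : ℕ → ℝ) (δ : ℝ) : Prop where
  one_lt : 1 < δ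
  rows : ∃ (N₀ : ℕ) (C : ℝ), ∀ n ≥ N₀, ∀ r : ℕ, 1 ≤ r → (r : ℝ) ≤ Real.log n →
    ∀ u : Fin n → ℝ, HoldsWithProb (P n) (1 - 1 / (n : ℝ) ^ 8) (fun ω =>
      ∀ i : Fin n, |((E n ω) ^ r *ᵥ u) i| ≤
        C * En n ^ r * Real.log n ^ (δ * (r : ℝ)) * ‖u‖)

end RSVD

namespace RSVD

section Deterministic

open scoped Matrix.Norms.L2Operator

/-! ### The `2 → ∞` norm -/

/-! Write `ε = E_n`, `S = ‖M‖`, `L = min |λ_i| = S/ψ`, `A = M + E`. On the event `‖E‖ ≤ ε`, and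
since `ψ = o(S/ε)` makes `8ε ≤ L`, every eigenvalue of `A` has modulus at most `3ε` or at least
`L/2` (`spectral_gap`). Let `Q` be the spectral projection onto the large part and `R` the inverse
of `A` there. Both are functional calculi of `A`.

Deterministic part (`IsSmallPerturbation.twoInfDist_le`). Split `Uhat = Q Uhat + (1 - Q) Uhat`.
Since `Uhat = A^g G N` with `‖N‖` at most the inverse of the `k`-th singular value of the sketch,
the second summand is controlled row by row by `A^g (1 - Q) G`, divided by that singular value. For
the first, iterating `Q = (M + E) R Q` gives `Q = ∑_{r<g} E^r M R^(r+1) Q + E^g R^g Q`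
(`cut_eq_sum`). Because `M = U Uᵀ M`, the term `r = 0` is `U` times a matrix close to `Uᵀ Q Uhat`,
which is nearly orthogonal (`exists_orthogonal_norm_sub_le`). The terms `1 ≤ r < g` involve only the
rows of `E^r U`, to which row-wise concentration applies. The remainder is at most `(2ε/L)^g` in
spectral norm.

Random part (`holdsWithProb_isGoodSketch`). The sketches are independent of `E`, so `Q` may be
frozen. By rotation invariance, a sketch restricted to the range of `Q` is a `k × m` Gaussian
matrix. It is bounded below by `c √m` with probability at least `1 - e^(-m)` if `m ≥ ρ k`, `ρ > 1`,
and with positive probability whenever `k ≤ m`. Among order `log n / m` independent sketches, one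
succeeds with high probability, so the selected sketch has `k`-th singular value at least `c √m
(L/2)^g`. The rows of `A^g (1 - Q)` have norm at most `(3ε)^g`, so a chi-square tail and a union
bound give `(3ε)^g √(T (m + log n))` for all rows of all sketches. The quotient of the two estimates
is of order `ϑ (6ψ ε/S)^g`.

Finally `√n (ε/S)^(g-1)` is bounded, which is the condition on `g`, and `√n ‖U‖_{2→∞} ≥ 1`. Hence
the terms known only in spectral norm are also of order `(ε/S) ‖U‖_{2→∞}` up to the other factors
(`error_terms_le`). The argument yields the exponent `δ` in every case, and `δ ≤ δ*`. -/

theorem rowNorm_le_twoInfNorm {n d : ℕ} (A : Matrix (Fin n) (Fin d) ℝ) (i : Fin n) :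
    √(∑ j : Fin d, A i j ^ 2) ≤ twoInfNorm A :=
  le_ciSup (f := fun i => √(∑ j : Fin d, A i j ^ 2)) (Set.finite_range _).bddAbove i

theorem twoInfNorm_nonneg {n d : ℕ} (A : Matrix (Fin n) (Fin d) ℝ) : 0 ≤ twoInfNorm A :=
  Real.iSup_nonneg fun _ => Real.sqrt_nonneg _

theorem twoInfNorm_le {n d : ℕ} {A : Matrix (Fin n) (Fin d) ℝ} {c : ℝ} (hc : 0 ≤ c)
    (h : ∀ i, √(∑ j : Fin d, A i j ^ 2) ≤ c) : twoInfNorm A ≤ c :=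
  Real.iSup_le h hc

theorem norm_row_eq {n d : ℕ} (A : Matrix (Fin n) (Fin d) ℝ) (i : Fin n) :
    √(∑ j : Fin d, A i j ^ 2) = ‖(WithLp.toLp 2 (A i) : EuclideanSpace ℝ (Fin d))‖ := by
  rw [EuclideanSpace.norm_eq]; simp

theorem norm_mulVec_le {n d : ℕ} (A : Matrix (Fin n) (Fin d) ℝ) (x : Fin d → ℝ) :
    ‖(WithLp.toLp 2 (A *ᵥ x) : EuclideanSpace ℝ (Fin n))‖ ≤
      ‖A‖ * ‖(WithLp.toLp 2 x : EuclideanSpace ℝ (Fin d))‖ :=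
  Matrix.l2_opNorm_mulVec A (WithLp.toLp 2 x)

theorem norm_transpose_eq {n d : ℕ} (A : Matrix (Fin n) (Fin d) ℝ) : ‖Aᵀ‖ = ‖A‖ := by
  rw [← Matrix.conjTranspose_eq_transpose_of_trivial, Matrix.l2_opNorm_conjTranspose]

theorem norm_le_of_mulVec_le {n d : ℕ} {A : Matrix (Fin n) (Fin d) ℝ} {c : ℝ} (hc : 0 ≤ c)
    (h : ∀ x : Fin d → ℝ, ‖(WithLp.toLp 2 (A *ᵥ x) : EuclideanSpace ℝ (Fin n))‖ ≤
      c * ‖(WithLp.toLp 2 x : EuclideanSpace ℝ (Fin d))‖) : ‖A‖ ≤ c := by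
  rw [Matrix.l2_opNorm_def]
  exact ContinuousLinearMap.opNorm_le_bound _ hc fun x => h x.ofLp

theorem rowNorm_mul_le {n d e : ℕ} (A : Matrix (Fin n) (Fin d) ℝ) (B : Matrix (Fin d) (Fin e) ℝ)
    (i : Fin n) : √(∑ j, (A * B) i j ^ 2) ≤ √(∑ j, A i j ^ 2) * ‖B‖ := by
  rw [norm_row_eq, norm_row_eq, mul_comm, ← norm_transpose_eq B]
  have : (A * B) i = Bᵀ *ᵥ A i := by
    ext j; simp [Matrix.mul_apply, Matrix.mulVec, dotProduct, mul_comm]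
  rw [this]
  exact norm_mulVec_le _ _

theorem twoInfNorm_mul_le {n d e : ℕ} (A : Matrix (Fin n) (Fin d) ℝ)
    (B : Matrix (Fin d) (Fin e) ℝ) : twoInfNorm (A * B) ≤ twoInfNorm A * ‖B‖ :=
  twoInfNorm_le (mul_nonneg (twoInfNorm_nonneg A) (norm_nonneg _)) fun i =>
    (rowNorm_mul_le A B i).trans
      (mul_le_mul_of_nonneg_right (rowNorm_le_twoInfNorm A i) (norm_nonneg _))

theorem rowNorm_le_norm {n d : ℕ} (A : Matrix (Fin n) (Fin d) ℝ) (i : Fin n) :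
    √(∑ j, A i j ^ 2) ≤ ‖A‖ := by
  have := rowNorm_mul_le (1 : Matrix (Fin n) (Fin n) ℝ) A i
  simpa [Matrix.one_apply] using this

theorem twoInfNorm_le_norm {n d : ℕ} (A : Matrix (Fin n) (Fin d) ℝ) : twoInfNorm A ≤ ‖A‖ :=
  twoInfNorm_le (norm_nonneg _) (rowNorm_le_norm A)

theorem twoInfNorm_add_le {n d : ℕ} (A B : Matrix (Fin n) (Fin d) ℝ) :
    twoInfNorm (A + B) ≤ twoInfNorm A + twoInfNorm B := by
  refine twoInfNorm_le (add_nonneg (twoInfNorm_nonneg A) (twoInfNorm_nonneg B)) fun i => ?_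
  have h1 := rowNorm_le_twoInfNorm A i
  have h2 := rowNorm_le_twoInfNorm B i
  rw [norm_row_eq] at *
  have : (WithLp.toLp 2 ((A + B) i) : EuclideanSpace ℝ (Fin d)) =
      WithLp.toLp 2 (A i) + WithLp.toLp 2 (B i) := rfl
  rw [this]
  exact (norm_add_le _ _).trans (add_le_add h1 h2)

theorem twoInfNorm_zero {n d : ℕ} : twoInfNorm (0 : Matrix (Fin n) (Fin d) ℝ) = 0 :=
  le_antisymm (twoInfNorm_le le_rfl fun i => by simp) (twoInfNorm_nonneg _)

theorem twoInfNorm_sum_le {n d : ℕ} {ι : Type*} (s : Finset ι)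
    (A : ι → Matrix (Fin n) (Fin d) ℝ) :
    twoInfNorm (∑ i ∈ s, A i) ≤ ∑ i ∈ s, twoInfNorm (A i) :=
  Finset.le_sum_of_subadditive twoInfNorm twoInfNorm_zero.le twoInfNorm_add_le s A

theorem norm_le_sqrt_mul_twoInfNorm {n d : ℕ} (A : Matrix (Fin n) (Fin d) ℝ) :
    ‖A‖ ≤ √n * twoInfNorm A := by
  have h0 := twoInfNorm_nonneg A
  refine norm_le_of_mulVec_le (by positivity) fun x => ?_
  set y : EuclideanSpace ℝ (Fin d) := WithLp.toLp 2 x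
  refine le_of_sq_le_sq ?_ (by positivity)
  rw [EuclideanSpace.norm_sq_eq]
  have hi : ∀ i : Fin n, ‖(WithLp.toLp 2 (A *ᵥ x) : EuclideanSpace ℝ (Fin n)) i‖ ^ 2 ≤
      (twoInfNorm A * ‖y‖) ^ 2 := by
    intro i
    refine pow_le_pow_left₀ (norm_nonneg _) ?_ 2
    have h1 := rowNorm_le_twoInfNorm A i
    rw [norm_row_eq] at h1
    have h2 : (WithLp.toLp 2 (A *ᵥ x) : EuclideanSpace ℝ (Fin n)) i =
        inner ℝ y (WithLp.toLp 2 (A i) : EuclideanSpace ℝ (Fin d)) := by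
      simp [PiLp.inner_apply, Matrix.mulVec, dotProduct, y]
    rw [h2]
    refine (norm_inner_le_norm _ _).trans ?_
    rw [mul_comm]
    exact mul_le_mul_of_nonneg_right h1 (norm_nonneg _)
  refine (Finset.sum_le_sum fun i _ => hi i).trans ?_
  simp only [Finset.sum_const, Finset.card_univ, Fintype.card_fin, nsmul_eq_mul]
  rw [mul_pow, mul_pow, mul_pow, Real.sq_sqrt (Nat.cast_nonneg n)]
  linarith

theorem norm_le_one_of_transpose_mul_self {n d : ℕ} {A : Matrix (Fin n) (Fin d) ℝ}
    (h : Aᵀ * A = 1) : ‖A‖ ≤ 1 := by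
  have h1 := Matrix.l2_opNorm_conjTranspose_mul_self A
  rw [Matrix.conjTranspose_eq_transpose_of_trivial, h] at h1
  have h2 : ‖(1 : Matrix (Fin d) (Fin d) ℝ)‖ ≤ 1 := by
    rw [← Matrix.diagonal_one, Matrix.l2_opNorm_diagonal]
    exact (pi_norm_le_iff_of_nonneg zero_le_one).2 fun i => by simp
  nlinarith [norm_nonneg A]

theorem norm_mulVec_of_transpose_mul_self {n d : ℕ} {A : Matrix (Fin n) (Fin d) ℝ}
    (h : Aᵀ * A = 1) (x : Fin d → ℝ) :
    ‖(WithLp.toLp 2 (A *ᵥ x) : EuclideanSpace ℝ (Fin n))‖ =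
      ‖(WithLp.toLp 2 x : EuclideanSpace ℝ (Fin d))‖ := by
  refine le_antisymm ?_ ?_
  · refine (norm_mulVec_le A x).trans ?_
    have := norm_le_one_of_transpose_mul_self h
    nlinarith [norm_nonneg (WithLp.toLp 2 x : EuclideanSpace ℝ (Fin d))]
  · have h1 : x = Aᵀ *ᵥ (A *ᵥ x) := by rw [Matrix.mulVec_mulVec, h, Matrix.one_mulVec]
    conv_lhs => rw [h1]
    refine (norm_mulVec_le Aᵀ _).trans ?_
    have := norm_le_one_of_transpose_mul_self h
    rw [norm_transpose_eq]
    nlinarith [norm_nonneg (WithLp.toLp 2 (A *ᵥ x) : EuclideanSpace ℝ (Fin n))]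

/-! ### Nearby orthogonal matrices -/

/-- Take the orthogonal polar factor `W = B D^(-1/2)` with `D = Bᵀ B`. Then `B - W = W (√D - 1)`,
and `|√x - 1| ≤ |x - 1|` on the spectrum of `D`. -/
theorem exists_orthogonal_norm_sub_le {k : ℕ} (B : Matrix (Fin k) (Fin k) ℝ) (hB : ‖B‖ ≤ 1) :
    ∃ W : Matrix.orthogonalGroup (Fin k) ℝ,
      ‖B - (W : Matrix (Fin k) (Fin k) ℝ)‖ ≤ 2 * ‖1 - Bᵀ * B‖ := by
  set D : Matrix (Fin k) (Fin k) ℝ := Bᵀ * B with hD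
  have hone : ‖(1 : Matrix (Fin k) (Fin k) ℝ)‖ ≤ 1 :=
    norm_le_one_of_transpose_mul_self (by simp)
  -- Here `D` may be singular and have no inverse square root. Any orthogonal matrix then serves,
  -- since `‖B - W‖ ≤ 2`; this case alone needs the factor `2`.
  by_cases hη : 1 ≤ ‖1 - D‖
  · refine ⟨1, ?_⟩
    have := norm_sub_le B 1
    simp only [OneMemClass.coe_one]
    linarith
  push Not at hη
  have hsa : IsSelfAdjoint D := by
    rw [← Matrix.isHermitian_iff_isSelfAdjoint]
    simp [Matrix.IsHermitian, hD, Matrix.conjTranspose_eq_transpose_of_trivial]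
  have hcont : ∀ f : ℝ → ℝ, ContinuousOn f (spectrum ℝ D) := fun f =>
    Set.Finite.continuousOn Matrix.finite_real_spectrum f
  have hsp : ∀ x ∈ spectrum ℝ D, |1 - x| ≤ ‖1 - D‖ := by
    have h1 : cfc (fun x : ℝ => 1 - x) D = 1 - D := by
      rw [cfc_sub (fun _ => 1) (fun x => x) D (hcont _) (hcont _), cfc_const_one ℝ D,
        cfc_id' ℝ D]
    intro x hx
    rw [← h1]
    exact norm_apply_le_norm_cfc (fun x : ℝ => 1 - x) D hx (hcont _)
  have hpos : ∀ x ∈ spectrum ℝ D, 0 < x := fun x hx => by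
    have := (abs_le.1 (hsp x hx)).2; linarith
  set T := cfc (fun x : ℝ => 1 / √x) D
  have hTsa : Tᵀ = T := by
    have : IsSelfAdjoint T := cfc_predicate _ D
    rw [← Matrix.isHermitian_iff_isSelfAdjoint] at this
    rw [← Matrix.conjTranspose_eq_transpose_of_trivial]; exact this
  have hid : cfc (fun x : ℝ => x) D = D := cfc_id' ℝ D
  have hDT : D * T = cfc (fun x : ℝ => √x) D := by
    conv_lhs => rw [← hid]
    rw [← cfc_mul _ _ D (hcont _) (hcont _)]
    refine cfc_congr fun x hx => ?_
    have := Real.sqrt_pos.2 (hpos x hx)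
    have h2 := Real.mul_self_sqrt (hpos x hx).le
    field_simp
    nlinarith
  have hWW : (B * T)ᵀ * (B * T) = 1 := by
    rw [Matrix.transpose_mul, hTsa, Matrix.mul_assoc, ← Matrix.mul_assoc Bᵀ, ← hD, hDT,
      ← cfc_mul _ _ D (hcont _) (hcont _), ← cfc_const_one ℝ D]
    refine cfc_congr fun x hx => ?_
    have := Real.sqrt_pos.2 (hpos x hx)
    field_simp
  refine ⟨⟨B * T, ?_⟩, ?_⟩
  · exact (Matrix.mem_orthogonalGroup_iff' _ _).2 hWW
  · have h1 : B - B * T = (B * T) * (cfc (fun x : ℝ => √x - 1) D) := by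
      rw [Matrix.mul_assoc, ← cfc_mul _ _ D (hcont _) (hcont _)]
      have : B - B * T = B * (1 - T) := by rw [Matrix.mul_sub, Matrix.mul_one]
      rw [this]
      congr 1
      rw [← cfc_const_one ℝ D, ← cfc_sub _ _ D (hcont _) (hcont _)]
      refine cfc_congr fun x hx => ?_
      have := Real.sqrt_pos.2 (hpos x hx)
      field_simp
    change ‖B - B * T‖ ≤ _
    rw [h1]
    have h2 : ‖cfc (fun x : ℝ => √x - 1) D‖ ≤ ‖1 - D‖ := by
      refine norm_cfc_le (norm_nonneg _) fun x hx => ?_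
      refine le_trans ?_ (hsp x hx)
      have h3 := Real.sqrt_pos.2 (hpos x hx)
      have h4 := Real.mul_self_sqrt (hpos x hx).le
      rw [Real.norm_eq_abs, abs_sub_comm 1 x]
      have : x - 1 = (√x - 1) * (√x + 1) := by linarith
      rw [this, abs_mul, abs_of_pos (by linarith : 0 < √x + 1)]
      nlinarith [abs_nonneg (√x - 1)]
    have h3 := norm_le_one_of_transpose_mul_self hWW
    have h4 := Matrix.l2_opNorm_mul (B * T) (cfc (fun x : ℝ => √x - 1) D)
    nlinarith [norm_nonneg (B * T), norm_nonneg (1 - D), norm_nonneg (cfc (fun x : ℝ => √x - 1) D)]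

end Deterministic

/-! ### The spectral projection of a perturbed low-rank matrix -/

/-- A continuous function that vanishes on `|x| ≤ 3 ε` and equals `1` on `|x| ≥ L / 2`. -/
noncomputable def cutoff (ε L x : ℝ) : ℝ := min 1 (max 0 ((|x| - 3 * ε) / (L / 2 - 3 * ε)))

theorem continuous_cutoff (ε L : ℝ) : Continuous (cutoff ε L) := by
  unfold cutoff; fun_prop

theorem cutoff_eq_zero {ε L x : ℝ} (hε : 0 < ε) (hL : 8 * ε ≤ L) (hx : |x| ≤ 3 * ε) :
    cutoff ε L x = 0 := by
  have : (|x| - 3 * ε) / (L / 2 - 3 * ε) ≤ 0 :=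
    div_nonpos_of_nonpos_of_nonneg (by linarith) (by linarith)
  simp [cutoff, max_eq_left this]

theorem cutoff_eq_one {ε L x : ℝ} (hε : 0 < ε) (hL : 8 * ε ≤ L) (hx : L / 2 ≤ |x|) :
    cutoff ε L x = 1 := by
  have : 1 ≤ (|x| - 3 * ε) / (L / 2 - 3 * ε) := by
    rw [le_div_iff₀ (by linarith)]; linarith
  simp [cutoff, this]

section Deterministic

open scoped Matrix.Norms.L2Operator

/-- The spectral projection onto the eigenvalues of `A` of modulus at least `L / 2`, when no
eigenvalue of `A` has modulus strictly between `3 ε` and `L / 2`. -/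
noncomputable def spectralCut {n : ℕ} (ε L : ℝ) (A : Matrix (Fin n) (Fin n) ℝ) :
    Matrix (Fin n) (Fin n) ℝ := cfc (cutoff ε L) A

/-- The inverse of `A` on the range of `spectralCut ε L A`, and zero on its complement. -/
noncomputable def spectralInv {n : ℕ} (ε L : ℝ) (A : Matrix (Fin n) (Fin n) ℝ) :
    Matrix (Fin n) (Fin n) ℝ := cfc (fun x => cutoff ε L x / x) A

/-- `M = U diag(lam) Uᵀ` has nonzero eigenvalues of modulus at least `L`, and the symmetric
perturbation `E` has norm at most `ε ≤ L / 8`. -/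
structure IsSmallPerturbation {n k : ℕ} (M : Matrix (Fin n) (Fin n) ℝ)
    (U : Matrix (Fin n) (Fin k) ℝ) (lam : Fin k → ℝ) (E : Matrix (Fin n) (Fin n) ℝ)
    (ε L : ℝ) : Prop where
  eigen : IsReducedEigendecomposition M U lam
  symm : E.IsSymm
  pos : 0 < ε
  le_lam : ∀ i, L ≤ |lam i|
  small : 8 * ε ≤ L
  norm_le : ‖E‖ ≤ ε

/-- The spectrum of a matrix is finite, so the functional calculus of one fixed matrix accepts every
function, including `x ↦ cutoff ε L x / x`. -/
theorem continuousOn_spectrum {n : ℕ} (A : Matrix (Fin n) (Fin n) ℝ) (f : ℝ → ℝ) :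
    ContinuousOn f (spectrum ℝ A) := Set.Finite.continuousOn Matrix.finite_real_spectrum f

theorem isSelfAdjoint_of_isSymm {n : ℕ} {A : Matrix (Fin n) (Fin n) ℝ} (h : A.IsSymm) :
    IsSelfAdjoint A := by
  rw [← Matrix.isHermitian_iff_isSelfAdjoint]
  exact (Matrix.conjTranspose_eq_transpose_of_trivial A).trans h

theorem transpose_cfc {n : ℕ} (f : ℝ → ℝ) (A : Matrix (Fin n) (Fin n) ℝ) :
    (cfc f A)ᵀ = cfc f A := by
  have : IsSelfAdjoint (cfc f A) := cfc_predicate _ A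
  rw [← Matrix.isHermitian_iff_isSelfAdjoint] at this
  rw [← Matrix.conjTranspose_eq_transpose_of_trivial]; exact this

theorem exists_eigenvector {n : ℕ} {A : Matrix (Fin n) (Fin n) ℝ} (hA : A.IsSymm) {μ : ℝ}
    (hμ : μ ∈ spectrum ℝ A) :
    ∃ v : Fin n → ℝ, ‖(WithLp.toLp 2 v : EuclideanSpace ℝ (Fin n))‖ = 1 ∧ A *ᵥ v = μ • v := by
  have hH : A.IsHermitian := (Matrix.isHermitian_iff_isSelfAdjoint).2 (isSelfAdjoint_of_isSymm hA)
  rw [hH.spectrum_real_eq_range_eigenvalues] at hμ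
  obtain ⟨i, rfl⟩ := hμ
  refine ⟨(hH.eigenvectorBasis i).ofLp, hH.eigenvectorBasis.orthonormal.1 i, ?_⟩
  exact hH.mulVec_eigenvectorBasis i

theorem IsReducedEigendecomposition.isSymm {n k : ℕ} {M : Matrix (Fin n) (Fin n) ℝ}
    {U : Matrix (Fin n) (Fin k) ℝ} {lam : Fin k → ℝ} (h : IsReducedEigendecomposition M U lam) :
    M.IsSymm := by
  rw [Matrix.IsSymm, h.eq]
  simp [Matrix.transpose_mul, Matrix.mul_assoc]

theorem IsReducedEigendecomposition.transpose_mul {n k : ℕ} {M : Matrix (Fin n) (Fin n) ℝ}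
    {U : Matrix (Fin n) (Fin k) ℝ} {lam : Fin k → ℝ} (h : IsReducedEigendecomposition M U lam) :
    Uᵀ * M = Matrix.diagonal lam * Uᵀ := by
  rw [h.eq, ← Matrix.mul_assoc, ← Matrix.mul_assoc, h.orthonormal, Matrix.one_mul]

theorem IsReducedEigendecomposition.proj_mul {n k : ℕ} {M : Matrix (Fin n) (Fin n) ℝ}
    {U : Matrix (Fin n) (Fin k) ℝ} {lam : Fin k → ℝ} (h : IsReducedEigendecomposition M U lam) :
    U * Uᵀ * M = M := by
  rw [Matrix.mul_assoc, h.transpose_mul, ← Matrix.mul_assoc, ← h.eq]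

theorem le_norm_diagonal_mulVec {k : ℕ} {lam : Fin k → ℝ} {L : ℝ} (hL : 0 ≤ L)
    (h : ∀ i, L ≤ |lam i|) (x : Fin k → ℝ) :
    L * ‖(WithLp.toLp 2 x : EuclideanSpace ℝ (Fin k))‖ ≤
      ‖(WithLp.toLp 2 (Matrix.diagonal lam *ᵥ x) : EuclideanSpace ℝ (Fin k))‖ := by
  refine le_of_sq_le_sq ?_ (norm_nonneg _)
  rw [mul_pow, EuclideanSpace.norm_sq_eq, EuclideanSpace.norm_sq_eq, Finset.mul_sum]
  refine Finset.sum_le_sum fun i _ => ?_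
  simp only [Matrix.mulVec_diagonal, norm_mul, mul_pow, Real.norm_eq_abs]
  exact mul_le_mul_of_nonneg_right (pow_le_pow_left₀ hL (h i) 2) (by positivity)

namespace IsSmallPerturbation

variable {n k : ℕ} {M : Matrix (Fin n) (Fin n) ℝ} {U : Matrix (Fin n) (Fin k) ℝ}
  {lam : Fin k → ℝ} {E : Matrix (Fin n) (Fin n) ℝ} {ε L : ℝ}

theorem L_pos (h : IsSmallPerturbation M U lam E ε L) : 0 < L := by
  linarith [h.pos, h.small]

theorem isSymm_add (h : IsSmallPerturbation M U lam E ε L) : (M + E).IsSymm :=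
  h.eigen.isSymm.add h.symm

theorem norm_U_le (h : IsSmallPerturbation M U lam E ε L) : ‖U‖ ≤ 1 :=
  norm_le_one_of_transpose_mul_self h.eigen.orthonormal

theorem norm_Ut_le (h : IsSmallPerturbation M U lam E ε L) : ‖Uᵀ‖ ≤ 1 :=
  (norm_transpose_eq U).trans_le h.norm_U_le

/-- Apply `Uᵀ` to the equation of a unit eigenvector `v`: `Λ Uᵀv = μ Uᵀv - UᵀEv`. If `|μ| < L/2`,
the first term on the right has at most half the norm of the left side, so `‖Λ Uᵀv‖ ≤ 2ε`. Then `|μ|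
= ‖U Λ Uᵀv + Ev‖ ≤ 3ε`. -/
theorem spectral_gap (h : IsSmallPerturbation M U lam E ε L) {μ : ℝ}
    (hμ : μ ∈ spectrum ℝ (M + E)) : |μ| ≤ 3 * ε ∨ L / 2 ≤ |μ| := by
  obtain ⟨v, hv, hAv⟩ := exists_eigenvector h.isSymm_add hμ
  by_cases hlt : L / 2 ≤ |μ|
  · exact Or.inr hlt
  push Not at hlt
  left
  have hε := h.pos
  have hs := h.small
  have hLp := h.L_pos
  have e1 : Matrix.diagonal lam *ᵥ (Uᵀ *ᵥ v) = μ • (Uᵀ *ᵥ v) - Uᵀ *ᵥ (E *ᵥ v) := by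
    have : Uᵀ *ᵥ ((M + E) *ᵥ v) = μ • (Uᵀ *ᵥ v) := by rw [hAv, Matrix.mulVec_smul]
    rw [← this, Matrix.add_mulVec, Matrix.mulVec_add, Matrix.mulVec_mulVec v Uᵀ M,
      h.eigen.transpose_mul, ← Matrix.mulVec_mulVec]
    abel
  have hEv : ‖(WithLp.toLp 2 (E *ᵥ v) : EuclideanSpace ℝ (Fin n))‖ ≤ ε := by
    refine (norm_mulVec_le E v).trans ?_
    rw [hv, mul_one]; exact h.norm_le
  have hUEv : ‖(WithLp.toLp 2 (Uᵀ *ᵥ (E *ᵥ v)) : EuclideanSpace ℝ (Fin k))‖ ≤ ε := by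
    refine (norm_mulVec_le Uᵀ _).trans ?_
    have := h.norm_Ut_le
    nlinarith [norm_nonneg (WithLp.toLp 2 (E *ᵥ v) : EuclideanSpace ℝ (Fin n)), norm_nonneg Uᵀ]
  set z : EuclideanSpace ℝ (Fin k) := WithLp.toLp 2 (Uᵀ *ᵥ v) with hz
  set w : EuclideanSpace ℝ (Fin k) := WithLp.toLp 2 (Matrix.diagonal lam *ᵥ (Uᵀ *ᵥ v)) with hw
  have e2 : w = μ • z - WithLp.toLp 2 (Uᵀ *ᵥ (E *ᵥ v)) := by
    rw [hw, e1]; rfl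
  have h1 : ‖w‖ ≤ |μ| * ‖z‖ + ε := by
    rw [e2]
    refine (norm_sub_le _ _).trans ?_
    rw [norm_smul, Real.norm_eq_abs]; linarith
  have h2 : L * ‖z‖ ≤ ‖w‖ := le_norm_diagonal_mulVec h.L_pos.le h.le_lam _
  have h3 : ‖w‖ ≤ 2 * ε := by nlinarith [norm_nonneg z]
  have e3 : μ • (WithLp.toLp 2 v : EuclideanSpace ℝ (Fin n)) =
      WithLp.toLp 2 (U *ᵥ (Matrix.diagonal lam *ᵥ (Uᵀ *ᵥ v))) + WithLp.toLp 2 (E *ᵥ v) := by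
    have : μ • v = U *ᵥ (Matrix.diagonal lam *ᵥ (Uᵀ *ᵥ v)) + E *ᵥ v := by
      rw [← hAv, Matrix.add_mulVec, h.eigen.eq, Matrix.mulVec_mulVec, Matrix.mulVec_mulVec]
    exact congrArg (WithLp.toLp 2) this
  have h4 := congrArg norm e3
  rw [norm_smul, hv, mul_one, Real.norm_eq_abs] at h4
  rw [h4]
  refine (norm_add_le _ _).trans ?_
  rw [norm_mulVec_of_transpose_mul_self h.eigen.orthonormal]
  linarith

theorem cut_mul_self (h : IsSmallPerturbation M U lam E ε L) :
    spectralCut ε L (M + E) * spectralCut ε L (M + E) = spectralCut ε L (M + E) := by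
  unfold spectralCut
  rw [← cfc_mul _ _ _ (continuousOn_spectrum _ _) (continuousOn_spectrum _ _)]
  refine cfc_congr fun x hx => ?_
  rcases h.spectral_gap hx with hx | hx
  · simp [cutoff_eq_zero h.pos h.small hx]
  · simp [cutoff_eq_one h.pos h.small hx]

theorem norm_cut_le (h : IsSmallPerturbation M U lam E ε L) : ‖spectralCut ε L (M + E)‖ ≤ 1 := by
  refine norm_cfc_le zero_le_one fun x hx => ?_
  rcases h.spectral_gap hx with hx | hx
  · simp [cutoff_eq_zero h.pos h.small hx]
  · simp [cutoff_eq_one h.pos h.small hx]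

theorem one_sub_cut (h : IsSmallPerturbation M U lam E ε L) :
    1 - spectralCut ε L (M + E) = cfc (fun x => 1 - cutoff ε L x) (M + E) := by
  have hsa := isSelfAdjoint_of_isSymm h.isSymm_add
  rw [cfc_sub (fun _ => 1) _ _ (continuousOn_spectrum _ _) (continuousOn_spectrum _ _),
    cfc_const_one ℝ _, spectralCut]

theorem norm_one_sub_cut_le (h : IsSmallPerturbation M U lam E ε L) :
    ‖1 - spectralCut ε L (M + E)‖ ≤ 1 := by
  rw [h.one_sub_cut]
  refine norm_cfc_le zero_le_one fun x hx => ?_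
  rcases h.spectral_gap hx with hx | hx
  · simp [cutoff_eq_zero h.pos h.small hx]
  · simp [cutoff_eq_one h.pos h.small hx]

theorem norm_pow_mul_one_sub_cut_le (h : IsSmallPerturbation M U lam E ε L) (g : ℕ) :
    ‖(M + E) ^ g * (1 - spectralCut ε L (M + E))‖ ≤ (3 * ε) ^ g := by
  have hsa := isSelfAdjoint_of_isSymm h.isSymm_add
  have hε := h.pos
  rw [h.one_sub_cut, ← cfc_pow_id (R := ℝ) (M + E) g,
    ← cfc_mul _ _ _ (continuousOn_spectrum _ _) (continuousOn_spectrum _ _)]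
  refine norm_cfc_le (by positivity) fun x hx => ?_
  rcases h.spectral_gap hx with hx | hx
  · simpa [cutoff_eq_zero h.pos h.small hx] using pow_le_pow_left₀ (abs_nonneg x) hx g
  · simp [cutoff_eq_one h.pos h.small hx]; positivity

theorem mul_inv (h : IsSmallPerturbation M U lam E ε L) :
    (M + E) * spectralInv ε L (M + E) = spectralCut ε L (M + E) := by
  have hsa := isSelfAdjoint_of_isSymm h.isSymm_add
  unfold spectralInv spectralCut
  conv_lhs => enter [1]; rw [← cfc_id' ℝ (M + E)]
  rw [← cfc_mul _ _ _ (continuousOn_spectrum _ _) (continuousOn_spectrum _ _)]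
  refine cfc_congr fun x hx => ?_
  rcases h.spectral_gap hx with hx | hx
  -- A zero eigenvalue falls here: the cutoff vanishes, so the value given to division by zero is
  -- harmless.
  · simp [cutoff_eq_zero h.pos h.small hx]
  · have : x ≠ 0 := by
      rintro rfl
      have := h.L_pos
      simp at hx; linarith
    field_simp

theorem commute_inv (h : IsSmallPerturbation M U lam E ε L) :
    Commute (M + E) (spectralInv ε L (M + E)) := by
  have hsa := isSelfAdjoint_of_isSymm h.isSymm_add
  have := cfc_commute_cfc (R := ℝ) (fun x => x) (fun x => cutoff ε L x / x) (M + E)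
  rwa [cfc_id' ℝ (M + E)] at this

theorem commute_cut (h : IsSmallPerturbation M U lam E ε L) :
    Commute (M + E) (spectralCut ε L (M + E)) := by
  rw [← h.mul_inv]
  exact (Commute.refl _).mul_right h.commute_inv

theorem norm_inv_le (h : IsSmallPerturbation M U lam E ε L) :
    ‖spectralInv ε L (M + E)‖ ≤ 2 / L := by
  have := h.L_pos
  refine norm_cfc_le (by positivity) fun x hx => ?_
  rcases h.spectral_gap hx with hx | hx
  · simp [cutoff_eq_zero h.pos h.small hx]; positivity
  · rw [cutoff_eq_one h.pos h.small hx, norm_div, norm_one, Real.norm_eq_abs,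
      div_le_div_iff₀ (by linarith) this]
    linarith

/-- `1 - U Uᵀ` annihilates `M`, so applying it to `Q = (M + E) R` leaves `(1 - U Uᵀ) E R`, with `‖R‖
≤ 2 / L`. -/
theorem norm_one_sub_proj_mul_cut_le (h : IsSmallPerturbation M U lam E ε L) :
    ‖(1 - U * Uᵀ) * spectralCut ε L (M + E)‖ ≤ 2 * ε / L := by
  have hLp := h.L_pos
  have hε := h.pos
  have e : (1 - U * Uᵀ) * spectralCut ε L (M + E) =
      (1 - U * Uᵀ) * (E * spectralInv ε L (M + E)) := by
    rw [← h.mul_inv, Matrix.add_mul, Matrix.mul_add, ← Matrix.mul_assoc _ M, Matrix.sub_mul,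
      Matrix.one_mul, h.eigen.proj_mul]
    simp
  have hP : ‖(1 - U * Uᵀ : Matrix (Fin n) (Fin n) ℝ)‖ ≤ 1 := by
    set S : Matrix (Fin n) (Fin n) ℝ := 1 - U * Uᵀ
    have hS : Sᴴ * S = S := by
      have hPP : U * Uᵀ * (U * Uᵀ) = U * Uᵀ := by
        rw [Matrix.mul_assoc, ← Matrix.mul_assoc Uᵀ, h.eigen.orthonormal, Matrix.one_mul]
      simp only [S, Matrix.conjTranspose_eq_transpose_of_trivial, Matrix.transpose_sub,
        Matrix.transpose_mul, Matrix.transpose_transpose, Matrix.transpose_one]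
      rw [Matrix.sub_mul, Matrix.one_mul, Matrix.mul_sub, Matrix.mul_one, hPP]
      simp
    have := Matrix.l2_opNorm_conjTranspose_mul_self S
    rw [hS] at this
    by_contra! hgt
    nlinarith [norm_nonneg S]
  rw [e]
  refine (Matrix.l2_opNorm_mul _ _).trans ?_
  have h2 := Matrix.l2_opNorm_mul E (spectralInv ε L (M + E))
  have h3 : ‖E‖ * ‖spectralInv ε L (M + E)‖ ≤ ε * (2 / L) :=
    mul_le_mul h.norm_le h.norm_inv_le (norm_nonneg _) hε.le
  have : ε * (2 / L) = 2 * ε / L := by ring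
  nlinarith [norm_nonneg (E * spectralInv ε L (M + E))]

/-- With `S = 1 - Q`, one has `Λ Uᵀ S = Uᵀ (M + E) S - Uᵀ E S`. The two terms are at most `3ε` and
`ε`, and `Λ` expands by at least `L`. -/
theorem norm_Ut_mul_one_sub_cut_le (h : IsSmallPerturbation M U lam E ε L) :
    ‖Uᵀ * (1 - spectralCut ε L (M + E))‖ ≤ 4 * ε / L := by
  have hLp := h.L_pos
  have hε := h.pos
  set S := 1 - spectralCut ε L (M + E)
  have e : Matrix.diagonal lam * (Uᵀ * S) = Uᵀ * ((M + E) * S) - Uᵀ * (E * S) := by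
    rw [← Matrix.mul_assoc, ← h.eigen.transpose_mul, Matrix.add_mul, Matrix.mul_add,
      Matrix.mul_assoc]
    abel
  have h1 : ‖(M + E) * S‖ ≤ 3 * ε := by
    simpa using h.norm_pow_mul_one_sub_cut_le 1
  have h2 : ‖E * S‖ ≤ ε := by
    refine (Matrix.l2_opNorm_mul _ _).trans ?_
    have := h.norm_one_sub_cut_le
    have := h.norm_le
    nlinarith [norm_nonneg E, norm_nonneg S]
  have h3 : ‖Matrix.diagonal lam * (Uᵀ * S)‖ ≤ 4 * ε := by
    rw [e]
    refine (norm_sub_le _ _).trans ?_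
    have h4 := Matrix.l2_opNorm_mul Uᵀ ((M + E) * S)
    have h5 := Matrix.l2_opNorm_mul Uᵀ (E * S)
    have := h.norm_Ut_le
    nlinarith [norm_nonneg ((M + E) * S), norm_nonneg (E * S), norm_nonneg Uᵀ]
  refine norm_le_of_mulVec_le (by positivity) fun x => ?_
  have h4 := le_norm_diagonal_mulVec hLp.le h.le_lam ((Uᵀ * S) *ᵥ x)
  rw [Matrix.mulVec_mulVec] at h4
  have h5 := norm_mulVec_le (Matrix.diagonal lam * (Uᵀ * S)) x
  rw [div_mul_eq_mul_div, le_div_iff₀ hLp]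
  nlinarith [norm_nonneg (WithLp.toLp 2 x : EuclideanSpace ℝ (Fin n))]

end IsSmallPerturbation

/-! ### Lower bounds for singular values -/

/-- One half of the Courant–Fischer principle, with the `k`-dimensional test space given as the
range of `T`. -/
theorem le_singVal {n m k : ℕ} (hk : 0 < k) (Y : Matrix (Fin n) (Fin m) ℝ)
    (T : Matrix (Fin m) (Fin k) ℝ) (hT : Function.Injective T.mulVec) {t : ℝ}
    (h : ∀ z, t * ‖(WithLp.toLp 2 (T *ᵥ z) : EuclideanSpace ℝ (Fin m))‖ ≤
      ‖(WithLp.toLp 2 (Y *ᵥ (T *ᵥ z)) : EuclideanSpace ℝ (Fin n))‖) :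
    t ≤ singVal Y (k - 1) := by
  by_contra! hlt
  set Φ := Matrix.toEuclideanLin Y with hΦ
  have hfin : Module.finrank ℝ (EuclideanSpace ℝ (Fin m)) = m := by simp
  have hkm : k ≤ m := by
    have := LinearMap.finrank_le_finrank_of_injective (f := T.mulVecLin) hT
    simpa using this
  have hkm' : k - 1 < m := by omega
  set b := Φ.isSymmetric_adjoint_comp_self.eigenvectorBasis hfin
  set ev := Φ.isSymmetric_adjoint_comp_self.eigenvalues hfin with hev
  -- Coefficients of `T z` along the top `k - 1` right singular vectors. There are `k - 1`
  -- conditions on `k` unknowns, so some nonzero `T z` is orthogonal to all of them, and `Y`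
  -- stretches it by at most the `k`-th singular value.
  let Cm : (Fin k → ℝ) →ₗ[ℝ] (Fin (k - 1) → ℝ) :=
    { toFun := fun z i => inner ℝ (b ⟨i, by omega⟩)
        (WithLp.toLp 2 (T *ᵥ z) : EuclideanSpace ℝ (Fin m))
      map_add' := fun x y => by
        ext i
        simp only [Matrix.mulVec_add, WithLp.toLp_add, inner_add_right, Pi.add_apply]
      map_smul' := fun c x => by
        ext i
        simp only [Matrix.mulVec_smul, WithLp.toLp_smul, inner_smul_right, Pi.smul_apply,
          smul_eq_mul, RingHom.id_apply] }
  have hker : LinearMap.ker Cm ≠ ⊥ := LinearMap.ker_ne_bot_of_finrank_lt (by simp; omega)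
  obtain ⟨z, hz, hz0⟩ := Submodule.exists_mem_ne_zero_of_ne_bot hker
  have hzC : ∀ i : Fin (k - 1), inner ℝ (b ⟨i, by omega⟩)
      (WithLp.toLp 2 (T *ᵥ z) : EuclideanSpace ℝ (Fin m)) = 0 := fun i =>
    congrFun (LinearMap.mem_ker.1 hz) i
  set x : EuclideanSpace ℝ (Fin m) := WithLp.toLp 2 (T *ᵥ z) with hx
  have hx0 : 0 < ‖x‖ := by
    rw [norm_pos_iff]
    intro h0
    apply hz0
    apply hT
    rw [Matrix.mulVec_zero]
    exact congrArg WithLp.ofLp h0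
  have hσ0 : 0 ≤ singVal Y (k - 1) := Φ.singularValues_nonneg _
  have hσ : singVal Y (k - 1) ^ 2 = ev ⟨k - 1, hkm'⟩ := Φ.sq_singularValues_of_lt hfin hkm'
  have hΦx : ‖Φ x‖ ^ 2 ≤ singVal Y (k - 1) ^ 2 * ‖x‖ ^ 2 := by
    have e1 : ‖Φ x‖ ^ 2 = inner ℝ ((LinearMap.adjoint Φ ∘ₗ Φ) x) x := by
      rw [LinearMap.comp_apply, LinearMap.adjoint_inner_left, real_inner_self_eq_norm_sq]
    rw [e1, ← b.sum_inner_mul_inner, ← b.sum_sq_inner_right x, Finset.mul_sum]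
    refine Finset.sum_le_sum fun i _ => ?_
    have e2 : inner ℝ ((LinearMap.adjoint Φ ∘ₗ Φ) x) (b i) = ev i * inner ℝ (b i) x := by
      rw [Φ.isSymmetric_adjoint_comp_self x (b i),
        Φ.isSymmetric_adjoint_comp_self.apply_eigenvectorBasis hfin i, inner_smul_right,
        real_inner_comm]
      rfl
    rw [e2]
    by_cases hi : (i : ℕ) < k - 1
    · have := hzC ⟨i, hi⟩
      have h0 : inner ℝ (b i) x = 0 := this
      rw [h0]; simp
    · have h1 : ev i ≤ ev ⟨k - 1, hkm'⟩ :=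
        Φ.isSymmetric_adjoint_comp_self.eigenvalues_antitone hfin
          (show (⟨k - 1, hkm'⟩ : Fin m) ≤ i by rw [Fin.le_def]; simpa using hi)
      rw [hσ]
      nlinarith [sq_nonneg (inner ℝ (b i) x)]
  have h1 : t * ‖x‖ ≤ ‖Φ x‖ := h z
  have h2 : ‖Φ x‖ ≤ singVal Y (k - 1) * ‖x‖ :=
    le_of_sq_le_sq (by rw [mul_pow]; exact hΦx) (by positivity)
  nlinarith

namespace IsSmallPerturbation

variable {n k m : ℕ} {M : Matrix (Fin n) (Fin n) ℝ} {U : Matrix (Fin n) (Fin k) ℝ}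
  {lam : Fin k → ℝ} {E : Matrix (Fin n) (Fin n) ℝ} {ε L : ℝ}

/-- If `Q U z = 0` then `z = Uᵀ (1 - Q) U z`, which has norm at most `(4ε/L) ‖z‖ < ‖z‖` unless `z =
0`. -/
theorem cut_mul_U_injective (h : IsSmallPerturbation M U lam E ε L) :
    Function.Injective (spectralCut ε L (M + E) * U).mulVec := by
  have hLp := h.L_pos
  have : Function.Injective (spectralCut ε L (M + E) * U).mulVecLin := by
    refine (injective_iff_map_eq_zero _).2 fun z hz => ?_
    rw [Matrix.mulVecLin_apply] at hz
    by_contra hne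
    have e : Uᵀ *ᵥ (U *ᵥ z) = (Uᵀ * (1 - spectralCut ε L (M + E))) *ᵥ (U *ᵥ z) := by
      rw [Matrix.mul_sub, Matrix.sub_mulVec, Matrix.mul_one, ← Matrix.mulVec_mulVec _ _
        (spectralCut ε L (M + E)), Matrix.mulVec_mulVec z (spectralCut ε L (M + E)) U, hz]
      simp
    rw [Matrix.mulVec_mulVec, h.eigen.orthonormal, Matrix.one_mulVec] at e
    have h1 := norm_mulVec_le (Uᵀ * (1 - spectralCut ε L (M + E))) (U *ᵥ z)
    rw [← e, norm_mulVec_of_transpose_mul_self h.eigen.orthonormal] at h1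
    have h2 : 4 * ε / L < 1 := by
      rw [div_lt_one hLp]; linarith [h.small, h.pos]
    have h3 := h.norm_Ut_mul_one_sub_cut_le
    have h4 : 0 < ‖(WithLp.toLp 2 z : EuclideanSpace ℝ (Fin k))‖ := by
      rw [norm_pos_iff]
      exact fun h0 => hne (congrArg WithLp.ofLp h0)
    nlinarith
  exact this

/-- The range of `Q` has dimension exactly `k`: `Uᵀ` is injective on it because `‖(1 - U Uᵀ) Q‖ <
1`, and it contains the injective image of `Q U`. The columns of `W` are an orthonormal basis of it.
-/
theorem exists_orthonormal_range_cut (h : IsSmallPerturbation M U lam E ε L) :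
    ∃ W : Matrix (Fin n) (Fin k) ℝ, Wᵀ * W = 1 ∧
      W * Wᵀ * spectralCut ε L (M + E) = spectralCut ε L (M + E) := by
  have hLp := h.L_pos
  set Q := spectralCut ε L (M + E) with hQ
  set F : Submodule ℝ (EuclideanSpace ℝ (Fin n)) := LinearMap.range (Matrix.toEuclideanLin Q)
  have hle : Module.finrank ℝ F ≤ k := by
    have hinj : Function.Injective ((Matrix.toEuclideanLin Uᵀ).domRestrict F) := by
      refine (injective_iff_map_eq_zero _).2 ?_
      rintro ⟨x, y, rfl⟩ hx
      have hx' : Uᵀ *ᵥ (Q *ᵥ y.ofLp) = 0 := congrArg WithLp.ofLp hx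
      have e : Q *ᵥ y.ofLp = ((1 - U * Uᵀ) * Q) *ᵥ (Q *ᵥ y.ofLp) := by
        rw [Matrix.mulVec_mulVec, Matrix.mul_assoc, h.cut_mul_self, Matrix.sub_mul, Matrix.one_mul,
          Matrix.sub_mulVec, Matrix.mul_assoc, ← Matrix.mulVec_mulVec _ U, ← Matrix.mulVec_mulVec,
          hx']
        simp [hQ]
      have h1 := norm_mulVec_le ((1 - U * Uᵀ) * Q) (Q *ᵥ y.ofLp)
      rw [← e] at h1
      have h2 := h.norm_one_sub_proj_mul_cut_le
      have h3 : 2 * ε / L < 1 := by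
        rw [div_lt_one hLp]; linarith [h.small, h.pos]
      have h4 : ‖(WithLp.toLp 2 (Q *ᵥ y.ofLp) : EuclideanSpace ℝ (Fin n))‖ ≤ 0 := by
        by_contra! hpos
        nlinarith
      have h5 := norm_le_zero_iff.1 h4
      exact Subtype.ext h5
    have := LinearMap.finrank_le_finrank_of_injective hinj
    simpa using this
  have hge : k ≤ Module.finrank ℝ F := by
    let T : (Fin k → ℝ) →ₗ[ℝ] F := LinearMap.codRestrict F
      ((Matrix.toEuclideanLin (Q * U)) ∘ₗ (WithLp.linearEquiv 2 ℝ (Fin k → ℝ)).symm.toLinearMap)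
      (fun z => ⟨WithLp.toLp 2 (U *ᵥ z), by
        simp [Matrix.toLpLin_apply, Matrix.mulVec_mulVec]⟩)
    have hT : Function.Injective T := by
      intro x y hxy
      have := congrArg (fun f : F => WithLp.ofLp (f : EuclideanSpace ℝ (Fin n))) hxy
      exact h.cut_mul_U_injective this
    have := LinearMap.finrank_le_finrank_of_injective hT
    simpa using this
  have hF : Module.finrank ℝ F = k := le_antisymm hle hge
  let b : OrthonormalBasis (Fin k) ℝ F := (stdOrthonormalBasis ℝ F).reindex (finCongr hF)
  refine ⟨Matrix.of fun i j => (b j : EuclideanSpace ℝ (Fin n)) i, ?_, ?_⟩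
  · ext i j
    have := b.inner_eq_ite i j
    rw [Submodule.coe_inner, PiLp.inner_apply] at this
    simp only [Matrix.mul_apply, Matrix.transpose_apply, Matrix.of_apply, Matrix.one_apply]
    rw [← this]
    refine Finset.sum_congr rfl fun l _ => ?_
    simp [mul_comm]
  · apply Matrix.toLin'.injective
    refine LinearMap.ext fun x => ?_
    simp only [Matrix.toLin'_apply]
    let f : F := ⟨WithLp.toLp 2 (Q *ᵥ x), ⟨WithLp.toLp 2 x, by simp [Matrix.toLpLin_apply]⟩⟩
    have h1 := congrArg (fun f : F => WithLp.ofLp (f : EuclideanSpace ℝ (Fin n)))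
      (b.sum_repr' f)
    have h2 : WithLp.ofLp (f : EuclideanSpace ℝ (Fin n)) = Q *ᵥ x := rfl
    simp only [h2] at h1
    rw [← Matrix.mulVec_mulVec, ← Matrix.mulVec_mulVec]
    conv_rhs => rw [← h1]
    ext i
    simp only [Matrix.mulVec, dotProduct, Matrix.of_apply, Matrix.transpose_apply,
      Submodule.coe_sum, Submodule.coe_smul, WithLp.ofLp_sum, WithLp.ofLp_smul, Finset.sum_apply,
      Pi.smul_apply, smul_eq_mul, Submodule.coe_inner, PiLp.inner_apply]
    refine Finset.sum_congr rfl fun l _ => ?_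
    rw [mul_comm]
    congr 1
    refine Finset.sum_congr rfl fun l _ => ?_
    simp [f, Matrix.mulVec, dotProduct, mul_comm]

theorem pow_inv_mul_pow_mul_cut (h : IsSmallPerturbation M U lam E ε L) (g : ℕ) :
    spectralInv ε L (M + E) ^ g * (M + E) ^ g * spectralCut ε L (M + E) =
      spectralCut ε L (M + E) := by
  induction g with
  | zero => simp
  | succ g ih =>
    rw [pow_succ, pow_succ', Matrix.mul_assoc (_ ^ g), ← Matrix.mul_assoc _ (M + E),
      ← h.commute_inv.eq, h.mul_inv, Matrix.mul_assoc, Matrix.mul_assoc,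
      (h.commute_cut.pow_left g).eq, ← Matrix.mul_assoc (spectralCut ε L (M + E)),
      h.cut_mul_self, ← (h.commute_cut.pow_left g).eq, ← Matrix.mul_assoc, ih]

/-- On the range of `Q`, `A^g` expands by at least `(L/2)^g` and `Gᵀ` by at least `s`, so `Yᵀ`
expands by at least `t = s (L/2)^g`. The test space for `Y` itself is the image of this range under
`Yᵀ`. -/
theorem le_singVal_sketch (h : IsSmallPerturbation M U lam E ε L) (hk : 0 < k) (g : ℕ)
    (G : Matrix (Fin n) (Fin m) ℝ) {s : ℝ} (hs : 0 < s)
    (hG : ∀ x, s * ‖(WithLp.toLp 2 (spectralCut ε L (M + E) *ᵥ x) : EuclideanSpace ℝ (Fin n))‖ ≤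
      ‖(WithLp.toLp 2 (Gᵀ *ᵥ (spectralCut ε L (M + E) *ᵥ x)) : EuclideanSpace ℝ (Fin m))‖) :
    s * (L / 2) ^ g ≤ singVal ((M + E) ^ g * G) (k - 1) := by
  have hLp := h.L_pos
  set Q := spectralCut ε L (M + E) with hQ
  set Y := (M + E) ^ g * G with hY
  set t := s * (L / 2) ^ g with ht
  have htpos : 0 < t := by positivity
  have hYt : ∀ x, Yᵀ *ᵥ (Q *ᵥ x) = Gᵀ *ᵥ (Q *ᵥ ((M + E) ^ g *ᵥ x)) := by
    intro x
    have hs : ((M + E) ^ g)ᵀ = (M + E) ^ g := by rw [Matrix.transpose_pow, h.isSymm_add]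
    rw [hY, Matrix.transpose_mul, hs, ← Matrix.mulVec_mulVec, Matrix.mulVec_mulVec _ _ Q,
      (h.commute_cut.pow_left g).eq, ← Matrix.mulVec_mulVec]
  have hlow : ∀ x, t * ‖(WithLp.toLp 2 (Q *ᵥ x) : EuclideanSpace ℝ (Fin n))‖ ≤
      ‖(WithLp.toLp 2 (Yᵀ *ᵥ (Q *ᵥ x)) : EuclideanSpace ℝ (Fin m))‖ := by
    intro x
    rw [hYt]
    refine le_trans ?_ (hG _)
    have e : Q *ᵥ x = spectralInv ε L (M + E) ^ g *ᵥ (Q *ᵥ ((M + E) ^ g *ᵥ x)) := by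
      rw [Matrix.mulVec_mulVec, Matrix.mulVec_mulVec, Matrix.mul_assoc,
        ← (h.commute_cut.pow_left g).eq, ← Matrix.mul_assoc, h.pow_inv_mul_pow_mul_cut]
    have h1 := norm_mulVec_le (spectralInv ε L (M + E) ^ g) (Q *ᵥ ((M + E) ^ g *ᵥ x))
    rw [← e] at h1
    have h2 : ‖spectralInv ε L (M + E) ^ g‖ ≤ (2 / L) ^ g := by
      rcases Nat.eq_zero_or_pos g with rfl | hg
      · simpa using norm_le_one_of_transpose_mul_self
          (A := (1 : Matrix (Fin n) (Fin n) ℝ)) (by simp)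
      · exact (norm_pow_le' _ hg).trans (pow_le_pow_left₀ (norm_nonneg _) h.norm_inv_le g)
    set N := ‖(WithLp.toLp 2 (Q *ᵥ ((M + E) ^ g *ᵥ x)) : EuclideanSpace ℝ (Fin n))‖
    have h3 : ‖(WithLp.toLp 2 (Q *ᵥ x) : EuclideanSpace ℝ (Fin n))‖ ≤ (2 / L) ^ g * N :=
      h1.trans (mul_le_mul_of_nonneg_right h2 (norm_nonneg _))
    calc t * ‖(WithLp.toLp 2 (Q *ᵥ x) : EuclideanSpace ℝ (Fin n))‖
        ≤ t * ((2 / L) ^ g * N) := mul_le_mul_of_nonneg_left h3 htpos.le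
      _ = s * ((L / 2) * (2 / L)) ^ g * N := by rw [ht, mul_pow]; ring
      _ = s * N := by
        have : (L / 2) * (2 / L) = 1 := by field_simp
        rw [this]; simp
  refine le_singVal hk Y (Yᵀ * (Q * U)) ?_ ?_
  · have : Function.Injective (Yᵀ * (Q * U)).mulVecLin := by
      refine (injective_iff_map_eq_zero _).2 fun z hz => ?_
      rw [Matrix.mulVecLin_apply, ← Matrix.mulVec_mulVec, ← Matrix.mulVec_mulVec] at hz
      have h1 := hlow (U *ᵥ z)
      rw [hz] at h1
      simp only [WithLp.toLp_zero, norm_zero] at h1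
      have h2 : ‖(WithLp.toLp 2 (Q *ᵥ U *ᵥ z) : EuclideanSpace ℝ (Fin n))‖ ≤ 0 := by
        by_contra! hp
        nlinarith
      have h3 := congrArg WithLp.ofLp (norm_le_zero_iff.1 h2)
      apply h.cut_mul_U_injective
      rw [Matrix.mulVec_zero, ← Matrix.mulVec_mulVec]
      exact h3
    exact this
  · intro z
    rw [← Matrix.mulVec_mulVec, ← Matrix.mulVec_mulVec]
    have h1 := hlow (U *ᵥ z)
    set x := Q *ᵥ (U *ᵥ z)
    set y : EuclideanSpace ℝ (Fin m) := WithLp.toLp 2 (Yᵀ *ᵥ x)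
    set w : EuclideanSpace ℝ (Fin n) := WithLp.toLp 2 (Y *ᵥ (Yᵀ *ᵥ x))
    -- From `‖Yᵀx‖² = ⟨Y Yᵀx, x⟩ ≤ ‖Y Yᵀx‖ ‖x‖` and `t ‖x‖ ≤ ‖Yᵀx‖` it follows that `t ‖Yᵀx‖ ≤ ‖Y
    -- Yᵀx‖`.
    have h2 : ‖y‖ ^ 2 = inner ℝ w (WithLp.toLp 2 x : EuclideanSpace ℝ (Fin n)) := by
      rw [← real_inner_self_eq_norm_sq]
      simp only [y, w, EuclideanSpace.inner_toLp_toLp, star_trivial]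
      rw [Matrix.dotProduct_mulVec, Matrix.vecMul_transpose, dotProduct_comm,
        dotProduct_comm x]
    have h3 := real_inner_le_norm w (WithLp.toLp 2 x : EuclideanSpace ℝ (Fin n))
    rw [← h2] at h3
    by_cases hy : ‖y‖ = 0
    · rw [hy]; simp
    · have hy' : 0 < ‖y‖ := lt_of_le_of_ne (norm_nonneg _) (Ne.symm hy)
      have h4 : t * ‖y‖ * ‖y‖ ≤ ‖w‖ * ‖y‖ := by nlinarith [norm_nonneg w]
      exact le_of_mul_le_mul_right h4 hy'

end IsSmallPerturbation

/-! ### Row-wise perturbation bound for the sketched singular vectors -/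

namespace IsSmallPerturbation

variable {n k m : ℕ} {M : Matrix (Fin n) (Fin n) ℝ} {U : Matrix (Fin n) (Fin k) ℝ}
  {lam : Fin k → ℝ} {E : Matrix (Fin n) (Fin n) ℝ} {ε L : ℝ}

/-- Substitute `R^g Q = (M + E) R^(g+1) Q` in the remainder: the `M` part is the next summand and
the `E` part the next remainder. Each power of `E` is thereby accompanied by a power of `R`, hence
by a factor of order `1/L`. -/
theorem cut_eq_sum (h : IsSmallPerturbation M U lam E ε L) (g : ℕ) :
    spectralCut ε L (M + E) =
      ∑ r ∈ Finset.range g, E ^ r * M * spectralInv ε L (M + E) ^ (r + 1) *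
        spectralCut ε L (M + E) +
      E ^ g * spectralInv ε L (M + E) ^ g * spectralCut ε L (M + E) := by
  induction g with
  | zero => simp
  | succ g ih =>
    set Q := spectralCut ε L (M + E)
    set R := spectralInv ε L (M + E)
    have hRQ : Commute R Q := by
      change Commute R (spectralCut ε L (M + E))
      rw [← h.mul_inv]
      exact h.commute_inv.symm.mul_right (Commute.refl _)
    have e : R ^ g * Q = (M + E) * R ^ (g + 1) * Q := by
      conv_lhs => rw [show Q = Q * Q from h.cut_mul_self.symm]
      rw [← Matrix.mul_assoc, (hRQ.pow_left g).eq]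
      conv_lhs => enter [1, 1]; rw [show Q = (M + E) * R from h.mul_inv.symm]
      rw [pow_succ', Matrix.mul_assoc (M + E)]
    conv_lhs => rw [ih]
    rw [Finset.sum_range_succ, add_assoc]
    congr 1
    rw [Matrix.mul_assoc (E ^ g) (R ^ g), e, Matrix.add_mul, Matrix.add_mul, Matrix.mul_add,
      pow_succ E]
    simp only [Matrix.mul_assoc]

/-- `M` may be much larger than `L`, but `M R = Q - E R` has norm at most `2`, so no condition
number appears here. -/
theorem norm_Ut_mul_M_mul_inv_pow_le (h : IsSmallPerturbation M U lam E ε L) (r : ℕ) :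
    ‖Uᵀ * M * spectralInv ε L (M + E) ^ (r + 1)‖ ≤ 2 * (2 / L) ^ r := by
  have hLp := h.L_pos
  have hε := h.pos
  set R := spectralInv ε L (M + E)
  have e : Uᵀ * M * R ^ (r + 1) = Uᵀ * ((spectralCut ε L (M + E) - E * R) * R ^ r) := by
    have : M * R = spectralCut ε L (M + E) - E * R := by
      rw [← h.mul_inv, Matrix.add_mul]; simp [R]
    rw [← this, pow_succ']
    simp only [Matrix.mul_assoc]
  have h1 : ‖spectralCut ε L (M + E) - E * R‖ ≤ 2 := by
    refine (norm_sub_le _ _).trans ?_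
    have h2 := (Matrix.l2_opNorm_mul E R).trans
      (mul_le_mul h.norm_le h.norm_inv_le (norm_nonneg _) hε.le)
    have h3 : ε * (2 / L) ≤ 1 := by
      rw [mul_div_assoc', div_le_one hLp]; linarith [h.small]
    linarith [h.norm_cut_le]
  have h2 : ‖R ^ r‖ ≤ (2 / L) ^ r := by
    rcases Nat.eq_zero_or_pos r with rfl | hg
    · simpa using norm_le_one_of_transpose_mul_self
        (A := (1 : Matrix (Fin n) (Fin n) ℝ)) (by simp)
    · exact (norm_pow_le' _ hg).trans (pow_le_pow_left₀ (norm_nonneg _) h.norm_inv_le r)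
  rw [e]
  have h3 := Matrix.l2_opNorm_mul Uᵀ ((spectralCut ε L (M + E) - E * R) * R ^ r)
  have h4 := (Matrix.l2_opNorm_mul (spectralCut ε L (M + E) - E * R) (R ^ r)).trans
    (mul_le_mul h1 h2 (norm_nonneg _) zero_le_two)
  have h5 := h.norm_Ut_le
  nlinarith [norm_nonneg ((spectralCut ε L (M + E) - E * R) * R ^ r)]

/-- From the SVD relation `Y V = Uhat Σ`, take `N = V Σ⁻¹`. -/
theorem exists_eq_sketch_mul {Y : Matrix (Fin n) (Fin m) ℝ} {Uhat : Matrix (Fin n) (Fin k) ℝ}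
    (hY : IsLeadingLeftSingular Y Uhat) {σ : ℝ} (hσ : 0 < σ) (hσY : σ ≤ singVal Y (k - 1)) :
    ∃ N : Matrix (Fin m) (Fin k) ℝ, ‖N‖ ≤ 1 / σ ∧ Uhat = Y * N := by
  obtain ⟨V, hV, hYV, -⟩ := hY.exists_right
  have hle : ∀ i : Fin k, σ ≤ singVal Y i := fun i =>
    hσY.trans ((Matrix.toEuclideanLin Y).singularValues_antitone (by omega))
  refine ⟨V * Matrix.diagonal (fun i : Fin k => 1 / singVal Y i), ?_, ?_⟩
  · refine (Matrix.l2_opNorm_mul _ _).trans ?_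
    have h1 := norm_le_one_of_transpose_mul_self hV
    have h2 : ‖(Matrix.diagonal (fun i : Fin k => 1 / singVal Y i))‖ ≤ 1 / σ := by
      rw [Matrix.l2_opNorm_diagonal]
      refine (pi_norm_le_iff_of_nonneg (by positivity)).2 fun i => ?_
      rw [Real.norm_eq_abs, abs_of_pos (one_div_pos.2 (hσ.trans_le (hle i)))]
      exact one_div_le_one_div_of_le hσ (hle i)
    nlinarith [norm_nonneg V, norm_nonneg (Matrix.diagonal (fun i : Fin k => 1 / singVal Y i))]
  · rw [← Matrix.mul_assoc, hYV, Matrix.mul_assoc, Matrix.diagonal_mul_diagonal]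
    have : (fun i : Fin k => singVal Y i * (1 / singVal Y i)) = fun _ => (1 : ℝ) := by
      ext i
      exact mul_one_div_cancel (hσ.trans_le (hle i)).ne'
    rw [this, Matrix.diagonal_one, Matrix.mul_one]

theorem twoInfDist_le_of {n k : ℕ} (U₁ U₂ : Matrix (Fin n) (Fin k) ℝ)
    (W : Matrix.orthogonalGroup (Fin k) ℝ) {c : ℝ}
    (h : twoInfNorm (U₁ - U₂ * (W : Matrix (Fin k) (Fin k) ℝ)) ≤ c) : twoInfDist U₁ U₂ ≤ c :=
  (ciInf_le ⟨0, by rintro _ ⟨W, rfl⟩; exact twoInfNorm_nonneg _⟩ W).trans h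

/-- The four summands come from the term `r = 0` of the expansion of `Q Uhat` together with the
orthogonal approximation, from the terms `1 ≤ r < g`, from the remainder, and from `(1 - Q) Uhat`.
-/
theorem twoInfDist_le (h : IsSmallPerturbation M U lam E ε L) {g : ℕ} (hg : 1 ≤ g)
    {G : Matrix (Fin n) (Fin m) ℝ} {Uhat : Matrix (Fin n) (Fin k) ℝ}
    (hY : IsLeadingLeftSingular ((M + E) ^ g * G) Uhat) {σ ρ : ℝ} (hσ : 0 < σ)
    (hσY : σ ≤ singVal ((M + E) ^ g * G) (k - 1))
    (hρ : twoInfNorm ((M + E) ^ g * (1 - spectralCut ε L (M + E)) * G) ≤ ρ) {κ : ℕ → ℝ}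
    (hκ : ∀ r ∈ Finset.Ico 1 g, twoInfNorm (E ^ r * U) ≤ κ r) :
    twoInfDist Uhat U ≤ twoInfNorm U * (2 * (√n * (ρ / σ)) + 6 * ε / L) +
      ∑ r ∈ Finset.Ico 1 g, κ r * (2 * (2 / L) ^ r) + (2 * ε / L) ^ g + ρ / σ := by
  have hLp := h.L_pos
  have hε := h.pos
  obtain ⟨N, hN, hUN⟩ := exists_eq_sketch_mul hY hσ hσY
  set Q := spectralCut ε L (M + E) with hQ
  set R := spectralInv ε L (M + E) with hR
  set Z := Q * Uhat with hZ
  have hUhat : ‖Uhat‖ ≤ 1 := norm_le_one_of_transpose_mul_self hY.orthonormal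
  have hZ1 : ‖Z‖ ≤ 1 := by
    refine (Matrix.l2_opNorm_mul _ _).trans ?_
    nlinarith [h.norm_cut_le, norm_nonneg Q, norm_nonneg Uhat]
  have hQZ : Q * Z = Z := by rw [hZ, ← Matrix.mul_assoc, h.cut_mul_self]
  -- the component orthogonal to the spectral subspace
  have hrest : (1 - Q) * Uhat = (M + E) ^ g * (1 - Q) * G * N := by
    conv_lhs => rw [hUN]
    have hc : (1 - Q) * (M + E) ^ g = (M + E) ^ g * (1 - Q) := by
      rw [Matrix.sub_mul, Matrix.mul_sub, Matrix.one_mul, Matrix.mul_one,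
        (h.commute_cut.pow_left g).eq]
    rw [← Matrix.mul_assoc, ← Matrix.mul_assoc, hc]
  have hρ0 : 0 ≤ ρ := (twoInfNorm_nonneg _).trans hρ
  have hrestrow : twoInfNorm ((1 - Q) * Uhat) ≤ ρ / σ := by
    rw [hrest]
    refine (twoInfNorm_mul_le _ _).trans ?_
    calc _ ≤ ρ * (1 / σ) := mul_le_mul hρ hN (norm_nonneg _) hρ0
      _ = ρ / σ := by ring
  have hrestnorm : ‖(1 - Q) * Uhat‖ ≤ √n * (ρ / σ) :=
    (norm_le_sqrt_mul_twoInfNorm _).trans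
      (mul_le_mul_of_nonneg_left hrestrow (Real.sqrt_nonneg _))
  -- the orthogonal matrix
  set B := Uᵀ * Z with hB
  have hB1 : ‖B‖ ≤ 1 := by
    refine (Matrix.l2_opNorm_mul _ _).trans ?_
    nlinarith [h.norm_Ut_le, norm_nonneg Uᵀ, norm_nonneg Z]
  obtain ⟨W, hW⟩ := exists_orthogonal_norm_sub_le B hB1
  have hBB : ‖1 - Bᵀ * B‖ ≤ √n * (ρ / σ) + 2 * ε / L := by
    have hQt : Qᵀ = Q := transpose_cfc _ _
    -- The defect of orthogonality of `B = Uᵀ Q Uhat` has two sources: the part of `Uhat` outside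
    -- the range of `Q`, and the angle between the ranges of `Q` and `U`.
    have e : 1 - Bᵀ * B = Uhatᵀ * ((1 - Q) * Uhat) + Zᵀ * ((1 - U * Uᵀ) * Q * Uhat) := by
      have e1 : Zᵀ * Z = Uhatᵀ * Z := by
        conv_lhs => rw [hZ, Matrix.transpose_mul, hQt, Matrix.mul_assoc, hQZ]
      have e2 : Zᵀ * ((1 - U * Uᵀ) * Q * Uhat) = Zᵀ * Z - Bᵀ * B := by
        have e3 : Bᵀ = Zᵀ * U := by rw [hB, Matrix.transpose_mul, Matrix.transpose_transpose]
        rw [e3, hB, Matrix.mul_assoc (1 - U * Uᵀ), ← hZ, Matrix.sub_mul, Matrix.one_mul, Matrix.mul_sub]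
        simp only [Matrix.mul_assoc]
      rw [e2, e1, Matrix.sub_mul, Matrix.one_mul, Matrix.mul_sub, hY.orthonormal, ← hZ]
      abel
    rw [e]
    refine (norm_add_le _ _).trans (add_le_add ?_ ?_)
    · refine ((Matrix.l2_opNorm_mul _ _).trans ?_).trans hrestnorm
      rw [norm_transpose_eq]
      nlinarith [norm_nonneg ((1 - Q) * Uhat)]
    · refine (Matrix.l2_opNorm_mul _ _).trans ?_
      rw [norm_transpose_eq]
      have h1 := Matrix.l2_opNorm_mul ((1 - U * Uᵀ) * Q) Uhat
      have h2 := h.norm_one_sub_proj_mul_cut_le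
      have h3 : ‖(1 - U * Uᵀ) * Q‖ * ‖Uhat‖ ≤ ‖(1 - U * Uᵀ) * Q‖ :=
        mul_le_of_le_one_right (norm_nonneg _) hUhat
      have h4 : ‖Z‖ * ‖(1 - U * Uᵀ) * Q * Uhat‖ ≤ ‖(1 - U * Uᵀ) * Q * Uhat‖ :=
        mul_le_of_le_one_left (norm_nonneg _) hZ1
      linarith
  -- the expansion
  have hexp : Z = U * (B - Uᵀ * (E * R) * Z) +
      ∑ r ∈ Finset.Ico 1 g, (E ^ r * U) * (Uᵀ * M * R ^ (r + 1) * Z) + E ^ g * R ^ g * Z := by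
    have e1 : Q * Uhat = (∑ r ∈ Finset.range g, E ^ r * M * R ^ (r + 1) * Q +
      E ^ g * R ^ g * Q) * Uhat := by rw [← h.cut_eq_sum g]
    rw [← hZ, Matrix.add_mul, Matrix.mul_assoc _ Q, ← hZ, Matrix.sum_mul,
      Finset.range_eq_Ico, Finset.sum_eq_sum_Ico_succ_bot (by omega : 0 < g)] at e1
    conv_lhs => rw [e1]
    congr 2
    -- In the term `r = 0`, `M R Z = U Uᵀ (Q - E R) Z = U (B - Uᵀ E R Z)`.
    · have e2 : M * R = Q - E * R := by
        rw [hQ, ← h.mul_inv, Matrix.add_mul]; simp [hR]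
      rw [pow_zero, Matrix.one_mul, zero_add, pow_one, Matrix.mul_assoc _ Q, ← hZ]
      conv_lhs => rw [← h.eigen.proj_mul]
      rw [Matrix.mul_assoc (U * Uᵀ), e2, Matrix.mul_assoc U, Matrix.mul_assoc U, Matrix.mul_sub,
        Matrix.sub_mul, Matrix.mul_assoc Uᵀ Q, hQZ]
    · refine Finset.sum_congr rfl fun r _ => ?_
      rw [Matrix.mul_assoc _ Q, ← hZ]
      conv_lhs => rw [← h.eigen.proj_mul]
      simp only [Matrix.mul_assoc]
  have hfinal : Uhat - U * (W : Matrix (Fin k) (Fin k) ℝ) =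
      U * ((B - (W : Matrix (Fin k) (Fin k) ℝ)) - Uᵀ * (E * R) * Z) +
      ∑ r ∈ Finset.Ico 1 g, (E ^ r * U) * (Uᵀ * M * R ^ (r + 1) * Z) + E ^ g * R ^ g * Z +
      (1 - Q) * Uhat := by
    have e1 : Uhat = Z + (1 - Q) * Uhat := by rw [Matrix.sub_mul, Matrix.one_mul, hZ]; abel
    conv_lhs => rw [e1, hexp]
    rw [Matrix.mul_sub, Matrix.mul_sub, Matrix.mul_sub]
    abel
  refine twoInfDist_le_of _ _ W ?_
  rw [hfinal]
  refine (twoInfNorm_add_le _ _).trans (add_le_add ?_ hrestrow)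
  refine (twoInfNorm_add_le _ _).trans (add_le_add ?_ ?_)
  · refine (twoInfNorm_add_le _ _).trans (add_le_add ?_ ?_)
    · refine (twoInfNorm_mul_le _ _).trans
        (mul_le_mul_of_nonneg_left ?_ (twoInfNorm_nonneg _))
      refine (norm_sub_le _ _).trans ?_
      have h1 : ‖Uᵀ * (E * R) * Z‖ ≤ 2 * ε / L := by
        have h2 := Matrix.l2_opNorm_mul (Uᵀ * (E * R)) Z
        have h3 := Matrix.l2_opNorm_mul Uᵀ (E * R)
        have h4 := (Matrix.l2_opNorm_mul E R).trans
          (mul_le_mul h.norm_le h.norm_inv_le (norm_nonneg _) hε.le)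
        have h5 : ‖Uᵀ * (E * R)‖ * ‖Z‖ ≤ ‖Uᵀ * (E * R)‖ :=
          mul_le_of_le_one_right (norm_nonneg _) hZ1
        have h6 : ‖Uᵀ‖ * ‖E * R‖ ≤ ‖E * R‖ := mul_le_of_le_one_left (norm_nonneg _) h.norm_Ut_le
        have h7 : ε * (2 / L) = 2 * ε / L := by ring
        linarith
      have h2 : 6 * ε / L = 3 * (2 * ε / L) := by ring
      linarith
    · refine (twoInfNorm_sum_le _ _).trans (Finset.sum_le_sum fun r hr => ?_)
      refine (twoInfNorm_mul_le _ _).trans ?_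
      have h1 := Matrix.l2_opNorm_mul (Uᵀ * M * R ^ (r + 1)) Z
      have h2 : ‖Uᵀ * M * R ^ (r + 1)‖ * ‖Z‖ ≤ ‖Uᵀ * M * R ^ (r + 1)‖ :=
        mul_le_of_le_one_right (norm_nonneg _) hZ1
      have h3 := h.norm_Ut_mul_M_mul_inv_pow_le r
      exact mul_le_mul (hκ r hr) (by linarith) (norm_nonneg _)
        ((twoInfNorm_nonneg _).trans (hκ r hr))
  · refine (twoInfNorm_le_norm _).trans ?_
    have h1 := Matrix.l2_opNorm_mul (E ^ g * R ^ g) Z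
    have h2 : ‖E ^ g * R ^ g‖ * ‖Z‖ ≤ ‖E ^ g * R ^ g‖ :=
      mul_le_of_le_one_right (norm_nonneg _) hZ1
    have h3 := (Matrix.l2_opNorm_mul (E ^ g) (R ^ g)).trans
      (mul_le_mul ((norm_pow_le' E hg).trans (pow_le_pow_left₀ (norm_nonneg _) h.norm_le g))
        ((norm_pow_le' R hg).trans (pow_le_pow_left₀ (norm_nonneg _) h.norm_inv_le g))
        (norm_nonneg _) (by positivity))
    rw [← mul_pow, mul_div_assoc', mul_comm ε 2] at h3
    linarith

end IsSmallPerturbation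

end Deterministic

/-! ### Gaussian vectors -/

/-- The law of a family of independent standard normal variables. -/
noncomputable def gaussianPi (ι : Type*) [Fintype ι] : Measure (ι → ℝ) :=
  Measure.pi fun _ => gaussianReal 0 1

instance (ι : Type*) [Fintype ι] : IsProbabilityMeasure (gaussianPi ι) := by
  unfold gaussianPi; infer_instance

instance (ι : Type*) [Fintype ι] : (gaussianPi ι).IsOpenPosMeasure := by
  have : (gaussianReal 0 1).IsOpenPosMeasure :=
    (gaussianReal_absolutelyContinuous' 0 one_ne_zero).isOpenPosMeasure
  unfold gaussianPi; infer_instance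

/-- Rotation invariance. Since `T Tᵀ = 1`, `Tᵀ` preserves norms, and the characteristic function of
a standard Gaussian depends only on the norm of its argument. -/
theorem gaussianPi_map_mulVec {ι κ : Type*} [Fintype ι] [Fintype κ] [DecidableEq κ]
    (T : Matrix κ ι ℝ) (hT : T * Tᵀ = 1) :
    (gaussianPi ι).map (fun x => T *ᵥ x) = gaussianPi κ := by
  have hmeas : Measurable fun x : ι → ℝ => T *ᵥ x := by
    refine measurable_pi_lambda _ fun i => ?_
    simp only [Matrix.mulVec, dotProduct]
    fun_prop
  apply (MeasurableEquiv.toLp 2 (κ → ℝ)).map_measurableEquiv_injective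
  have h2 : (gaussianPi κ).map (MeasurableEquiv.toLp 2 (κ → ℝ)) =
      stdGaussian (EuclideanSpace ℝ κ) := map_pi_eq_stdGaussian
  have h1 : (gaussianPi ι).map (WithLp.toLp 2) = stdGaussian (EuclideanSpace ℝ ι) :=
    map_pi_eq_stdGaussian
  rw [h2, Measure.map_map (by fun_prop) hmeas]
  have hmeas2 : Measurable (MeasurableEquiv.toLp 2 (κ → ℝ) ∘ fun x : ι → ℝ => T *ᵥ x) :=
    (MeasurableEquiv.toLp 2 (κ → ℝ)).measurable.comp hmeas
  have : IsProbabilityMeasure ((gaussianPi ι).map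
      (MeasurableEquiv.toLp 2 (κ → ℝ) ∘ fun x : ι → ℝ => T *ᵥ x)) :=
    Measure.isProbabilityMeasure_map hmeas2.aemeasurable
  apply Measure.ext_of_charFun (E := EuclideanSpace ℝ κ)
  ext t
  set t' : EuclideanSpace ℝ ι := WithLp.toLp 2 (Tᵀ *ᵥ t.ofLp) with ht'
  have hnorm : ‖t'‖ ^ 2 = ‖t‖ ^ 2 := by
    rw [← real_inner_self_eq_norm_sq, ← real_inner_self_eq_norm_sq]
    have e : inner ℝ t' t' = (Tᵀ *ᵥ t.ofLp) ⬝ᵥ (Tᵀ *ᵥ t.ofLp) := by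
      rw [ht', EuclideanSpace.inner_toLp_toLp, star_trivial]
    rw [e, Matrix.dotProduct_mulVec, Matrix.vecMul_transpose, Matrix.mulVec_mulVec, hT,
      Matrix.one_mulVec, EuclideanSpace.inner_eq_star_dotProduct, star_trivial]
  have h3 : charFun (stdGaussian (EuclideanSpace ℝ ι)) t' =
      charFun ((gaussianPi ι).map
        (MeasurableEquiv.toLp 2 (κ → ℝ) ∘ fun x : ι → ℝ => T *ᵥ x)) t := by
    rw [← h1, charFun_apply, charFun_apply,
      integral_map (by fun_prop) (Measurable.aestronglyMeasurable (by fun_prop)),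
      integral_map hmeas2.aemeasurable (Measurable.aestronglyMeasurable (by fun_prop))]
    refine integral_congr_ae (Eventually.of_forall fun x => ?_)
    have e : inner ℝ (WithLp.toLp 2 x : EuclideanSpace ℝ ι) t' =
        inner ℝ (WithLp.toLp 2 (T *ᵥ x) : EuclideanSpace ℝ κ) t := by
      have e1 : inner ℝ (WithLp.toLp 2 x : EuclideanSpace ℝ ι) t' =
          x ⬝ᵥ (Tᵀ *ᵥ t.ofLp) := by
        simp [ht', PiLp.inner_apply, dotProduct, mul_comm]
      have e2 : inner ℝ (WithLp.toLp 2 (T *ᵥ x) : EuclideanSpace ℝ κ) t =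
          (T *ᵥ x) ⬝ᵥ t.ofLp := by
        simp [PiLp.inner_apply, dotProduct, mul_comm]
      rw [e1, e2, Matrix.dotProduct_mulVec, Matrix.vecMul_transpose]
    change Complex.exp (inner ℝ (WithLp.toLp 2 x : EuclideanSpace ℝ ι) t' * Complex.I) =
      Complex.exp (inner ℝ (WithLp.toLp 2 (T *ᵥ x) : EuclideanSpace ℝ κ) t * Complex.I)
    rw [e]
  rw [← h3, charFun_stdGaussian, charFun_stdGaussian]
  congr 3
  exact_mod_cast hnorm

/-- One Laplace transform serves both tails: negative `l` for large values, positive `l` for small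
ones. -/
theorem integral_exp_neg_mul_sq_gaussianReal {l : ℝ} (hl : -(1 / 2) < l) :
    ∫ x, Real.exp (-l * x ^ 2) ∂(gaussianReal 0 1) = (√(1 + 2 * l))⁻¹ := by
  rw [integral_gaussianReal_eq_integral_smul one_ne_zero]
  have e : ∀ x : ℝ, gaussianPDFReal 0 1 x • Real.exp (-l * x ^ 2) =
      (√(2 * Real.pi))⁻¹ * Real.exp (-(l + 1 / 2) * x ^ 2) := by
    intro x
    simp only [gaussianPDFReal, NNReal.coe_one, mul_one, sub_zero, smul_eq_mul]
    rw [mul_assoc, ← Real.exp_add]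
    congr 2
    ring
  simp_rw [e]
  rw [integral_const_mul, integral_gaussian, ← Real.sqrt_inv, ← Real.sqrt_inv,
    ← Real.sqrt_mul (by positivity)]
  congr 1
  have := Real.pi_pos
  have h2 : l + 1 / 2 ≠ 0 := by linarith
  have h3 : 1 + 2 * l = 2 * (l + 1 / 2) := by ring
  rw [h3]
  field_simp

theorem integral_exp_neg_mul_sum_sq_gaussianPi {ι : Type*} [Fintype ι] {l : ℝ}
    (hl : -(1 / 2) < l) :
    ∫ x, Real.exp (-l * ∑ i, x i ^ 2) ∂(gaussianPi ι) = ((√(1 + 2 * l))⁻¹) ^ Fintype.card ι := by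
  have e : ∀ x : ι → ℝ, Real.exp (-l * ∑ i, x i ^ 2) = ∏ i, Real.exp (-l * x i ^ 2) := by
    intro x
    rw [Finset.mul_sum, Real.exp_sum]
  simp_rw [e]
  unfold gaussianPi
  rw [integral_fintype_prod_eq_prod (fun (_ : ι) (x : ℝ) => Real.exp (-l * x ^ 2))]
  simp only [integral_exp_neg_mul_sq_gaussianReal hl, Finset.prod_const, Finset.card_univ]

/-- Otherwise the Bochner integral would be `0`, while its computed value is positive. -/
theorem integrable_exp_neg_mul_sum_sq_gaussianPi {ι : Type*} [Fintype ι] {l : ℝ}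
    (hl : -(1 / 2) < l) :
    Integrable (fun x : ι → ℝ => Real.exp (-l * ∑ i, x i ^ 2)) (gaussianPi ι) := by
  by_contra h
  have h1 := integral_undef h
  rw [integral_exp_neg_mul_sum_sq_gaussianPi hl] at h1
  have : 0 < √(1 + 2 * l) := Real.sqrt_pos.2 (by linarith)
  have : 0 < ((√(1 + 2 * l))⁻¹) ^ Fintype.card ι := by positivity
  linarith

/-- Chernoff bound with parameter `l = -1/4`, at which each coordinate contributes `√2`. -/
theorem gaussianPi_le_sum_sq {ι : Type*} [Fintype ι] (t : ℝ) :
    (gaussianPi ι).real {x | t ≤ ∑ i, x i ^ 2} ≤ √2 ^ Fintype.card ι * Real.exp (-t / 4) := by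
  have hl : -(1 / 2 : ℝ) < -(1 / 4) := by norm_num
  have h := mul_meas_ge_le_integral_of_nonneg
    (Eventually.of_forall fun x : ι → ℝ => (Real.exp_pos (-(-(1 / 4)) * ∑ i, x i ^ 2)).le)
    (integrable_exp_neg_mul_sum_sq_gaussianPi hl) (Real.exp (t / 4))
  rw [integral_exp_neg_mul_sum_sq_gaussianPi hl] at h
  have e1 : {x : ι → ℝ | Real.exp (t / 4) ≤ Real.exp (-(-(1 / 4)) * ∑ i, x i ^ 2)} =
      {x | t ≤ ∑ i, x i ^ 2} := by
    ext x
    simp only [Set.mem_ofPred_eq, Real.exp_le_exp]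
    constructor <;> intro h <;> linarith
  have e2 : (√(1 + 2 * -(1 / 4)))⁻¹ = √2 := by
    rw [← Real.sqrt_inv]; norm_num
  rw [e1, e2] at h
  have e3 : -t / 4 = -(t / 4) := by ring
  rw [e3, Real.exp_neg, ← div_eq_mul_inv, le_div_iff₀ (Real.exp_pos _), mul_comm]
  exact h

/-- Chernoff bound with parameter `l = 1/(2s)`: each coordinate contributes at most `√s`, and
`e^(-1/2) ≥ 1/2` accounts for the factor `2`. -/
theorem gaussianPi_sum_sq_le {ι : Type*} [Fintype ι] {s : ℝ} (hs : 0 < s) :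
    (gaussianPi ι).real {x | ∑ i, x i ^ 2 ≤ s * Fintype.card ι} ≤
      (2 * √s) ^ Fintype.card ι := by
  have hl : -(1 / 2 : ℝ) < 1 / (2 * s) := by
    have : 0 < 1 / (2 * s) := by positivity
    linarith
  set N := Fintype.card ι
  have h := mul_meas_ge_le_integral_of_nonneg
    (Eventually.of_forall fun x : ι → ℝ => (Real.exp_pos (-(1 / (2 * s)) * ∑ i, x i ^ 2)).le)
    (integrable_exp_neg_mul_sum_sq_gaussianPi hl) (Real.exp (-(N / 2 : ℝ)))
  rw [integral_exp_neg_mul_sum_sq_gaussianPi hl] at h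
  have e1 : {x : ι → ℝ | Real.exp (-(N / 2 : ℝ)) ≤ Real.exp (-(1 / (2 * s)) * ∑ i, x i ^ 2)} =
      {x | ∑ i, x i ^ 2 ≤ s * N} := by
    ext x
    simp only [Set.mem_ofPred_eq, Real.exp_le_exp]
    rw [neg_mul, neg_le_neg_iff, one_div_mul_eq_div, div_le_div_iff₀ (by positivity) two_pos]
    constructor <;> intro h <;> nlinarith
  rw [e1] at h
  have e2 : Real.exp (-(N / 2 : ℝ)) = (Real.exp (-(1 / 2))) ^ N := by
    rw [← Real.exp_nat_mul]; congr 1; ring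
  rw [e2] at h
  have h3 : (√(1 + 2 * (1 / (2 * s))))⁻¹ ≤ √s := by
    rw [← Real.sqrt_inv]
    apply Real.sqrt_le_sqrt
    have : 1 + 2 * (1 / (2 * s)) = (s + 1) / s := by field_simp
    rw [this, inv_div, div_le_iff₀ (by positivity)]
    nlinarith
  have h4 : (1 / 2 : ℝ) ≤ Real.exp (-(1 / 2)) := by
    have := Real.add_one_le_exp (-(1 / 2) : ℝ)
    linarith
  have h5 : ((√(1 + 2 * (1 / (2 * s))))⁻¹) ^ N ≤ √s ^ N := pow_le_pow_left₀ (by positivity) h3 N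
  have h6 : (1 / 2 : ℝ) ^ N ≤ Real.exp (-(1 / 2)) ^ N := pow_le_pow_left₀ (by positivity) h4 N
  have h7 : (1 / 2 : ℝ) ^ N * (gaussianPi ι).real {x | ∑ i, x i ^ 2 ≤ s * N} ≤ √s ^ N :=
    ((mul_le_mul_of_nonneg_right h6 measureReal_nonneg).trans h).trans h5
  rw [mul_pow]
  have h8 : (2 : ℝ) ^ N * (1 / 2 : ℝ) ^ N = 1 := by rw [← mul_pow]; norm_num
  calc _ = 2 ^ N * ((1 / 2 : ℝ) ^ N * (gaussianPi ι).real {x | ∑ i, x i ^ 2 ≤ s * N}) := by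
        rw [← mul_assoc, h8, one_mul]
    _ ≤ _ := mul_le_mul_of_nonneg_left h7 (by positivity)

/-! ### Gaussian matrices -/

/-- The matrix with the given family of entries. -/
def toMatrix {n m : ℕ} (H : Fin n × Fin m → ℝ) : Matrix (Fin n) (Fin m) ℝ :=
  Matrix.of fun i j => H (i, j)

/-- The image `Hᵀ u` of a vector under the transpose of a matrix given by its entries. -/
noncomputable def sketch {n m : ℕ} (H : Fin n × Fin m → ℝ) (u : Fin n → ℝ) :
    EuclideanSpace ℝ (Fin m) := WithLp.toLp 2 ((toMatrix H)ᵀ *ᵥ u)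

theorem sketch_apply {n m : ℕ} (H : Fin n × Fin m → ℝ) (u : Fin n → ℝ) (j : Fin m) :
    sketch H u j = ∑ i, H (i, j) * u i := by
  simp [sketch, toMatrix, Matrix.mulVec, dotProduct]

theorem norm_sketch_sq {n m : ℕ} (H : Fin n × Fin m → ℝ) (u : Fin n → ℝ) :
    ‖sketch H u‖ ^ 2 = ∑ j, (∑ i, H (i, j) * u i) ^ 2 := by
  simp [EuclideanSpace.norm_sq_eq, sketch_apply]

theorem sketch_smul {n m : ℕ} (H : Fin n × Fin m → ℝ) (c : ℝ) (u : Fin n → ℝ) :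
    sketch H (c • u) = c • sketch H u := by
  rw [sketch, Matrix.mulVec_smul]; rfl

theorem sketch_add {n m : ℕ} (H : Fin n × Fin m → ℝ) (u v : Fin n → ℝ) :
    sketch H (u + v) = sketch H u + sketch H v := by
  rw [sketch, Matrix.mulVec_add]; rfl

theorem sketch_sub {n m : ℕ} (H : Fin n × Fin m → ℝ) (u v : Fin n → ℝ) :
    sketch H (u - v) = sketch H u - sketch H v := by
  rw [sketch, Matrix.mulVec_sub]; rfl

theorem continuous_sketch {n m : ℕ} :
    Continuous fun p : (Fin n × Fin m → ℝ) × (Fin n → ℝ) => sketch p.1 p.2 := by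
  refine (PiLp.continuous_toLp 2 _).comp (continuous_pi fun j => ?_)
  simp only [toMatrix, Matrix.mulVec, dotProduct, Matrix.transpose_apply, Matrix.of_apply]
  fun_prop

theorem gaussianPi_map_sketch {n m : ℕ} {u : Fin n → ℝ} (hu : ∑ i, u i ^ 2 = 1) :
    (gaussianPi (Fin n × Fin m)).map (fun H j => ∑ i, H (i, j) * u i) = gaussianPi (Fin m) := by
  set T : Matrix (Fin m) (Fin n × Fin m) ℝ :=
    Matrix.of fun j p => if p.2 = j then u p.1 else 0 with hT
  rw [← gaussianPi_map_mulVec T]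
  · congr 1
    ext H j
    simp [hT, Matrix.mulVec, dotProduct, Fintype.sum_prod_type, mul_comm]
  · ext j j'
    rw [Matrix.mul_apply, Fintype.sum_prod_type, Matrix.one_apply]
    simp only [hT, Matrix.of_apply, Matrix.transpose_apply]
    by_cases hj : j = j'
    · subst hj
      simp [← hu, sq]
    · simp [hj, Ne.symm hj]

theorem gaussianPi_map_transpose_mul {n m k : ℕ} (W : Matrix (Fin n) (Fin k) ℝ) (hW : Wᵀ * W = 1) :
    (gaussianPi (Fin n × Fin m)).map (fun H p => ∑ i, H (i, p.2) * W i p.1) =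
      gaussianPi (Fin k × Fin m) := by
  set T : Matrix (Fin k × Fin m) (Fin n × Fin m) ℝ :=
    Matrix.of fun q p => if p.2 = q.2 then W p.1 q.1 else 0 with hT
  rw [← gaussianPi_map_mulVec T]
  · congr 1
    ext H j
    simp [hT, Matrix.mulVec, dotProduct, Fintype.sum_prod_type, mul_comm]
  · ext ⟨i, j⟩ ⟨i', j'⟩
    have hWi : ∑ l, W l i * W l i' = if i = i' then 1 else 0 := by
      have := congrFun (congrFun hW i) i'
      simpa [Matrix.mul_apply, Matrix.one_apply] using this
    rw [Matrix.mul_apply, Fintype.sum_prod_type, Matrix.one_apply]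
    simp only [hT, Matrix.of_apply, Matrix.transpose_apply, Prod.mk.injEq]
    by_cases hj : j = j'
    · subst hj
      simp [hWi]
    · simp [hj, Ne.symm hj]

theorem sum_sq_eq_norm_sq {n : ℕ} (u : Fin n → ℝ) :
    ∑ i, u i ^ 2 = ‖(WithLp.toLp 2 u : EuclideanSpace ℝ (Fin n))‖ ^ 2 := by
  simp [EuclideanSpace.norm_sq_eq]

theorem measurable_sum_mul {n m : ℕ} (u : Fin n → ℝ) :
    Measurable fun (H : Fin n × Fin m → ℝ) (j : Fin m) => ∑ i, H (i, j) * u i := by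
  fun_prop

theorem gaussianPi_le_norm_sketch_sq_of_eq_one {n m : ℕ} {u : Fin n → ℝ} (hu : ∑ i, u i ^ 2 = 1)
    (t : ℝ) : (gaussianPi (Fin n × Fin m)).real {H | t ≤ ‖sketch H u‖ ^ 2} ≤
      √2 ^ m * Real.exp (-t / 4) := by
  have h := gaussianPi_le_sum_sq (ι := Fin m) t
  rw [← gaussianPi_map_sketch hu, map_measureReal_apply (measurable_sum_mul u)
    (measurableSet_le measurable_const (by fun_prop)), Fintype.card_fin] at h
  simpa only [Set.preimage_ofPred_eq, ← norm_sketch_sq] using h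

theorem gaussianPi_norm_sketch_sq_le_of_eq_one {n m : ℕ} {u : Fin n → ℝ} (hu : ∑ i, u i ^ 2 = 1)
    {s : ℝ} (hs : 0 < s) :
    (gaussianPi (Fin n × Fin m)).real {H | ‖sketch H u‖ ^ 2 ≤ s * m} ≤ (2 * √s) ^ m := by
  have h := gaussianPi_sum_sq_le (ι := Fin m) hs
  rw [← gaussianPi_map_sketch hu, map_measureReal_apply (measurable_sum_mul u)
    (measurableSet_le (by fun_prop) measurable_const), Fintype.card_fin] at h
  simpa only [Set.preimage_ofPred_eq, ← norm_sketch_sq] using h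

theorem exists_unit_smul {n : ℕ} {u : Fin n → ℝ}
    (hu : 0 < ‖(WithLp.toLp 2 u : EuclideanSpace ℝ (Fin n))‖) :
    ∃ v : Fin n → ℝ, ∑ i, v i ^ 2 = 1 ∧
      u = ‖(WithLp.toLp 2 u : EuclideanSpace ℝ (Fin n))‖ • v := by
  set r := ‖(WithLp.toLp 2 u : EuclideanSpace ℝ (Fin n))‖ with hr
  refine ⟨r⁻¹ • u, ?_, ?_⟩
  · simp only [Pi.smul_apply, smul_eq_mul, mul_pow, ← Finset.mul_sum]
    rw [sum_sq_eq_norm_sq, ← hr, ← mul_pow, inv_mul_cancel₀ hu.ne', one_pow]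
  · rw [smul_smul, mul_inv_cancel₀ hu.ne', one_smul]

theorem gaussianPi_le_norm_sketch_sq {n m : ℕ} {u : Fin n → ℝ}
    (hu : ‖(WithLp.toLp 2 u : EuclideanSpace ℝ (Fin n))‖ ≤ 1) {t : ℝ} (ht : 0 < t) :
    (gaussianPi (Fin n × Fin m)).real {H | t ≤ ‖sketch H u‖ ^ 2} ≤
      √2 ^ m * Real.exp (-t / 4) := by
  rcases (norm_nonneg (WithLp.toLp 2 u : EuclideanSpace ℝ (Fin n))).eq_or_lt with h0 | h0
  · have hu0 : u = 0 := congrArg WithLp.ofLp (norm_eq_zero.1 h0.symm)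
    have : {H : Fin n × Fin m → ℝ | t ≤ ‖sketch H u‖ ^ 2} = ∅ := by
      ext H
      simp only [Set.mem_ofPred_eq, Set.mem_empty_iff_false, iff_false, not_le]
      rw [hu0]
      simpa [sketch] using ht
    rw [this, measureReal_empty]
    positivity
  · obtain ⟨v, hv, huv⟩ := exists_unit_smul h0
    refine le_trans (measureReal_mono fun H hH => ?_) (gaussianPi_le_norm_sketch_sq_of_eq_one hv t)
    simp only [Set.mem_ofPred_eq] at hH ⊢
    rw [huv, sketch_smul, norm_smul, norm_norm, mul_pow] at hH
    refine hH.trans (mul_le_of_le_one_left (by positivity) ?_)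
    exact pow_le_one₀ (norm_nonneg _) hu

theorem gaussianPi_norm_sketch_sq_le {n m : ℕ} {u : Fin n → ℝ}
    (hu : 1 / 2 ≤ ‖(WithLp.toLp 2 u : EuclideanSpace ℝ (Fin n))‖) {s : ℝ} (hs : 0 < s) :
    (gaussianPi (Fin n × Fin m)).real {H | ‖sketch H u‖ ^ 2 ≤ s * m} ≤ (4 * √s) ^ m := by
  obtain ⟨v, hv, huv⟩ := exists_unit_smul (by linarith :
    0 < ‖(WithLp.toLp 2 u : EuclideanSpace ℝ (Fin n))‖)
  have e : (2 * √(4 * s)) = 4 * √s := by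
    rw [Real.sqrt_mul (by norm_num), show (4 : ℝ) = 2 ^ 2 by norm_num,
      Real.sqrt_sq (by norm_num)]
    ring
  rw [← e]
  refine le_trans (measureReal_mono fun H hH => ?_)
    (gaussianPi_norm_sketch_sq_le_of_eq_one hv (by positivity))
  simp only [Set.mem_ofPred_eq] at hH ⊢
  rw [huv, sketch_smul, norm_smul, norm_norm, mul_pow] at hH
  have h1 : (1 / 4 : ℝ) ≤ ‖(WithLp.toLp 2 u : EuclideanSpace ℝ (Fin n))‖ ^ 2 := by nlinarith
  nlinarith [sq_nonneg ‖sketch H v‖]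

/-! ### The smallest singular value of a Gaussian matrix -/

/-- A volumetric substitute for a net: if every `x ∈ D` is related by `F` to all points of a subset
of the ball of radius `2` which has the volume of a ball of radius `r`, then the measure of `D` is
controlled by the largest measure of a section of `F`. -/
theorem measure_le_of_volume_section {X : Type*} [MeasurableSpace X] (μ : Measure X)
    [IsProbabilityMeasure μ] {k : ℕ} {F : Set (X × EuclideanSpace ℝ (Fin k))}
    (hF : MeasurableSet F) {D : Set X} {r q : ℝ} (hr : 0 < r) (hq : 0 ≤ q)
    (hD : ∀ x ∈ D, ∃ y, Metric.ball y r ⊆ Metric.ball 0 2 ∩ {z | (x, z) ∈ F})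
    (hq' : ∀ y ∈ Metric.ball (0 : EuclideanSpace ℝ (Fin k)) 2, μ.real {x | (x, y) ∈ F} ≤ q) :
    μ.real D ≤ (2 / r) ^ k * q := by
  set v : ENNReal := volume (Metric.ball (0 : EuclideanSpace ℝ (Fin k)) 1) with hv
  have hv0 : v ≠ 0 := (Metric.measure_ball_pos volume _ one_pos).ne'
  have hvt : v ≠ ⊤ := measure_ball_lt_top.ne
  set B : Set (EuclideanSpace ℝ (Fin k)) := Metric.ball 0 2
  set F' : Set (X × EuclideanSpace ℝ (Fin k)) := F ∩ (Set.univ ×ˢ B) with hF'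
  have hF'm : MeasurableSet F' := hF.inter (MeasurableSet.univ.prod Metric.isOpen_ball.measurableSet)
  have hball : ∀ (y : EuclideanSpace ℝ (Fin k)) {s : ℝ}, 0 < s →
      volume (Metric.ball y s) = ENNReal.ofReal (s ^ k) * v := by
    intro y s hs
    rw [Measure.addHaar_ball_of_pos volume y hs]
    simp [hv]
  have hsec : ∀ x ∈ D, ENNReal.ofReal (r ^ k) * v ≤ volume (Prod.mk x ⁻¹' F') := by
    intro x hx
    obtain ⟨y, hy⟩ := hD x hx
    rw [← hball y hr]
    refine measure_mono fun z hz => ?_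
    exact ⟨(hy hz).2, Set.mem_univ _, (hy hz).1⟩
  have h1 : ENNReal.ofReal (r ^ k) * v * μ D ≤ (μ.prod (volume : Measure (EuclideanSpace ℝ (Fin k)))) F' := by
    rw [Measure.prod_apply hF'm]
    refine le_trans ?_ (mul_meas_ge_le_lintegral
      (measurable_measure_prodMk_left hF'm) (ENNReal.ofReal (r ^ k) * v))
    exact mul_le_mul_right (measure_mono hsec) _
  have h2 : (μ.prod (volume : Measure (EuclideanSpace ℝ (Fin k)))) F' ≤ ENNReal.ofReal q * (ENNReal.ofReal (2 ^ k) * v) := by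
    rw [Measure.prod_apply_symm hF'm, ← hball 0 two_pos, ← setLIntegral_const,
      ← lintegral_indicator Metric.isOpen_ball.measurableSet]
    refine lintegral_mono fun y => ?_
    by_cases hy : y ∈ B
    · rw [Set.indicator_of_mem hy]
      have h3 := hq' y hy
      rw [← ENNReal.ofReal_le_ofReal_iff hq, ofReal_measureReal] at h3
      refine le_trans (measure_mono fun x hx => ?_) h3
      exact hx.1
    · have : (fun x => (x, y)) ⁻¹' F' = ∅ := by
        ext x
        simp only [Set.mem_preimage, Set.mem_empty_iff_false, iff_false]
        exact fun hx => hy hx.2.2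
      rw [this]; simp
  have h3 : ENNReal.ofReal (r ^ k) * μ D ≤ ENNReal.ofReal (q * 2 ^ k) := by
    rw [ENNReal.ofReal_mul hq]
    have h4 := h1.trans h2
    rw [mul_right_comm, ← mul_assoc] at h4
    exact (ENNReal.mul_le_mul_iff_left hv0 hvt).1 h4
  have h4 : r ^ k * μ.real D ≤ q * 2 ^ k := by
    have h5 := ENNReal.toReal_mono ENNReal.ofReal_ne_top h3
    rwa [ENNReal.toReal_mul, ENNReal.toReal_ofReal (by positivity),
      ENNReal.toReal_ofReal (by positivity)] at h5
  rw [div_pow, div_mul_eq_mul_div, le_div_iff₀ (by positivity)]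
  linarith

open scoped Matrix.Norms.L2Operator in
theorem norm_sketch_le {n m : ℕ} (H : Fin n × Fin m → ℝ) (u : Fin n → ℝ) :
    ‖sketch H u‖ ≤ ‖(toMatrix H)ᵀ‖ * ‖(WithLp.toLp 2 u : EuclideanSpace ℝ (Fin n))‖ :=
  norm_mulVec_le _ _

theorem continuous_norm_sketch {n m : ℕ} :
    Continuous fun p : (Fin n × Fin m → ℝ) × EuclideanSpace ℝ (Fin n) =>
      ‖sketch p.1 p.2.ofLp‖ :=
  (continuous_sketch.comp (continuous_fst.prodMk
    ((PiLp.continuous_ofLp 2 _).comp continuous_snd))).norm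

-- A unit-ball vector stretched by more than `3/4` of the norm forces every vector within `1/4` of
-- it to be stretched by at least half the norm. The volume argument with radius `1/4` costs `8^k`;
-- the remaining factor is the chi-square tail.
open scoped Matrix.Norms.L2Operator in
theorem gaussianPi_lt_norm {k m : ℕ} {K : ℝ} (hK : 0 < K) (hm : 0 < m) :
    (gaussianPi (Fin k × Fin m)).real {H | K * √m < ‖(toMatrix H)ᵀ‖} ≤
      8 ^ k * (√2 ^ m * Real.exp (-(K ^ 2 / 64) * m)) := by
  have hm' : (0 : ℝ) < m := by exact_mod_cast hm
  have hsm : 0 < √(m : ℝ) := Real.sqrt_pos.2 hm'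
  set F : Set ((Fin k × Fin m → ℝ) × EuclideanSpace ℝ (Fin k)) :=
    {p | K * √m / 2 ≤ ‖sketch p.1 p.2.ofLp‖} with hF
  have hFm : MeasurableSet F :=
    measurableSet_le measurable_const continuous_norm_sketch.measurable
  have h8 : (8 : ℝ) = 2 / (1 / 4) := by norm_num
  rw [h8]
  refine measure_le_of_volume_section _ hFm (by norm_num) (by positivity) ?_ ?_
  · intro H hH
    simp only [Set.mem_ofPred_eq] at hH
    set N := ‖(toMatrix H)ᵀ‖ with hN
    have hNpos : 0 < N := lt_trans (by positivity) hH
    have hlt : 3 / 4 * N < ‖(Matrix.toEuclideanLin (𝕜 := ℝ) (m := Fin m) (n := Fin k)).trans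
        LinearMap.toContinuousLinearMap (toMatrix H)ᵀ‖ := by
      rw [← Matrix.l2_opNorm_def]; linarith
    obtain ⟨x, hx1, hx2⟩ := ContinuousLinearMap.exists_lt_apply_of_lt_opNorm _ hlt
    have hx2' : 3 / 4 * N < ‖sketch H x.ofLp‖ := hx2
    refine ⟨x, fun y hy => ⟨?_, ?_⟩⟩
    · rw [mem_ball_iff_norm] at hy
      rw [mem_ball_zero_iff]
      have := norm_sub_norm_le y x
      linarith
    · rw [mem_ball_iff_norm] at hy
      simp only [hF, Set.mem_ofPred_eq]
      have h1 : ‖sketch H (y - x).ofLp‖ ≤ N * ‖y - x‖ := norm_sketch_le H _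
      have h2 : sketch H x.ofLp = sketch H y.ofLp - sketch H (y - x).ofLp := by
        rw [← sketch_sub]; congr 1; simp
      have h3 := norm_sub_le (sketch H y.ofLp) (sketch H (y - x).ofLp)
      rw [← h2] at h3
      nlinarith
  · intro y hy
    rw [mem_ball_zero_iff] at hy
    have hu : ‖(WithLp.toLp 2 ((1 / 2 : ℝ) • y.ofLp) : EuclideanSpace ℝ (Fin k))‖ ≤ 1 := by
      rw [WithLp.toLp_smul, norm_smul]
      simp only [WithLp.toLp_ofLp, Real.norm_eq_abs]
      rw [abs_of_pos (by norm_num)]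
      linarith
    have h1 := gaussianPi_le_norm_sketch_sq (m := m) hu
      (show 0 < (K * √m / 4) ^ 2 by positivity)
    have e : -(K * √m / 4) ^ 2 / 4 = -(K ^ 2 / 64) * m := by
      rw [div_pow, mul_pow, Real.sq_sqrt hm'.le]; ring
    rw [e] at h1
    refine le_trans (measureReal_mono fun H hH => ?_) h1
    simp only [hF, Set.mem_ofPred_eq] at hH ⊢
    rw [sketch_smul, norm_smul, Real.norm_eq_abs, abs_of_pos (by norm_num)]
    exact pow_le_pow_left₀ (by positivity) (by linarith) 2

/-- The event that `Hᵀ` shrinks some vector by more than the factor `c √m`. -/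
def shrinkSet (c : ℝ) (k m : ℕ) : Set (Fin k × Fin m → ℝ) :=
  {H | ∃ z : Fin k → ℝ, ‖sketch H z‖ < c * √m * ‖(WithLp.toLp 2 z : EuclideanSpace ℝ (Fin k))‖}

-- If `‖Hᵀ‖ ≤ K √m` and a unit vector is sent below `c √m`, then all vectors within `c/K` of it are
-- sent below `2c √m`, and their norm is at least `1/2`. For each such vector the small-ball bound
-- is `(8c)^m`.
open scoped Matrix.Norms.L2Operator in
theorem gaussianPi_shrinkSet_diff_le {k m : ℕ} {K c : ℝ} (hK : 0 < K) (hc : 0 < c)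
    (hcK : c ≤ K / 2) :
    (gaussianPi (Fin k × Fin m)).real
      (shrinkSet c k m \ {H | K * √m < ‖(toMatrix H)ᵀ‖}) ≤
      (2 * K / c) ^ k * (8 * c) ^ m := by
  set F : Set ((Fin k × Fin m → ℝ) × EuclideanSpace ℝ (Fin k)) :=
    {p | ‖sketch p.1 p.2.ofLp‖ ≤ 2 * c * √m ∧ 1 / 2 ≤ ‖p.2‖} with hF
  have hFm : MeasurableSet F :=
    (measurableSet_le continuous_norm_sketch.measurable measurable_const).inter
      (measurableSet_le measurable_const continuous_snd.norm.measurable)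
  have h8 : 2 * K / c = 2 / (c / K) := by field_simp
  rw [h8]
  have hcK' : c / K ≤ 1 / 2 := by rw [div_le_iff₀ hK]; linarith
  refine measure_le_of_volume_section _ hFm (by positivity) (by positivity) ?_ ?_
  · rintro H ⟨⟨z, hz⟩, hH⟩
    simp only [Set.mem_ofPred_eq, not_lt] at hH
    have hz0 : 0 < ‖(WithLp.toLp 2 z : EuclideanSpace ℝ (Fin k))‖ := by
      by_contra! h0
      have h1 := le_antisymm h0 (norm_nonneg _)
      rw [h1, mul_zero] at hz
      exact absurd hz (not_lt.2 (norm_nonneg _))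
    set r := ‖(WithLp.toLp 2 z : EuclideanSpace ℝ (Fin k))‖ with hr
    set x : EuclideanSpace ℝ (Fin k) := WithLp.toLp 2 (r⁻¹ • z) with hx
    have hx1 : ‖x‖ = 1 := by
      rw [hx, WithLp.toLp_smul, norm_smul, ← hr, Real.norm_eq_abs, abs_of_pos (by positivity),
        inv_mul_cancel₀ hz0.ne']
    have hx2 : ‖sketch H x.ofLp‖ < c * √m := by
      have : sketch H x.ofLp = r⁻¹ • sketch H z := sketch_smul H r⁻¹ z
      rw [this, norm_smul, Real.norm_eq_abs, abs_of_pos (by positivity), inv_mul_lt_iff₀ hz0]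
      linarith
    refine ⟨x, fun y hy => ?_⟩
    rw [mem_ball_iff_norm] at hy
    refine ⟨?_, ?_, ?_⟩
    · rw [mem_ball_zero_iff]
      have := norm_sub_norm_le y x
      linarith
    · have h1 : ‖sketch H (y - x).ofLp‖ ≤ K * √m * (c / K) :=
        (norm_sketch_le H _).trans
          (mul_le_mul hH hy.le (norm_nonneg _) (by positivity))
      have h2 : sketch H y.ofLp = sketch H x.ofLp + sketch H (y - x).ofLp := by
        rw [← sketch_add]; congr 1; simp
      have h3 := norm_add_le (sketch H x.ofLp) (sketch H (y - x).ofLp)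
      rw [← h2] at h3
      have h4 : K * √m * (c / K) = c * √m := by field_simp
      change ‖sketch H y.ofLp‖ ≤ 2 * c * √m
      linarith
    · have := norm_sub_norm_le x y
      rw [norm_sub_rev] at this
      change 1 / 2 ≤ ‖y‖
      linarith
  · intro y hy
    by_cases hy2 : 1 / 2 ≤ ‖y‖
    · have h1 := gaussianPi_norm_sketch_sq_le (m := m) (u := y.ofLp) hy2
        (show 0 < (2 * c) ^ 2 by positivity)
      rw [Real.sqrt_sq (by positivity), show 4 * (2 * c) = 8 * c by ring] at h1
      refine le_trans (measureReal_mono fun H hH => ?_) h1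
      have h2 : ‖sketch H y.ofLp‖ ≤ 2 * c * √m := hH.1
      simp only [Set.mem_ofPred_eq]
      calc ‖sketch H y.ofLp‖ ^ 2 ≤ (2 * c * √m) ^ 2 := pow_le_pow_left₀ (norm_nonneg _) h2 2
        _ = _ := by rw [mul_pow, Real.sq_sqrt (Nat.cast_nonneg m)]
    · have : {H : Fin k × Fin m → ℝ | (H, y) ∈ F} = ∅ := by
        ext H
        simp only [Set.mem_ofPred_eq, Set.mem_empty_iff_false, iff_false]
        exact fun h => hy2 h.2
      rw [this, measureReal_empty]
      positivity

/-- The volume factor `(48/c)^k` competes with the small-ball factor `(8c)^m`. As `k ≤ m/ρ`, their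
product is at most `(384 c^(1 - 1/ρ))^m`, which is as small as desired for small `c` because `ρ >
1`. -/
theorem exists_gaussianPi_shrinkSet_le {ρ : ℝ} (hρ : 1 < ρ) :
    ∃ c : ℝ, 0 < c ∧ ∀ k m : ℕ, 0 < m → ρ * k ≤ m →
      (gaussianPi (Fin k × Fin m)).real (shrinkSet c k m) ≤ Real.exp (-m) := by
  set θ : ℝ := 1 - 1 / ρ with hθ
  have hθ0 : 0 < θ := by
    have : 1 / ρ < 1 := by rw [div_lt_one (by linarith)]; exact hρ
    linarith
  have hθ1 : θ ≤ 1 := by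
    have : 0 < 1 / ρ := by positivity
    linarith
  -- Chosen so that `c^θ = 1/4000`, whence `384 c^θ ≤ e^(-2)`. The norm threshold `K = 24` makes the
  -- other contribution at most `(8 √2 e^(-9))^m`, also below `e^(-2m)`; each is thus at most half
  -- of `e^(-m)`.
  set c : ℝ := (1 / 4000 : ℝ) ^ (1 / θ) with hc
  have hc0 : 0 < c := by positivity
  have hc1 : c ≤ 1 := Real.rpow_le_one (by norm_num) (by norm_num) (by positivity)
  have hcθ : c ^ θ = 1 / 4000 := by
    rw [hc, ← Real.rpow_mul (by norm_num), one_div_mul_cancel hθ0.ne', Real.rpow_one]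
  refine ⟨c, hc0, fun k m hm hkm => ?_⟩
  have hm' : (1 : ℝ) ≤ m := by exact_mod_cast hm
  have hkm' : (k : ℝ) ≤ m := by nlinarith [Nat.cast_nonneg (α := ℝ) k]
  have hkmn : k ≤ m := by exact_mod_cast hkm'
  open scoped Matrix.Norms.L2Operator in
  have h1 : (gaussianPi (Fin k × Fin m)).real (shrinkSet c k m) ≤
      8 ^ k * (√2 ^ m * Real.exp (-((24 : ℝ) ^ 2 / 64) * m)) +
        (2 * 24 / c) ^ k * (8 * c) ^ m := by
    refine (measureReal_mono (fun H hH => ?_)).trans ((measureReal_union_le _ _).trans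
      (add_le_add (gaussianPi_lt_norm (by norm_num) hm)
        (gaussianPi_shrinkSet_diff_le (K := 24) (by norm_num) hc0 (by linarith))))
    by_cases hb : 24 * √m < ‖(toMatrix H)ᵀ‖
    · exact Or.inl hb
    · exact Or.inr ⟨hH, hb⟩
  have hexp1 : Real.exp 1 ≤ 2.72 := (Real.exp_one_lt_d9.le).trans (by norm_num)
  have hexp1' : 2.7 ≤ Real.exp 1 := le_trans (by norm_num) Real.exp_one_gt_d9.le
  have hexp2 : Real.exp (-2) = (Real.exp 1 ^ 2)⁻¹ := by
    rw [← Real.exp_nat_mul, ← Real.exp_neg]; norm_num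
  have hhalf : Real.exp (-2) ^ m ≤ Real.exp (-m) / 2 := by
    have e : Real.exp (-2) ^ m = Real.exp (-m) * Real.exp (-m) := by
      rw [← Real.exp_nat_mul, ← Real.exp_add]; congr 1; ring
    have h2 : Real.exp (-m) ≤ 1 / 2 := by
      have h3 : Real.exp (-(m : ℝ)) ≤ Real.exp (-1) := Real.exp_le_exp.2 (by linarith)
      have h4 : Real.exp (-1) ≤ 1 / 2 := by
        rw [Real.exp_neg, inv_le_comm₀ (Real.exp_pos 1) (by norm_num)]; linarith
      linarith
    rw [e]
    nlinarith [Real.exp_pos (-(m : ℝ))]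
  have ha : 8 ^ k * (√2 ^ m * Real.exp (-((24 : ℝ) ^ 2 / 64) * m)) ≤ Real.exp (-2) ^ m := by
    have e : Real.exp (-((24 : ℝ) ^ 2 / 64) * m) = (Real.exp (-9)) ^ m := by
      rw [← Real.exp_nat_mul]; congr 1; ring
    have h8 : (8 : ℝ) ^ k ≤ 8 ^ m := pow_le_pow_right₀ (by norm_num) hkmn
    rw [e, ← mul_pow]
    calc (8 : ℝ) ^ k * (√2 * Real.exp (-9)) ^ m ≤ 8 ^ m * (√2 * Real.exp (-9)) ^ m :=
          mul_le_mul_of_nonneg_right h8 (by positivity)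
      _ = (8 * (√2 * Real.exp (-9))) ^ m := by rw [← mul_pow]
      _ ≤ _ := by
        refine pow_le_pow_left₀ (by positivity) ?_ m
        have h9 : Real.exp (-9) = Real.exp (-2) * (Real.exp 1 ^ 7)⁻¹ := by
          rw [← Real.exp_nat_mul, ← Real.exp_neg, ← Real.exp_add]; norm_num
        have hs : √2 ≤ 2 := by
          rw [Real.sqrt_le_left (by norm_num)]; norm_num
        have h10 : (16 : ℝ) ≤ Real.exp 1 ^ 7 :=
          le_trans (by norm_num) (pow_le_pow_left₀ (by norm_num) hexp1' 7)
        have h11 : (Real.exp 1 ^ 7)⁻¹ ≤ 1 / 16 := by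
          rw [inv_le_comm₀ (by positivity) (by norm_num)]; linarith
        have h12 : √2 * (Real.exp 1 ^ 7)⁻¹ ≤ 2 * (1 / 16) :=
          mul_le_mul hs h11 (by positivity) (by norm_num)
        rw [h9]
        nlinarith [Real.exp_pos (-2)]
  have hb : (2 * 24 / c) ^ k * (8 * c) ^ m ≤ Real.exp (-2) ^ m := by
    have h48 : (2 * 24 / c) ^ k ≤ 48 ^ m * (c ^ (-(1 / ρ))) ^ m := by
      rw [div_pow]
      have h2 : (2 * 24 : ℝ) ^ k ≤ 48 ^ m := by
        norm_num
        exact pow_le_pow_right₀ (by norm_num) hkmn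
      have h3 : (c ^ k)⁻¹ ≤ (c ^ (-(1 / ρ))) ^ m := by
        rw [← Real.rpow_natCast, ← Real.rpow_natCast, ← Real.rpow_mul hc0.le,
          ← Real.rpow_neg hc0.le]
        refine Real.rpow_le_rpow_of_exponent_ge hc0 hc1 ?_
        have : (k : ℝ) ≤ 1 / ρ * m := by
          rw [one_div_mul_eq_div, le_div_iff₀ (by linarith)]; linarith
        linarith
      rw [div_eq_mul_inv]
      exact mul_le_mul h2 h3 (by positivity) (by positivity)
    calc (2 * 24 / c) ^ k * (8 * c) ^ m
        ≤ (48 ^ m * (c ^ (-(1 / ρ))) ^ m) * (8 * c) ^ m :=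
          mul_le_mul_of_nonneg_right h48 (by positivity)
      _ = (384 * (c ^ (-(1 / ρ)) * c)) ^ m := by
          rw [← mul_pow, ← mul_pow]; congr 1; ring
      _ = (384 * (1 / 4000)) ^ m := by
          congr 2
          rw [← hcθ, hθ]
          conv_lhs => enter [2]; rw [← Real.rpow_one c]
          rw [← Real.rpow_add hc0]; congr 1; ring
      _ ≤ _ := by
          refine pow_le_pow_left₀ (by norm_num) ?_ m
          rw [hexp2, le_inv_comm₀ (by norm_num) (by positivity)]
          calc Real.exp 1 ^ 2 ≤ 2.72 ^ 2 := pow_le_pow_left₀ (Real.exp_pos 1).le hexp1 2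
            _ ≤ _ := by norm_num
  linarith

-- When `m` is not much larger than `k`, only positivity is available. Within distance `1/2` of the
-- coordinate isometry `H₀`, no vector shrinks by more than a factor `1/2`, and this open set has
-- positive Gaussian measure.
open scoped Matrix.Norms.L2Operator in
theorem gaussianPi_shrinkSet_lt_one {k m : ℕ} (hkm : k ≤ m) (hm : 0 < m) :
    (gaussianPi (Fin k × Fin m)).real (shrinkSet (1 / (2 * √m)) k m) < 1 := by
  have hsm : 0 < √(m : ℝ) := Real.sqrt_pos.2 (by exact_mod_cast hm)
  set H₀ : Fin k × Fin m → ℝ := fun p => if (p.1 : ℕ) = p.2 then 1 else 0 with hH₀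
  set O : Set (Fin k × Fin m → ℝ) := {H | ‖(toMatrix H)ᵀ - (toMatrix H₀)ᵀ‖ < 1 / 2} with hO
  have hcont : Continuous fun H : Fin k × Fin m → ℝ => (toMatrix H)ᵀ :=
    continuous_matrix fun i j => by simp only [toMatrix, Matrix.transpose_apply, Matrix.of_apply]; fun_prop
  have hOo : IsOpen O := isOpen_lt (hcont.sub continuous_const).norm continuous_const
  have hOn : O.Nonempty := ⟨H₀, by simp [hO]⟩
  have hpos : 0 < (gaussianPi (Fin k × Fin m)).real O := by
    rw [measureReal_def]
    exact ENNReal.toReal_pos (hOo.measure_pos _ hOn).ne' (measure_ne_top _ _)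
  have hiso : (toMatrix H₀)ᵀᵀ * (toMatrix H₀)ᵀ = 1 := by
    ext i j
    simp only [Matrix.mul_apply, Matrix.transpose_transpose, Matrix.transpose_apply, toMatrix,
      Matrix.of_apply, hH₀, Matrix.one_apply]
    rw [Finset.sum_eq_single ⟨i, by omega⟩]
    · by_cases hij : i = j
      · subst hij; simp
      · have : (j : ℕ) ≠ i := fun h => hij (Fin.ext h.symm)
        simp [hij, this]
    · intro b _ hb
      have : (i : ℕ) ≠ b := fun h => hb (Fin.ext h.symm)
      simp [this]
    · simp
  have hsub : shrinkSet (1 / (2 * √m)) k m ⊆ Oᶜ := by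
    rintro H ⟨z, hz⟩ hHO
    have hHO' : ‖(toMatrix H)ᵀ - (toMatrix H₀)ᵀ‖ < 1 / 2 := hHO
    have e1 : 1 / (2 * √m) * √m = 1 / 2 := by field_simp
    rw [e1] at hz
    have h1 : ‖sketch H₀ z‖ = ‖(WithLp.toLp 2 z : EuclideanSpace ℝ (Fin k))‖ :=
      norm_mulVec_of_transpose_mul_self hiso z
    have h2 := norm_mulVec_le ((toMatrix H)ᵀ - (toMatrix H₀)ᵀ) z
    have e2 : (WithLp.toLp 2 (((toMatrix H)ᵀ - (toMatrix H₀)ᵀ) *ᵥ z) :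
        EuclideanSpace ℝ (Fin m)) = sketch H z - sketch H₀ z := by
      rw [Matrix.sub_mulVec]; rfl
    rw [e2] at h2
    have h3 := norm_sub_norm_le (sketch H₀ z) (sketch H z)
    rw [norm_sub_rev] at h3
    nlinarith [norm_nonneg (WithLp.toLp 2 z : EuclideanSpace ℝ (Fin k))]
  have h1 := measureReal_mono (μ := gaussianPi (Fin k × Fin m)) hsub
  rw [probReal_compl_eq_one_sub hOo.measurableSet] at h1
  linarith

theorem isOpen_shrinkSet (c : ℝ) (k m : ℕ) : IsOpen (shrinkSet c k m) := by
  have : shrinkSet c k m = ⋃ z : Fin k → ℝ, {H | ‖sketch H z‖ <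
      c * √m * ‖(WithLp.toLp 2 z : EuclideanSpace ℝ (Fin k))‖} := by
    ext H; simp [shrinkSet]
  rw [this]
  refine isOpen_iUnion fun z => isOpen_lt ?_ continuous_const
  exact (continuous_sketch.comp (continuous_id.prodMk continuous_const)).norm

/-! ### Gaussian sketches: independence -/

theorem gaussianPi_prod_eq_map {α β : Type*} [Fintype α] [Fintype β] :
    (Measure.pi fun _ : α => gaussianPi β).map (fun x (q : α × β) => x q.1 q.2) =
      gaussianPi (α × β) := by
  symm
  refine Measure.pi_eq fun s hs => ?_
  have hm : Measurable fun (x : α → β → ℝ) (q : α × β) => x q.1 q.2 := by fun_prop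
  rw [Measure.map_apply hm (MeasurableSet.univ_pi hs)]
  have e : (fun (x : α → β → ℝ) (q : α × β) => x q.1 q.2) ⁻¹' (Set.univ.pi s) =
      Set.univ.pi fun b => Set.univ.pi fun p => s (b, p) := by
    ext x
    simp [Set.mem_pi]
  rw [e, Measure.pi_pi, Fintype.prod_prod_type]
  refine Finset.prod_congr rfl fun b _ => ?_
  rw [gaussianPi, Measure.pi_pi]

/-- The family of all entries of the sketching matrices. -/
def sketchEntries {Ω : Type*} {n m a : ℕ} (G : Fin a → Ω → Matrix (Fin n) (Fin m) ℝ) (ω : Ω)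
    (q : Fin a × Fin n × Fin m) : ℝ := G q.1 ω q.2.1 q.2.2

/-- The family of all entries of the noise matrix. -/
def noiseEntries {Ω : Type*} {n : ℕ} (E : Ω → Matrix (Fin n) (Fin n) ℝ) (ω : Ω)
    (p : Fin n × Fin n) : ℝ := E ω p.1 p.2

/-- The entries of the `b`-th sketching matrix. -/
def slice {n m a : ℕ} (b : Fin a) (h : Fin a × Fin n × Fin m → ℝ) (p : Fin n × Fin m) : ℝ :=
  h (b, p)

@[fun_prop]
theorem continuous_slice {n m a : ℕ} (b : Fin a) : Continuous (slice (n := n) (m := m) b) := by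
  unfold slice; fun_prop

theorem gaussianPi_map_slice {n m a : ℕ} (b : Fin a) :
    (gaussianPi (Fin a × Fin n × Fin m)).map (slice b) = gaussianPi (Fin n × Fin m) := by
  rw [← gaussianPi_prod_eq_map, Measure.map_map (continuous_slice b).measurable (by fun_prop)]
  exact (measurePreserving_eval (fun _ : Fin a => gaussianPi (Fin n × Fin m)) b).map_eq

theorem gaussianPi_forall_slice_mem {n m a : ℕ} {D : Set (Fin n × Fin m → ℝ)}
    (hD : MeasurableSet D) :
    (gaussianPi (Fin a × Fin n × Fin m)).real {h | ∀ b, slice b h ∈ D} =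
      (gaussianPi (Fin n × Fin m)).real D ^ a := by
  have hS : MeasurableSet {h : Fin a × Fin n × Fin m → ℝ | ∀ b, slice b h ∈ D} := by
    have : {h : Fin a × Fin n × Fin m → ℝ | ∀ b, slice b h ∈ D} = ⋂ b, slice b ⁻¹' D := by
      ext h; simp
    rw [this]
    exact MeasurableSet.iInter fun b => (continuous_slice b).measurable hD
  rw [← gaussianPi_prod_eq_map, map_measureReal_apply (by fun_prop) hS]
  have e : (fun (x : Fin a → Fin n × Fin m → ℝ) (q : Fin a × Fin n × Fin m) => x q.1 q.2) ⁻¹'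
      {h | ∀ b, slice b h ∈ D} = Set.univ.pi fun _ => D := by
    ext x
    simp only [Set.mem_preimage, Set.mem_ofPred_eq, Set.mem_pi, Set.mem_univ, true_imp_iff]
    rfl
  rw [e, measureReal_def, Measure.pi_pi, ENNReal.toReal_prod]
  simp [measureReal_def]

section Sketch

variable {Ω : Type*} [MeasurableSpace Ω] {P : Measure Ω} {n m a : ℕ}
  {G : Fin a → Ω → Matrix (Fin n) (Fin m) ℝ} {E : Ω → Matrix (Fin n) (Fin n) ℝ}

theorem measurable_sketchEntries (hG : IsGaussianSketch P G E) :
    Measurable (sketchEntries G) :=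
  measurable_pi_lambda _ fun q => hG.measurable q.1 q.2.1 q.2.2

theorem measurable_noiseEntries (hE : IsRandomSymmetric E) :
    Measurable (noiseEntries E) :=
  measurable_pi_lambda _ fun q => hE.measurable q.1 q.2

theorem map_sketchEntries [IsProbabilityMeasure P] (hG : IsGaussianSketch P G E) :
    P.map (sketchEntries G) = gaussianPi (Fin a × Fin n × Fin m) := by
  have h := hG.indep_entries.map_fun_eq_pi_map
    (fun q : Fin a × Fin n × Fin m => (hG.measurable q.1 q.2.1 q.2.2).aemeasurable)
  simp only [hG.law] at h
  exact h

/-- Fubini: the sketching matrices are integrated out first. -/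
theorem measureReal_sketch_noise_le [IsProbabilityMeasure P] (hG : IsGaussianSketch P G E) (hE : IsRandomSymmetric E)
    {S : Set ((Fin a × Fin n × Fin m → ℝ) × (Fin n × Fin n → ℝ))} (hS : MeasurableSet S) {q : ℝ}
    (hq : 0 ≤ q) (h : ∀ e, (gaussianPi (Fin a × Fin n × Fin m)).real {x | (x, e) ∈ S} ≤ q) :
    P.real {ω | (sketchEntries G ω, noiseEntries E ω) ∈ S} ≤ q := by
  have hmG := measurable_sketchEntries hG
  have hmE := measurable_noiseEntries hE
  have hind := (indepFun_iff_map_prod_eq_prod_map_map hmG.aemeasurable hmE.aemeasurable).1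
    hG.indep_noise
  have : IsProbabilityMeasure (P.map (noiseEntries E)) :=
    Measure.isProbabilityMeasure_map hmE.aemeasurable
  have e : P {ω | (sketchEntries G ω, noiseEntries E ω) ∈ S} =
      ((gaussianPi (Fin a × Fin n × Fin m)).prod (P.map (noiseEntries E))) S := by
    rw [← map_sketchEntries hG, ← hind, Measure.map_apply (hmG.prodMk hmE) hS]
    rfl
  refine ENNReal.toReal_le_of_le_ofReal hq ?_
  rw [e, Measure.prod_apply_symm hS]
  calc _ ≤ ∫⁻ _, ENNReal.ofReal q ∂(P.map (noiseEntries E)) := by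
        refine lintegral_mono fun x => ?_
        have h3 := h x
        rwa [← ENNReal.ofReal_le_ofReal_iff hq, ofReal_measureReal] at h3
    _ = _ := by simp

end Sketch

/-! ### Tail and shrinkage events over all sketches -/

theorem gaussianPi_exists_slice_le {n m a : ℕ} (u : Fin n → Fin n → ℝ)
    (hu : ∀ i, ‖(WithLp.toLp 2 (u i) : EuclideanSpace ℝ (Fin n))‖ ≤ 1) {t : ℝ} (ht : 0 < t) :
    (gaussianPi (Fin a × Fin n × Fin m)).real
      {h | ∃ b i, t ≤ ‖sketch (slice b h) (u i)‖ ^ 2} ≤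
      a * n * (√2 ^ m * Real.exp (-t / 4)) := by
  have e : {h : Fin a × Fin n × Fin m → ℝ | ∃ b i, t ≤ ‖sketch (slice b h) (u i)‖ ^ 2} =
      ⋃ q ∈ (Finset.univ : Finset (Fin a × Fin n)),
        slice q.1 ⁻¹' {H | t ≤ ‖sketch H (u q.2)‖ ^ 2} := by
    ext h; simp
  rw [e]
  refine (measureReal_biUnion_finset_le _ _).trans ?_
  have hq : ∀ q ∈ (Finset.univ : Finset (Fin a × Fin n)),
      (gaussianPi (Fin a × Fin n × Fin m)).real
        (slice q.1 ⁻¹' {H | t ≤ ‖sketch H (u q.2)‖ ^ 2}) ≤ √2 ^ m * Real.exp (-t / 4) := by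
    intro q _
    have hm : MeasurableSet {H : Fin n × Fin m → ℝ | t ≤ ‖sketch H (u q.2)‖ ^ 2} :=
      measurableSet_le measurable_const
        ((continuous_sketch.comp (continuous_id.prodMk continuous_const)).norm.pow 2).measurable
    rw [← map_measureReal_apply (continuous_slice q.1).measurable hm, gaussianPi_map_slice]
    exact gaussianPi_le_norm_sketch_sq (hu q.2) ht
  refine (Finset.sum_le_sum hq).trans ?_
  simp

/-- Each slice restricted to the range of `W` is again a standard Gaussian matrix, and the slices
are independent, so the probability that all of them fail is an `a`-th power. -/
theorem gaussianPi_forall_slice_shrink_le {n m a k : ℕ} (c : ℝ) (W : Matrix (Fin n) (Fin k) ℝ)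
    (hW : Wᵀ * W = 1) :
    (gaussianPi (Fin a × Fin n × Fin m)).real
      {h | ∀ b, ∃ z : Fin k → ℝ, ‖sketch (slice b h) (W *ᵥ z)‖ <
        c * √m * ‖(WithLp.toLp 2 z : EuclideanSpace ℝ (Fin k))‖} ≤
      (gaussianPi (Fin k × Fin m)).real (shrinkSet c k m) ^ a := by
  have hmeas : Measurable fun (H : Fin n × Fin m → ℝ) (p : Fin k × Fin m) =>
      ∑ i, H (i, p.2) * W i p.1 := by fun_prop
  have hD := (isOpen_shrinkSet c k m).measurableSet
  rw [← gaussianPi_map_transpose_mul W hW, map_measureReal_apply hmeas hD,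
    ← gaussianPi_forall_slice_mem (hmeas hD)]
  refine (measureReal_mono fun h hh b => ?_)
  obtain ⟨z, hz⟩ := hh b
  refine ⟨z, ?_⟩
  have e : sketch (fun p : Fin k × Fin m => ∑ i, slice b h (i, p.2) * W i p.1) z =
      sketch (slice b h) (W *ᵥ z) := by
    ext j
    rw [sketch_apply, sketch_apply]
    simp only [Matrix.mulVec, dotProduct, Finset.mul_sum, Finset.sum_mul]
    rw [Finset.sum_comm]
    exact Finset.sum_congr rfl fun _ _ => Finset.sum_congr rfl fun _ _ => by ring
  rwa [e]

section Deterministic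

open scoped Matrix.Norms.L2Operator

/-! ### The good event for the sketching matrices -/

/-- The entries of symmetric matrices of norm at most `ε`. -/
def noiseBall (n : ℕ) (ε : ℝ) : Set (Fin n × Fin n → ℝ) :=
  {e | (toMatrix e).IsSymm ∧ ‖toMatrix e‖ ≤ ε}

theorem continuous_toMatrix {n m : ℕ} : Continuous (toMatrix (n := n) (m := m)) :=
  continuous_matrix fun i j => by simp only [toMatrix, Matrix.of_apply]; fun_prop

theorem isClosed_noiseBall (n : ℕ) (ε : ℝ) : IsClosed (noiseBall n ε) :=
  (isClosed_eq continuous_toMatrix.matrix_transpose continuous_toMatrix).inter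
    (isClosed_le continuous_toMatrix.norm continuous_const)

/-- Needed for measurability of the events that involve `Q`. The functional calculus of a continuous
function depends continuously on a matrix whose spectrum stays in a compact set; for this the cutoff
is continuous rather than an indicator. -/
theorem continuousOn_spectralCut {n : ℕ} {M : Matrix (Fin n) (Fin n) ℝ} (hM : M.IsSymm) (ε L : ℝ) :
    ContinuousOn (fun e => spectralCut ε L (M + toMatrix e)) (noiseBall n ε) := by
  have h := continuousOn_cfc (Matrix (Fin n) (Fin n) ℝ) (𝕜 := ℝ)
    (isCompact_closedBall (0 : ℝ) (‖M‖ + ε)) (cutoff ε L) (continuous_cutoff ε L).continuousOn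
  refine h.comp (continuous_const.add continuous_toMatrix).continuousOn fun e he => ⟨?_, ?_⟩
  · exact isSelfAdjoint_of_isSymm (hM.add he.1)
  · intro x hx
    rw [mem_closedBall_zero_iff]
    rcases Nat.eq_zero_or_pos n with rfl | hn
    · exact absurd hx (by simp [spectrum.of_subsingleton])
    · have : Nonempty (Fin n) := ⟨⟨0, hn⟩⟩
      have h1 := spectrum.norm_le_norm_mul_of_mem hx
      have h2 : ‖(1 : Matrix (Fin n) (Fin n) ℝ)‖ ≤ 1 :=
        norm_le_one_of_transpose_mul_self (by simp)
      have h3 := norm_add_le M (toMatrix e)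
      have h4 := he.2
      nlinarith [norm_nonneg (M + toMatrix e)]

/-- The normalized part of `(M + E) ^ g` outside of the leading spectral subspace, as a function of
the entries of `E`. -/
noncomputable def tailMatrix {n : ℕ} (M : Matrix (Fin n) (Fin n) ℝ) (ε L : ℝ) (g : ℕ)
    (e : Fin n × Fin n → ℝ) : Matrix (Fin n) (Fin n) ℝ :=
  ((3 * ε) ^ g)⁻¹ • ((M + toMatrix e) ^ g * (1 - spectralCut ε L (M + toMatrix e)))

theorem continuousOn_tailMatrix {n : ℕ} {M : Matrix (Fin n) (Fin n) ℝ} (hM : M.IsSymm) (ε L : ℝ)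
    (g : ℕ) : ContinuousOn (tailMatrix M ε L g) (noiseBall n ε) := by
  have h1 := continuousOn_spectralCut hM ε L
  have h2 : Continuous fun e : Fin n × Fin n → ℝ => M + toMatrix e :=
    continuous_const.add continuous_toMatrix
  exact ContinuousOn.const_smul (M := ℝ)
    ((h2.pow g).continuousOn.mul (continuousOn_const.sub h1)) (((3 * ε) ^ g)⁻¹)

theorem isClosed_noise_le {n : ℕ} {X : Type*} [TopologicalSpace X] {ε : ℝ}
    {f₁ f₂ : X × (Fin n × Fin n → ℝ) → ℝ} (h₁ : ContinuousOn f₁ (Set.univ ×ˢ noiseBall n ε))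
    (h₂ : ContinuousOn f₂ (Set.univ ×ˢ noiseBall n ε)) :
    IsClosed {p : X × (Fin n × Fin n → ℝ) | p.2 ∈ noiseBall n ε ∧ f₁ p ≤ f₂ p} := by
  have h := IsClosed.isClosed_le (isClosed_univ.prod (isClosed_noiseBall n ε)) h₁ h₂
  convert h using 1
  ext p
  simp

theorem continuousOn_norm_sketch_slice {n m a : ℕ} {ε : ℝ} (b : Fin a)
    {v : (Fin n × Fin n → ℝ) → Fin n → ℝ} (hv : ContinuousOn v (noiseBall n ε)) :
    ContinuousOn (fun p : (Fin a × Fin n × Fin m → ℝ) × (Fin n × Fin n → ℝ) =>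
      ‖sketch (slice b p.1) (v p.2)‖) (Set.univ ×ˢ noiseBall n ε) := by
  have h1 : ContinuousOn (fun p : (Fin a × Fin n × Fin m → ℝ) × (Fin n × Fin n → ℝ) =>
      (slice b p.1, v p.2)) (Set.univ ×ˢ noiseBall n ε) :=
    ((continuous_slice b).comp continuous_fst).continuousOn.prodMk
      (hv.comp continuous_snd.continuousOn fun p hp => hp.2)
  exact (continuous_sketch.comp_continuousOn h1).norm

theorem measurableSet_large_tail {n m a : ℕ} {M : Matrix (Fin n) (Fin n) ℝ} (hM : M.IsSymm)
    (ε L : ℝ) (g : ℕ) (t : ℝ) :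
    MeasurableSet {p : (Fin a × Fin n × Fin m → ℝ) × (Fin n × Fin n → ℝ) |
      p.2 ∈ noiseBall n ε ∧ ∃ b i, t ≤ ‖sketch (slice b p.1) (tailMatrix M ε L g p.2 i)‖ ^ 2} := by
  have e : {p : (Fin a × Fin n × Fin m → ℝ) × (Fin n × Fin n → ℝ) |
      p.2 ∈ noiseBall n ε ∧ ∃ b i, t ≤ ‖sketch (slice b p.1) (tailMatrix M ε L g p.2 i)‖ ^ 2} =
      ⋃ b : Fin a, ⋃ i : Fin n, {p : (Fin a × Fin n × Fin m → ℝ) × (Fin n × Fin n → ℝ) |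
        p.2 ∈ noiseBall n ε ∧ t ≤ ‖sketch (slice b p.1) (tailMatrix M ε L g p.2 i)‖ ^ 2} := by
    ext p; simp
  rw [e]
  refine MeasurableSet.iUnion fun b => MeasurableSet.iUnion fun i => IsClosed.measurableSet ?_
  refine isClosed_noise_le continuousOn_const ((continuousOn_norm_sketch_slice b
    (v := fun e => tailMatrix M ε L g e i) ?_).pow 2)
  exact (continuous_apply i).comp_continuousOn (continuousOn_tailMatrix hM ε L g)

/-- The vector `x` ranges over an uncountable set, so closedness is used: for each `b`, the pairs in
the noise ball for which no `x` is shrunk form an intersection of closed sets. -/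
theorem measurableSet_shrink {n m a : ℕ} {M : Matrix (Fin n) (Fin n) ℝ} (hM : M.IsSymm)
    (ε L c : ℝ) :
    MeasurableSet {p : (Fin a × Fin n × Fin m → ℝ) × (Fin n × Fin n → ℝ) |
      p.2 ∈ noiseBall n ε ∧ ∀ b, ∃ x : Fin n → ℝ,
        ‖sketch (slice b p.1) (spectralCut ε L (M + toMatrix p.2) *ᵥ x)‖ <
        c * ‖(WithLp.toLp 2 (spectralCut ε L (M + toMatrix p.2) *ᵥ x) :
          EuclideanSpace ℝ (Fin n))‖} := by
  set C : Fin a → (Fin n → ℝ) → Set ((Fin a × Fin n × Fin m → ℝ) × (Fin n × Fin n → ℝ)) :=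
    fun b x => {p | p.2 ∈ noiseBall n ε ∧
      c * ‖(WithLp.toLp 2 (spectralCut ε L (M + toMatrix p.2) *ᵥ x) : EuclideanSpace ℝ (Fin n))‖ ≤
        ‖sketch (slice b p.1) (spectralCut ε L (M + toMatrix p.2) *ᵥ x)‖} with hC
  have hv : ∀ x : Fin n → ℝ,
      ContinuousOn (fun e => spectralCut ε L (M + toMatrix e) *ᵥ x) (noiseBall n ε) := fun x =>
    (Continuous.matrix_mulVec continuous_id continuous_const).comp_continuousOn
      (continuousOn_spectralCut hM ε L)
  have hCc : ∀ b x, IsClosed (C b x) := by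
    intro b x
    have h1 : ContinuousOn (fun e => ‖(WithLp.toLp 2 (spectralCut ε L (M + toMatrix e) *ᵥ x) :
        EuclideanSpace ℝ (Fin n))‖) (noiseBall n ε) :=
      ((PiLp.continuous_toLp 2 _).comp_continuousOn (hv x)).norm
    have h2 : ContinuousOn (fun p : (Fin a × Fin n × Fin m → ℝ) × (Fin n × Fin n → ℝ) =>
        c * ‖(WithLp.toLp 2 (spectralCut ε L (M + toMatrix p.2) *ᵥ x) :
          EuclideanSpace ℝ (Fin n))‖) (Set.univ ×ˢ noiseBall n ε) :=
      continuousOn_const.mul (ContinuousOn.comp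
        (f := (Prod.snd : (Fin a × Fin n × Fin m → ℝ) × (Fin n × Fin n → ℝ) → _)) h1
        continuous_snd.continuousOn fun p hp => hp.2)
    exact isClosed_noise_le h2 (continuousOn_norm_sketch_slice b
      (v := fun e => spectralCut ε L (M + toMatrix e) *ᵥ x) (hv x))
  have e : {p : (Fin a × Fin n × Fin m → ℝ) × (Fin n × Fin n → ℝ) |
      p.2 ∈ noiseBall n ε ∧ ∀ b, ∃ x : Fin n → ℝ,
        ‖sketch (slice b p.1) (spectralCut ε L (M + toMatrix p.2) *ᵥ x)‖ <
        c * ‖(WithLp.toLp 2 (spectralCut ε L (M + toMatrix p.2) *ᵥ x) :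
          EuclideanSpace ℝ (Fin n))‖} =
      (Set.univ ×ˢ noiseBall n ε) ∩ ⋂ b, (⋂ x, C b x)ᶜ := by
    ext p
    simp only [Set.mem_ofPred_eq, Set.mem_inter_iff, Set.mem_prod, Set.mem_univ, true_and,
      Set.mem_iInter, Set.mem_compl_iff, not_forall, hC, not_and, not_le]
    refine and_congr_right fun hp => forall_congr' fun b => exists_congr fun x => ?_
    simp [hp]
  rw [e]
  exact (MeasurableSet.univ.prod (isClosed_noiseBall n ε).measurableSet).inter
    (MeasurableSet.iInter fun b => (isClosed_iInter (hCc b)).measurableSet.compl)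

theorem toMatrix_noiseEntries {Ω : Type*} {n : ℕ} (E : Ω → Matrix (Fin n) (Fin n) ℝ) (ω : Ω) :
    toMatrix (noiseEntries E ω) = E ω := rfl

/-- The sketching matrices resolve the leading spectral subspace of `M + E` and do not amplify the
rest of its spectrum. -/
structure IsGoodSketch {n m a : ℕ} (M E : Matrix (Fin n) (Fin n) ℝ)
    (G : Fin a → Matrix (Fin n) (Fin m) ℝ) (ε L : ℝ) (g : ℕ) (c t : ℝ) : Prop where
  tail_le : ∀ b, twoInfNorm ((M + E) ^ g * (1 - spectralCut ε L (M + E)) * G b) ≤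
    (3 * ε) ^ g * √t
  exists_le : ∃ b, ∀ x,
    c * √m * ‖(WithLp.toLp 2 (spectralCut ε L (M + E) *ᵥ x) : EuclideanSpace ℝ (Fin n))‖ ≤
      ‖(WithLp.toLp 2 ((G b)ᵀ *ᵥ (spectralCut ε L (M + E) *ᵥ x)) : EuclideanSpace ℝ (Fin m))‖

/-- Both failure probabilities are bounded for each fixed noise matrix in the ball, uniformly in it;
Fubini then allows `Q` to be random. -/
theorem holdsWithProb_isGoodSketch {Ω : Type*} [MeasurableSpace Ω] {P : Measure Ω}
    [IsProbabilityMeasure P] {n m a k : ℕ} {M : Matrix (Fin n) (Fin n) ℝ}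
    {U : Matrix (Fin n) (Fin k) ℝ} {lam : Fin k → ℝ} {G : Fin a → Ω → Matrix (Fin n) (Fin m) ℝ}
    {E : Ω → Matrix (Fin n) (Fin n) ℝ} (hG : IsGaussianSketch P G E) (hE : IsRandomSymmetric E)
    (hM : IsReducedEigendecomposition M U lam) {ε L : ℝ} (hε : 0 < ε) (hL : ∀ i, L ≤ |lam i|)
    (h8 : 8 * ε ≤ L) (g : ℕ) (c : ℝ) {t : ℝ} (ht : 0 < t) :
    HoldsWithProb P (1 - (a * n * (√2 ^ m * Real.exp (-t / 4)) +
      (gaussianPi (Fin k × Fin m)).real (shrinkSet c k m) ^ a))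
      (fun ω => ‖E ω‖ ≤ ε → IsGoodSketch M (E ω) (fun b => G b ω) ε L g c t) := by
  have hpert : ∀ e ∈ noiseBall n ε, IsSmallPerturbation M U lam (toMatrix e) ε L :=
    fun e he => ⟨hM, he.1, hε, hL, h8, he.2⟩
  set S₁ := {p : (Fin a × Fin n × Fin m → ℝ) × (Fin n × Fin n → ℝ) |
      p.2 ∈ noiseBall n ε ∧ ∃ b i, t ≤ ‖sketch (slice b p.1) (tailMatrix M ε L g p.2 i)‖ ^ 2}
    with hS₁
  set S₂ := {p : (Fin a × Fin n × Fin m → ℝ) × (Fin n × Fin n → ℝ) |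
      p.2 ∈ noiseBall n ε ∧ ∀ b, ∃ x : Fin n → ℝ,
        ‖sketch (slice b p.1) (spectralCut ε L (M + toMatrix p.2) *ᵥ x)‖ <
        c * √m * ‖(WithLp.toLp 2 (spectralCut ε L (M + toMatrix p.2) *ᵥ x) :
          EuclideanSpace ℝ (Fin n))‖} with hS₂
  have hm₁ : MeasurableSet S₁ := measurableSet_large_tail hM.isSymm ε L g t
  have hm₂ : MeasurableSet S₂ := measurableSet_shrink hM.isSymm ε L (c * √m)
  have hpair := (measurable_sketchEntries hG).prodMk (measurable_noiseEntries hE)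
  have hp₁ : P.real {ω | (sketchEntries G ω, noiseEntries E ω) ∈ S₁} ≤
      a * n * (√2 ^ m * Real.exp (-t / 4)) := by
    refine measureReal_sketch_noise_le hG hE hm₁ (by positivity) fun e => ?_
    by_cases he : e ∈ noiseBall n ε
    · refine (measureReal_mono fun h hh => hh.2).trans
        (gaussianPi_exists_slice_le (fun i => tailMatrix M ε L g e i) (fun i => ?_) ht)
      rw [← norm_row_eq]
      refine (rowNorm_le_norm _ i).trans ?_
      rw [tailMatrix, norm_smul, norm_inv, norm_pow, Real.norm_eq_abs,
        abs_of_pos (by positivity), inv_mul_le_iff₀ (by positivity), mul_one]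
      exact (hpert e he).norm_pow_mul_one_sub_cut_le g
    · have : {x | (x, e) ∈ S₁} = ∅ := by
        ext x
        simp only [Set.mem_ofPred_eq, Set.mem_empty_iff_false, iff_false]
        exact fun h => he h.1
      rw [this, measureReal_empty]
      positivity
  have hp₂ : P.real {ω | (sketchEntries G ω, noiseEntries E ω) ∈ S₂} ≤
      (gaussianPi (Fin k × Fin m)).real (shrinkSet c k m) ^ a := by
    refine measureReal_sketch_noise_le hG hE hm₂ (by positivity) fun e => ?_
    by_cases he : e ∈ noiseBall n ε
    -- In the orthonormal basis `W` of the range of `Q`, the event becomes shrinkage by a `k × m`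
    -- Gaussian matrix, whose law does not depend on `e`.
    · obtain ⟨W, hW, hWQ⟩ := (hpert e he).exists_orthonormal_range_cut
      refine (measureReal_mono fun h hh b => ?_).trans (gaussianPi_forall_slice_shrink_le c W hW)
      obtain ⟨x, hx⟩ := hh.2 b
      refine ⟨Wᵀ *ᵥ (spectralCut ε L (M + toMatrix e) *ᵥ x), ?_⟩
      have e1 : W *ᵥ (Wᵀ *ᵥ (spectralCut ε L (M + toMatrix e) *ᵥ x)) =
          spectralCut ε L (M + toMatrix e) *ᵥ x := by
        rw [Matrix.mulVec_mulVec, Matrix.mulVec_mulVec, hWQ]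
      rw [← norm_mulVec_of_transpose_mul_self hW, e1]
      exact hx
    · have : {x | (x, e) ∈ S₂} = ∅ := by
        ext x
        simp only [Set.mem_ofPred_eq, Set.mem_empty_iff_false, iff_false]
        exact fun h => he h.1
      rw [this, measureReal_empty]
      positivity
  have hmm : MeasurableSet ({ω | (sketchEntries G ω, noiseEntries E ω) ∈ S₁} ∪
      {ω | (sketchEntries G ω, noiseEntries E ω) ∈ S₂}) := (hpair hm₁).union (hpair hm₂)
  refine ⟨_, hmm.compl, ?_, ?_⟩
  · rw [probReal_compl_eq_one_sub hmm]
    have := measureReal_union_le (μ := P) {ω | (sketchEntries G ω, noiseEntries E ω) ∈ S₁}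
      {ω | (sketchEntries G ω, noiseEntries E ω) ∈ S₂}
    linarith
  · intro ω hω hEω
    have hball : noiseEntries E ω ∈ noiseBall n ε := ⟨hE.symm ω, hEω⟩
    rw [Set.mem_compl_iff, Set.mem_union, not_or] at hω
    obtain ⟨h1, h2⟩ := hω
    simp only [Set.mem_ofPred_eq, hS₁, hS₂, hball, true_and, not_exists, not_forall, not_le,
      not_lt, toMatrix_noiseEntries] at h1 h2
    refine ⟨fun b => twoInfNorm_le (by positivity) fun i => ?_, h2⟩
    have h3 := h1 b i
    rw [← Real.lt_sqrt (norm_nonneg _)] at h3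
    set N : Matrix (Fin n) (Fin n) ℝ := (M + E ω) ^ g * (1 - spectralCut ε L (M + E ω)) with hN
    have e1 : √(∑ j, (N * G b ω) i j ^ 2) =
        (3 * ε) ^ g * ‖sketch (slice b (sketchEntries G ω))
          (tailMatrix M ε L g (noiseEntries E ω) i)‖ := by
      have e2 : N i = ((3 * ε) ^ g) • tailMatrix M ε L g (noiseEntries E ω) i := by
        ext j
        simp only [tailMatrix, toMatrix_noiseEntries, Pi.smul_apply, Matrix.smul_apply,
          smul_eq_mul]
        rw [mul_inv_cancel_left₀ (by positivity)]
      have e3 : (WithLp.toLp 2 ((N * G b ω) i) : EuclideanSpace ℝ (Fin m)) =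
          sketch (slice b (sketchEntries G ω)) (N i) := by
        ext j
        rw [sketch_apply]
        simp only [Matrix.mul_apply]
        exact Finset.sum_congr rfl fun l _ => mul_comm _ _
      rw [norm_row_eq, e3, e2, sketch_smul, norm_smul, Real.norm_eq_abs,
        abs_of_pos (by positivity)]
    rw [e1]
    exact mul_le_mul_of_nonneg_left h3.le (by positivity)

end Deterministic

/-! ### Events of high probability -/

theorem HoldsWithProb.mono {Ω : Type*} [MeasurableSpace Ω] {P : Measure Ω} {p q : ℝ}
    {S T : Ω → Prop} (h : HoldsWithProb P p S) (hq : q ≤ p) (hST : ∀ ω, S ω → T ω) :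
    HoldsWithProb P q T := by
  obtain ⟨A, hA, hp, hS⟩ := h
  exact ⟨A, hA, hq.trans hp, fun ω hω => hST ω (hS ω hω)⟩

theorem HoldsWithProb.and {Ω : Type*} [MeasurableSpace Ω] {P : Measure Ω} [IsProbabilityMeasure P]
    {p q : ℝ} {S T : Ω → Prop} (hS : HoldsWithProb P (1 - p) S) (hT : HoldsWithProb P (1 - q) T) :
    HoldsWithProb P (1 - (p + q)) (fun ω => S ω ∧ T ω) := by
  obtain ⟨A, hA, hp, hS⟩ := hS
  obtain ⟨B, hB, hq, hT⟩ := hT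
  refine ⟨A ∩ B, hA.inter hB, ?_, fun ω hω => ⟨hS ω hω.1, hT ω hω.2⟩⟩
  have h1 := measureReal_union_add_inter (μ := P) (s := A) hB
  have h2 : P.real (A ∪ B) ≤ 1 := measureReal_le_one
  linarith

theorem HoldsWithProb.forall {Ω ι : Type*} [MeasurableSpace Ω] {P : Measure Ω}
    [IsProbabilityMeasure P] [Fintype ι] {q : ℝ} {S : ι → Ω → Prop}
    (h : ∀ i, HoldsWithProb P (1 - q) (S i)) :
    HoldsWithProb P (1 - Fintype.card ι * q) (fun ω => ∀ i, S i ω) := by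
  choose A hA hp hS using h
  have hAc : MeasurableSet (⋃ i, (A i)ᶜ) := MeasurableSet.iUnion fun i => (hA i).compl
  refine ⟨(⋃ i, (A i)ᶜ)ᶜ, hAc.compl, ?_, fun ω hω i => hS i ω ?_⟩
  · rw [probReal_compl_eq_one_sub hAc]
    have h1 : P.real (⋃ i, (A i)ᶜ) ≤ ∑ i, P.real (A i)ᶜ := measureReal_iUnion_fintype_le _
    have h2 : ∑ i, P.real (A i)ᶜ ≤ ∑ _ : ι, q := by
      refine Finset.sum_le_sum fun i _ => ?_
      rw [probReal_compl_eq_one_sub (hA i)]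
      have := hp i
      linarith
    simp only [Finset.sum_const, Finset.card_univ, nsmul_eq_mul] at h2
    linarith
  · simpa using fun hi => hω (Set.mem_iUnion.2 ⟨i, hi⟩)

/-! ### The number of sketches -/

/-- An upper bound, less than `1`, for the probability that a Gaussian `k × m` matrix is badly
conditioned. -/
noncomputable def failureProb (k m : ℕ) : ℝ :=
  max ((gaussianPi (Fin k × Fin m)).real (shrinkSet (1 / (2 * √m)) k m)) (1 / 2)

open Classical in
/-- The constant in the number of sketches when both dimensions are fixed. -/
noncomputable def sketchConst (k m : ℕ) : ℝ :=
  if k ≤ m ∧ 0 < m then 6 * m / (-Real.log (failureProb k m)) else 1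

/-- The floor `1/2` in the definition serves this: the logarithm in `sketchConst` needs a positive
argument. -/
theorem failureProb_pos (k m : ℕ) : 0 < failureProb k m :=
  lt_of_lt_of_le (by norm_num) (le_max_right _ _)

theorem log_failureProb_neg {k m : ℕ} (hkm : k ≤ m) (hm : 0 < m) :
    Real.log (failureProb k m) < 0 :=
  Real.log_neg (failureProb_pos k m)
    (max_lt (gaussianPi_shrinkSet_lt_one hkm hm) (by norm_num))

/-- The value `1` for inadmissible dimensions only secures positivity everywhere. -/
theorem sketchConst_pos (k m : ℕ) : 0 < sketchConst k m := by
  unfold sketchConst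
  split_ifs with h
  · have h1 := log_failureProb_neg h.1 h.2
    have h2 : (0 : ℝ) < m := by exact_mod_cast h.2
    exact div_pos (by positivity) (by linarith)
  · exact one_pos

theorem exp_neg_mul_log {x : ℝ} (hx : 0 < x) (j : ℕ) :
    Real.exp (-(j * Real.log x)) = 1 / x ^ j := by
  rw [Real.exp_neg, Real.exp_nat_mul, Real.exp_log hx, one_div]

theorem exp_pow_le_of_le {x C : ℝ} {m a : ℕ} {q : ℝ} (hx : 1 ≤ x) (hC : 6 ≤ C) (hm : 0 < m)
    (hq0 : 0 ≤ q) (hq : q ≤ Real.exp (-m)) (ha : C * Real.log x / m ≤ a) :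
    q ^ a ≤ 1 / x ^ 6 := by
  have hm' : (0 : ℝ) < m := by exact_mod_cast hm
  rw [div_le_iff₀ hm'] at ha
  have hl := Real.log_nonneg hx
  have h6 := exp_neg_mul_log (zero_lt_one.trans_le hx) 6
  rw [← h6]
  calc q ^ a ≤ Real.exp (-m) ^ a := pow_le_pow_left₀ hq0 hq a
    _ = Real.exp (-(a * m)) := by rw [← Real.exp_nat_mul]; congr 1; ring
    _ ≤ _ := by
      rw [Real.exp_le_exp]
      push_cast
      nlinarith

/-- With fixed dimensions the failure probability is a constant below `1`, and `sketchConst` is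
calibrated to its logarithm. In the other regimes it is at most `e^(-m)`, so `a ≥ 6 log n / m` would
suffice. -/
theorem exists_shrinkSet_pow_le {k m a : ℕ → ℕ} {C : ℝ}
    (hkm : ∀ᶠ n in atTop, 1 ≤ k n ∧ k n ≤ m n)
    (hreg : DimensionRegime sketchConst (fun _ => 15) k m C)
    (ha : ∀ᶠ n : ℕ in atTop, ⌈C * Real.log (n : ℝ) / (m n : ℝ)⌉₊ ≤ a n) :
    ∃ c : ℝ, 0 < c ∧ ∀ᶠ n : ℕ in atTop,
      (gaussianPi (Fin (k n) × Fin (m n))).real (shrinkSet c (k n) (m n)) ^ a n ≤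
        1 / (n : ℝ) ^ 6 := by
  have ha' : ∀ᶠ n : ℕ in atTop, C * Real.log (n : ℝ) / (m n : ℝ) ≤ a n := by
    filter_upwards [ha] with n hn
    exact (Nat.le_ceil _).trans (by exact_mod_cast hn)
  rcases hreg with ⟨k₀, m₀, hev, rfl⟩ | ⟨k₀, hev, hm, rfl⟩ | ⟨cgap, hc, hk, hgap, rfl⟩
  · have hkm₀ : 1 ≤ k₀ ∧ k₀ ≤ m₀ := by
      obtain ⟨n, h1, h2⟩ := (hkm.and hev).exists
      rwa [h2.1, h2.2] at h1
    have hm₀ : 0 < m₀ := by omega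
    have hm' : (0 : ℝ) < m₀ := by exact_mod_cast hm₀
    refine ⟨1 / (2 * √m₀), by positivity, ?_⟩
    filter_upwards [ha', hev, eventually_ge_atTop 1] with n h1 h2 hn
    have hn' : (1 : ℝ) ≤ n := by exact_mod_cast hn
    rw [h2.1, h2.2]
    rw [h2.2] at h1
    have hneg := log_failureProb_neg hkm₀.2 hm₀
    rw [sketchConst, if_pos ⟨hkm₀.2, hm₀⟩] at h1
    have h3 : 6 * Real.log n ≤ a n * (-Real.log (failureProb k₀ m₀)) := by
      have h4 : 6 * m₀ / (-Real.log (failureProb k₀ m₀)) * Real.log n / m₀ =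
          6 * Real.log n / (-Real.log (failureProb k₀ m₀)) := by
        field_simp
      rw [h4, div_le_iff₀ (by linarith)] at h1
      exact h1
    have h6 := exp_neg_mul_log (zero_lt_one.trans_le hn') 6
    calc _ ≤ failureProb k₀ m₀ ^ a n := pow_le_pow_left₀ measureReal_nonneg (le_max_left _ _) _
      _ = Real.exp (a n * Real.log (failureProb k₀ m₀)) := by
          rw [Real.exp_nat_mul, Real.exp_log (failureProb_pos _ _)]
      _ ≤ Real.exp (-((6 : ℕ) * Real.log n)) := by
          rw [Real.exp_le_exp]; push_cast; linarith
      _ = _ := h6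
  -- With `k` fixed and `m → ∞`, eventually `m ≥ 2k`; any ratio above `1` would do.
  · obtain ⟨c, hc0, hc⟩ := exists_gaussianPi_shrinkSet_le (ρ := 2) (by norm_num)
    refine ⟨c, hc0, ?_⟩
    filter_upwards [ha', hev, hm.eventually_ge_atTop (2 * k₀), hkm, eventually_ge_atTop 1] with
      n h1 h2 h3 h4 hn
    have hn' : (1 : ℝ) ≤ n := by exact_mod_cast hn
    have hm0 : 0 < m n := by omega
    refine exp_pow_le_of_le hn' (by norm_num) hm0 measureReal_nonneg (hc _ _ hm0 ?_) h1
    rw [h2]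
    exact_mod_cast h3
  · obtain ⟨c, hc0, hc'⟩ := exists_gaussianPi_shrinkSet_le hc
    refine ⟨c, hc0, ?_⟩
    filter_upwards [ha', hgap, hkm, eventually_ge_atTop 1] with n h1 h3 h4 hn
    have hn' : (1 : ℝ) ≤ n := by exact_mod_cast hn
    have hm0 : 0 < m n := by omega
    exact exp_pow_le_of_le hn' (by norm_num) hm0 measureReal_nonneg (hc' _ _ hm0 h3) h1

/-! ### The signal -/

section Deterministic

open scoped Matrix.Norms.L2Operator

theorem IsReducedEigendecomposition.norm_eq {n k : ℕ} {M : Matrix (Fin n) (Fin n) ℝ}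
    {U : Matrix (Fin n) (Fin k) ℝ} {lam : Fin k → ℝ} (h : IsReducedEigendecomposition M U lam)
    (hk : 0 < k) : ‖M‖ = ⨆ i, |lam i| := by
  have : Nonempty (Fin k) := ⟨⟨0, hk⟩⟩
  have hU := norm_le_one_of_transpose_mul_self h.orthonormal
  have hUt : ‖Uᵀ‖ ≤ 1 := (norm_transpose_eq U).trans_le hU
  have hlam : ‖lam‖ = ⨆ i, |lam i| := by
    refine le_antisymm ?_ (ciSup_le fun i => norm_le_pi_norm lam i)
    exact (pi_norm_le_iff_of_nonempty _).2 fun i =>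
      le_ciSup (f := fun i => |lam i|) (Set.finite_range _).bddAbove i
  rw [← hlam, ← Matrix.l2_opNorm_diagonal (𝕜 := ℝ) lam]
  refine le_antisymm ?_ ?_
  · rw [h.eq]
    refine (Matrix.l2_opNorm_mul _ _).trans ?_
    have h1 := Matrix.l2_opNorm_mul U (Matrix.diagonal lam)
    have h2 : ‖U‖ * ‖Matrix.diagonal lam‖ ≤ ‖Matrix.diagonal lam‖ :=
      mul_le_of_le_one_left (norm_nonneg _) hU
    exact (mul_le_of_le_one_right (norm_nonneg _) hUt).trans (h1.trans h2)
  · have e : Matrix.diagonal lam = Uᵀ * M * U := by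
      rw [h.transpose_mul, Matrix.mul_assoc, h.orthonormal, Matrix.mul_one]
    rw [e]
    refine (Matrix.l2_opNorm_mul _ _).trans ((mul_le_of_le_one_right (norm_nonneg _) hU).trans ?_)
    exact (Matrix.l2_opNorm_mul _ _).trans (mul_le_of_le_one_left (norm_nonneg _) hUt)

/-- This lower bound on the coherence of `U` turns spectral-norm estimates into estimates
proportional to `‖U‖_{2→∞}`. -/
theorem sqrt_inv_le_twoInfNorm {n k : ℕ} {U : Matrix (Fin n) (Fin k) ℝ} (hU : Uᵀ * U = 1)
    (hk : 0 < k) : 1 ≤ √n * twoInfNorm U := by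
  refine le_trans ?_ (norm_le_sqrt_mul_twoInfNorm U)
  have h := norm_mulVec_le U (Pi.single ⟨0, hk⟩ 1)
  rw [norm_mulVec_of_transpose_mul_self hU] at h
  have h1 : ‖(WithLp.toLp 2 (Pi.single ⟨0, hk⟩ 1 : Fin k → ℝ) : EuclideanSpace ℝ (Fin k))‖ = 1 := by
    rw [EuclideanSpace.norm_eq]
    simp [Pi.single_apply, ite_pow]
  rwa [h1, mul_one] at h

theorem abs_le_twoInfNorm {n k : ℕ} (U : Matrix (Fin n) (Fin k) ℝ) (i : Fin n) (j : Fin k) :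
    |U i j| ≤ twoInfNorm U := by
  refine le_trans ?_ (rowNorm_le_twoInfNorm U i)
  exact Real.abs_le_sqrt (Finset.single_le_sum (f := fun j => U i j ^ 2)
    (fun _ _ => sq_nonneg _) (Finset.mem_univ j))

theorem twoInfNorm_le_sqrt_mul {n k : ℕ} {A : Matrix (Fin n) (Fin k) ℝ} {b : ℝ} (hb : 0 ≤ b)
    (h : ∀ i j, |A i j| ≤ b) : twoInfNorm A ≤ √k * b := by
  refine twoInfNorm_le (by positivity) fun i => ?_
  rw [Real.sqrt_le_left (by positivity), mul_pow, Real.sq_sqrt (Nat.cast_nonneg k)]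
  calc ∑ j, A i j ^ 2 ≤ ∑ _ : Fin k, b ^ 2 :=
        Finset.sum_le_sum fun j _ => sq_le_sq' (abs_le.1 (h i j)).1 (abs_le.1 (h i j)).2
    _ = k * b ^ 2 := by simp

end Deterministic

/-! ### Collecting the error terms -/

theorem add_log_le {n m : ℕ} (hm : 0 < m) (hn : 1 ≤ n) :
    (m : ℝ) + Real.log n ≤ 2 * (m * theta n m ^ 2) := by
  have hm' : (0 : ℝ) < m := by exact_mod_cast hm
  have hl : 0 ≤ Real.log n := Real.log_nonneg (by exact_mod_cast hn)
  have h1 : (1 : ℝ) ≤ theta n m := le_max_left _ _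
  have h2 : √(Real.log n) / √(m : ℝ) ≤ theta n m := le_max_right _ _
  have h3 : Real.log n / m ≤ theta n m ^ 2 := by
    have := pow_le_pow_left₀ (by positivity) h2 2
    rwa [div_pow, Real.sq_sqrt hl, Real.sq_sqrt hm'.le] at this
  rw [div_le_iff₀ hm'] at h3
  have h4 : (m : ℝ) ≤ m * theta n m ^ 2 := le_mul_of_one_le_right hm'.le (one_le_pow₀ h1)
  linarith

/-- In the application `x = ε/S`, `μ = ‖U‖_{2→∞}`, `sn = √n`, `sk = √k`, `l = (log n)^δ` and `ld =
(log n)^δ*`. Terms with `x^g` keep one factor `x`; the rest is absorbed through `sn x^(g-1) ≤ Cx` or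
`x^(g-1) ≤ Cx μ`. -/
theorem error_terms_le {g : ℕ} (hg : 1 ≤ g) {μ sn sk x ψ ϑ l ld B Cr Cx : ℝ} (hx : 0 < x)
    (hψ : 1 ≤ ψ) (hϑ : 1 ≤ ϑ) (hl : 1 ≤ l) (hld : l ≤ ld) (hsk : 1 ≤ sk) (hμ : 1 ≤ sn * μ)
    (hsn : 0 < sn) (hB : 0 ≤ B) (hCr : 0 ≤ Cr) (hCx : sn * x ^ (g - 1) ≤ Cx) (hlx : l * x ≤ 1) :
    μ * (2 * (sn * (B * ((6 * (ψ * x)) ^ g * ϑ))) + 6 * (ψ * x)) +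
      ∑ r ∈ Finset.Ico 1 g, sk * (Cr * l ^ r * μ) * (2 * (2 * (ψ * x)) ^ r) +
      (2 * (ψ * x)) ^ g + B * ((6 * (ψ * x)) ^ g * ϑ) ≤
    (3 * (B * 6 ^ g * Cx) + 6 + g * (Cr * 2 ^ (g + 1)) + 2 ^ g * Cx) *
      (ld * ϑ * ψ ^ g * sk * x * μ) := by
  have hμ0 : 0 < μ := by
    by_contra! h
    nlinarith
  have hψ0 : 0 < ψ := by linarith
  have hl0 : 0 < l := by linarith
  have hld0 : 0 < ld := by linarith
  have hϑ0 : 0 < ϑ := by linarith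
  have hsk0 : 0 < sk := by linarith
  have hxg : x ^ g = x * x ^ (g - 1) := by
    rw [← pow_succ']; congr 1; omega
  have hx1 : 0 < x ^ (g - 1) := by positivity
  have hCx0 : 0 < Cx := lt_of_lt_of_le (by positivity) hCx
  have hxμ : x ^ (g - 1) ≤ Cx * μ := by
    have : x ^ (g - 1) * 1 ≤ x ^ (g - 1) * (sn * μ) := mul_le_mul_of_nonneg_left hμ hx1.le
    nlinarith
  set T := ld * ϑ * ψ ^ g * sk * x * μ with hT
  have hT0 : 0 ≤ T := by positivity
  have hψg : 1 ≤ ψ ^ g := one_le_pow₀ hψ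
  -- the products of the factors that are at least one
  have hbase : ψ ^ g * x * μ * ϑ ≤ T := by
    have h1 : 1 ≤ ld * sk := by nlinarith
    calc ψ ^ g * x * μ * ϑ = (ψ ^ g * x * μ * ϑ) * 1 := by ring
      _ ≤ (ψ ^ g * x * μ * ϑ) * (ld * sk) := mul_le_mul_of_nonneg_left h1 (by positivity)
      _ = T := by rw [hT]; ring
  have hbase' : ψ ^ g * x * μ ≤ T := by
    refine le_trans ?_ hbase
    exact le_mul_of_one_le_right (by positivity) hϑ
  have t1 : μ * (2 * (sn * (B * ((6 * (ψ * x)) ^ g * ϑ)))) ≤ 2 * (B * 6 ^ g * Cx) * T := by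
    have e : μ * (2 * (sn * (B * ((6 * (ψ * x)) ^ g * ϑ)))) =
        2 * (B * 6 ^ g) * (ψ ^ g * x * μ * ϑ) * (sn * x ^ (g - 1)) := by
      rw [mul_pow, mul_pow, hxg]; ring
    rw [e]
    calc _ ≤ 2 * (B * 6 ^ g) * T * Cx :=
          mul_le_mul (mul_le_mul_of_nonneg_left hbase (by positivity)) hCx (by positivity)
            (by positivity)
      _ = _ := by ring
  have t2 : μ * (6 * (ψ * x)) ≤ 6 * T := by
    have h1 : ψ ≤ ψ ^ g := le_self_pow₀ hψ (by omega)
    have h2 : ψ * x * μ ≤ ψ ^ g * x * μ := by gcongr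
    linarith
  have t3 : ∑ r ∈ Finset.Ico 1 g, sk * (Cr * l ^ r * μ) * (2 * (2 * (ψ * x)) ^ r) ≤
      g * (Cr * 2 ^ (g + 1)) * T := by
    have h1 : ∀ r ∈ Finset.Ico 1 g, sk * (Cr * l ^ r * μ) * (2 * (2 * (ψ * x)) ^ r) ≤
        Cr * 2 ^ (g + 1) * T := by
      intro r hr
      rw [Finset.mem_Ico] at hr
      -- Since `r ≥ 1`, one factor `l x` can be kept and the other `r - 1` bounded by `1`: only one
      -- power of `(log n)^δ` survives.
      have e : sk * (Cr * l ^ r * μ) * (2 * (2 * (ψ * x)) ^ r) =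
          Cr * 2 ^ (r + 1) * (l * (ψ ^ r * x * μ * sk)) * (l * x) ^ (r - 1) := by
        obtain ⟨s, rfl⟩ : ∃ s, r = s + 1 := ⟨r - 1, by omega⟩
        simp only [Nat.add_sub_cancel, mul_pow]
        ring
      rw [e]
      have h2 : (2 : ℝ) ^ (r + 1) ≤ 2 ^ (g + 1) := pow_le_pow_right₀ (by norm_num) (by omega)
      have h3 : ψ ^ r ≤ ψ ^ g := pow_le_pow_right₀ hψ (by omega)
      have h4 : (l * x) ^ (r - 1) ≤ 1 := pow_le_one₀ (by positivity) hlx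
      have h5 : l * (ψ ^ r * x * μ * sk) ≤ T := by
        calc l * (ψ ^ r * x * μ * sk) ≤ ld * (ψ ^ g * x * μ * sk) := by gcongr
          _ ≤ ld * (ψ ^ g * x * μ * sk) * ϑ := le_mul_of_one_le_right (by positivity) hϑ
          _ = T := by rw [hT]; ring
      calc _ ≤ Cr * 2 ^ (g + 1) * T * 1 := by gcongr
        _ = _ := mul_one _
    refine (Finset.sum_le_sum h1).trans ?_
    simp only [Finset.sum_const, Nat.card_Ico, nsmul_eq_mul]
    have h6 : ((g - 1 : ℕ) : ℝ) ≤ g := by exact_mod_cast Nat.sub_le g 1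
    have h7 : 0 ≤ Cr * 2 ^ (g + 1) * T := by positivity
    nlinarith
  have t4 : (2 * (ψ * x)) ^ g ≤ 2 ^ g * Cx * T := by
    have e : (2 * (ψ * x)) ^ g = 2 ^ g * (ψ ^ g * x) * x ^ (g - 1) := by
      rw [mul_pow, mul_pow, hxg]; ring
    rw [e]
    calc _ ≤ 2 ^ g * (ψ ^ g * x) * (Cx * μ) := by gcongr
      _ = 2 ^ g * Cx * (ψ ^ g * x * μ) := by ring
      _ ≤ _ := by gcongr
  have t5 : B * ((6 * (ψ * x)) ^ g * ϑ) ≤ B * 6 ^ g * Cx * T := by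
    have e : B * ((6 * (ψ * x)) ^ g * ϑ) = B * 6 ^ g * (ψ ^ g * x * ϑ) * x ^ (g - 1) := by
      rw [mul_pow, mul_pow, hxg]; ring
    rw [e]
    calc _ ≤ B * 6 ^ g * (ψ ^ g * x * ϑ) * (Cx * μ) := by gcongr
      _ = B * 6 ^ g * Cx * (ψ ^ g * x * μ * ϑ) := by ring
      _ ≤ _ := by gcongr
  rw [mul_add]
  linarith

theorem le_deltaStar {β δ : ℝ} (hδ : 0 ≤ δ) {g : ℕ} (hg : 1 ≤ g) (μ : ℕ → ℝ) :
    δ ≤ deltaStar β δ g μ := by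
  unfold deltaStar
  split_ifs
  · exact le_rfl
  · have : (1 : ℝ) ≤ g := by exact_mod_cast hg
    nlinarith

/-! ### Asymptotics -/

/-- Here `y = S/ε` is at least of order `n^β`. The condition on `g` says `β (g - 1) ≥ 1/2`, which
beats `√n`, and a power of `log n` is negligible against `n^β`. -/
theorem exists_eventually_snr_le {β δ : ℝ} (hβ : 0 < β) {g : ℕ} (hg : 1 + (2 * β)⁻¹ ≤ (g : ℝ))
    {y : ℕ → ℝ} (hy0 : ∀ᶠ n in atTop, 0 ≤ y n) (hy : AsympLE (fun n => (n : ℝ) ^ β) y) :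
    ∃ Cx : ℝ, ∀ᶠ n : ℕ in atTop, 0 < y n ∧ √(n : ℝ) * (y n)⁻¹ ^ (g - 1) ≤ Cx ∧
      Real.log n ^ δ * (y n)⁻¹ ≤ 1 := by
  obtain ⟨c, hc⟩ := hy
  -- The constant hidden in `AsympLE` has no sign, and it is about to be divided by.
  set c' := max c 1 with hc'
  have hc0 : 0 < c' := lt_of_lt_of_le one_pos (le_max_right _ _)
  have hg1 : 1 ≤ g := by
    have h1 : (0 : ℝ) < (2 * β)⁻¹ := by positivity
    have h2 : (1 : ℝ) < g := by linarith
    exact_mod_cast h2.le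
  have hlog := ((isLittleO_log_rpow_rpow_atTop δ hβ).comp_tendsto
    tendsto_natCast_atTop_atTop).bound (show (0 : ℝ) < 1 / c' by positivity)
  refine ⟨c' ^ (g - 1), ?_⟩
  filter_upwards [hy0, hc, hlog, eventually_ge_atTop 1] with n h0 h1 h2 hn
  have hn1 : (1 : ℝ) ≤ n := by exact_mod_cast hn
  have hn0 : (0 : ℝ) < n := by linarith
  have hnβ : 0 < (n : ℝ) ^ β := Real.rpow_pos_of_pos hn0 _
  have h3 : (n : ℝ) ^ β ≤ c' * y n := h1.trans (mul_le_mul_of_nonneg_right (le_max_left _ _) h0)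
  have hypos : 0 < y n := by
    rcases h0.eq_or_lt with h | h
    · rw [← h, mul_zero] at h3; linarith
    · exact h
  have hinv : (y n)⁻¹ ≤ c' * ((n : ℝ) ^ β)⁻¹ := by
    rw [← div_eq_mul_inv, inv_le_comm₀ hypos (by positivity), inv_div, div_le_iff₀ hc0]
    linarith
  refine ⟨hypos, ?_, ?_⟩
  · have h4 : √(n : ℝ) ≤ ((n : ℝ) ^ β) ^ (g - 1) := by
      rw [Real.sqrt_eq_rpow, ← Real.rpow_natCast, ← Real.rpow_mul hn0.le]
      refine Real.rpow_le_rpow_of_exponent_le hn1 ?_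
      rw [Nat.cast_sub hg1, Nat.cast_one]
      have h5 : β * (2 * β)⁻¹ ≤ β * (g - 1) := mul_le_mul_of_nonneg_left (by linarith) hβ.le
      have h6 : β * (2 * β)⁻¹ = 1 / 2 := by field_simp
      linarith
    calc √(n : ℝ) * (y n)⁻¹ ^ (g - 1) ≤
          ((n : ℝ) ^ β) ^ (g - 1) * (c' * ((n : ℝ) ^ β)⁻¹) ^ (g - 1) := by gcongr
      _ = c' ^ (g - 1) := by
          rw [← mul_pow]; congr 1; field_simp
  · have h4 : Real.log n ^ δ ≤ 1 / c' * (n : ℝ) ^ β := by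
      simp only [Function.comp_apply, Real.norm_eq_abs, abs_of_pos hnβ] at h2
      exact (le_abs_self _).trans h2
    calc Real.log n ^ δ * (y n)⁻¹ ≤ (1 / c' * (n : ℝ) ^ β) * (c' * ((n : ℝ) ^ β)⁻¹) := by
          refine mul_le_mul h4 hinv (by positivity) (by positivity)
      _ = 1 := by field_simp

/-- The multiple `4 (p + 8)` gives `e^(-(p+8) m) n^(-(p+8))`. This absorbs `√2^m ≤ e^m` and the `a n
≤ n^(p+1)` rows, leaving `n^(-7)`. -/
theorem chi_square_budget {a n m p : ℕ} (hn : 1 ≤ n) (ha : a ≤ n ^ p) :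
    a * n * (√2 ^ m * Real.exp (-(4 * (p + 8) * (m + Real.log n)) / 4)) ≤ 1 / (n : ℝ) ^ 7 := by
  have hn0 : (0 : ℝ) < n := by exact_mod_cast hn
  have h1 : √(2 : ℝ) ≤ Real.exp 1 := by
    have := Real.add_one_le_exp 1
    have h2 : √(2 : ℝ) ≤ 2 := by
      rw [Real.sqrt_le_left (by norm_num)]; norm_num
    linarith
  have h2 : √(2 : ℝ) ^ m ≤ Real.exp m := by
    calc √(2 : ℝ) ^ m ≤ Real.exp 1 ^ m := by gcongr
      _ = Real.exp m := by rw [← Real.exp_nat_mul, mul_one]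
  have h3 : Real.exp (-(4 * (p + 8) * (m + Real.log n)) / 4) ≤
      Real.exp (-m) * (1 / (n : ℝ) ^ (p + 8)) := by
    rw [← exp_neg_mul_log hn0 (p + 8), ← Real.exp_add, Real.exp_le_exp]
    push_cast
    have : (0 : ℝ) ≤ (p + 7) * m := by positivity
    linarith
  have ha' : (a : ℝ) ≤ (n : ℝ) ^ p := by exact_mod_cast ha
  calc _ ≤ (n : ℝ) ^ p * n * (Real.exp m * (Real.exp (-m) * (1 / (n : ℝ) ^ (p + 8)))) := by gcongr
    _ = (n : ℝ) ^ p * n * (1 / (n : ℝ) ^ (p + 8)) := by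
        rw [← mul_assoc (Real.exp m), ← Real.exp_add]; simp
    _ = _ := by
        rw [pow_add]; field_simp

/-! ### Rows of powers of the noise -/

theorem le_of_transpose_mul_self {n k : ℕ} {U : Matrix (Fin n) (Fin k) ℝ} (hU : Uᵀ * U = 1) :
    k ≤ n := by
  have h1 : (Uᵀ * U).rank = k := by rw [hU, Matrix.rank_one, Fintype.card_fin]
  have h2 := (Matrix.rank_mul_le_right Uᵀ U).trans (Matrix.rank_le_height U)
  omega

/-- Row-wise concentration is applied to each column of `U` and each `r < g`, at most `g n` events
in all. Passing from entries to rows costs `√k`, the source of `k^(1/2)` in the final bound. -/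
theorem holdsWithProb_twoInfNorm_pow_mul_le {Ω : Type*} [MeasurableSpace Ω] {P : Measure Ω}
    [IsProbabilityMeasure P] {n k g : ℕ} {E : Ω → Matrix (Fin n) (Fin n) ℝ}
    {U : Matrix (Fin n) (Fin k) ℝ} (hU : Uᵀ * U = 1) (hn : 1 ≤ n) {C ε δ : ℝ} (hε : 0 < ε)
    (hg : (g : ℝ) ≤ Real.log n)
    (h : ∀ r : ℕ, 1 ≤ r → (r : ℝ) ≤ Real.log n → ∀ u : Fin n → ℝ,
      HoldsWithProb P (1 - 1 / (n : ℝ) ^ 8) (fun ω => ∀ i : Fin n, |((E ω) ^ r *ᵥ u) i| ≤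
        C * ε ^ r * Real.log n ^ (δ * (r : ℝ)) * ‖u‖)) :
    HoldsWithProb P (1 - g / (n : ℝ) ^ 7) (fun ω => ∀ r ∈ Finset.Ico 1 g,
      twoInfNorm ((E ω) ^ r * U) ≤
        √k * (|C| * ε ^ r * (Real.log n ^ δ) ^ r * twoInfNorm U)) := by
  have hn0 : (0 : ℝ) < n := by exact_mod_cast hn
  have hlog : 0 ≤ Real.log n := Real.log_nonneg (by exact_mod_cast hn)
  have key := HoldsWithProb.forall (P := P) (q := 1 / (n : ℝ) ^ 8)
    (ι := Finset.Ico 1 g × Fin k)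
    (S := fun q ω => ∀ i : Fin n, |((E ω) ^ (q.1 : ℕ) *ᵥ fun i => U i q.2) i| ≤
        C * ε ^ (q.1 : ℕ) * Real.log n ^ (δ * ((q.1 : ℕ) : ℝ)) * ‖fun i => U i q.2‖)
    (fun q => by
      have hq := Finset.mem_Ico.1 q.1.2
      refine h q.1 hq.1 (le_trans ?_ hg) _
      exact_mod_cast hq.2.le)
  refine key.mono ?_ fun ω hω r hr => ?_
  · have hk : (k : ℝ) ≤ n := by exact_mod_cast le_of_transpose_mul_self hU
    have hg' : ((g - 1 : ℕ) : ℝ) ≤ g := by exact_mod_cast Nat.sub_le g 1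
    have : ((g - 1 : ℕ) : ℝ) * k * (1 / (n : ℝ) ^ 8) ≤ g / (n : ℝ) ^ 7 := by
      calc ((g - 1 : ℕ) : ℝ) * k * (1 / (n : ℝ) ^ 8) ≤ g * n * (1 / (n : ℝ) ^ 8) := by gcongr
        _ = _ := by field_simp
    simp only [Fintype.card_prod, Fintype.card_coe, Nat.card_Ico, Fintype.card_fin, Nat.cast_mul]
    linarith
  · have hμ := twoInfNorm_nonneg U
    refine twoInfNorm_le_sqrt_mul (by positivity) fun i j => ?_
    have h1 := hω ⟨⟨r, hr⟩, j⟩ i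
    have h2 : ‖fun i => U i j‖ ≤ twoInfNorm U :=
      (pi_norm_le_iff_of_nonneg hμ).2 fun i => abs_le_twoInfNorm U i j
    have h3 : ((E ω) ^ r * U) i j = ((E ω) ^ r *ᵥ fun i => U i j) i := by
      simp [Matrix.mul_apply, Matrix.mulVec, dotProduct]
    rw [h3]
    refine h1.trans ?_
    have h4 : Real.log n ^ (δ * (r : ℝ)) = (Real.log n ^ δ) ^ r := by
      rw [Real.rpow_mul hlog, Real.rpow_natCast]
    rw [h4]
    have h5 := le_abs_self C
    gcongr

/-! ### Deterministic bound for the selected sketch -/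

section Deterministic

open scoped Matrix.Norms.L2Operator

/-- The selected sketch `s` need not be the one `b` that resolves the range of `Q`. By maximality
its `k`-th singular value is at least as large, and the tail bound holds for every sketch, so both
estimates apply to `s`. -/
theorem IsSmallPerturbation.twoInfDist_rsvd_le {n k m a : ℕ} {M : Matrix (Fin n) (Fin n) ℝ}
    {U : Matrix (Fin n) (Fin k) ℝ} {lam : Fin k → ℝ} {E : Matrix (Fin n) (Fin n) ℝ} {ε L : ℝ}
    (h : IsSmallPerturbation M U lam E ε L) (hk : 0 < k) (hm : 0 < m) {g : ℕ} (hg : 1 ≤ g)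
    {G : Fin a → Matrix (Fin n) (Fin m) ℝ} {c t : ℝ} (hc : 0 < c)
    (hG : IsGoodSketch M E G ε L g c t) {Uhat : Matrix (Fin n) (Fin k) ℝ}
    (hU : IsRSVDOutput (M + E) g G Uhat) {κ : ℕ → ℝ}
    (hκ : ∀ r ∈ Finset.Ico 1 g, twoInfNorm (E ^ r * U) ≤ κ r) {τ : ℝ} (hτ : √t ≤ τ * √m) :
    twoInfDist Uhat U ≤
      twoInfNorm U * (2 * (√n * (τ / c * (6 * (ε / L)) ^ g)) + 6 * (ε / L)) +
      ∑ r ∈ Finset.Ico 1 g, κ r * (2 * (2 / L) ^ r) + (2 * (ε / L)) ^ g +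
        τ / c * (6 * (ε / L)) ^ g := by
  have hL := h.L_pos
  have hε := h.pos
  have hm' : 0 < √(m : ℝ) := Real.sqrt_pos.2 (by exact_mod_cast hm)
  obtain ⟨s, hs, hY⟩ := hU
  obtain ⟨b, hb⟩ := hG.exists_le
  have h1 := h.le_singVal_sketch hk g (G b) (mul_pos hc hm') hb
  have h2 : twoInfNorm ((M + E) ^ g * (1 - spectralCut ε L (M + E)) * G s) ≤
      (3 * ε) ^ g * (τ * √m) :=
    (hG.tail_le s).trans (mul_le_mul_of_nonneg_left hτ (by positivity))
  have h3 := h.twoInfDist_le hg hY (by positivity) (h1.trans (hs b)) h2 hκ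
  have e : (3 * ε) ^ g * (τ * √m) / (c * √m * (L / 2) ^ g) = τ / c * (6 * (ε / L)) ^ g := by
    have : 6 * (ε / L) = (3 * ε) / (L / 2) := by field_simp; norm_num
    have hLg : (L / 2) ^ g ≠ 0 := by positivity
    rw [this, div_pow (3 * ε) (L / 2)]
    generalize (L / 2) ^ g = y at hLg
    field_simp
  rw [e] at h3
  rwa [mul_div_assoc, mul_div_assoc] at h3

theorem IsReducedEigendecomposition.exists_condNumber_eq {n k : ℕ} {M : Matrix (Fin n) (Fin n) ℝ}
    {U : Matrix (Fin n) (Fin k) ℝ} {lam : Fin k → ℝ} (h : IsReducedEigendecomposition M U lam)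
    (hk : 0 < k) :
    ∃ L : ℝ, 0 < L ∧ (∀ i, L ≤ |lam i|) ∧ condNumber lam = ‖M‖ / L ∧ 1 ≤ condNumber lam := by
  have : Nonempty (Fin k) := ⟨⟨0, hk⟩⟩
  obtain ⟨i, hi⟩ := exists_eq_ciInf_of_finite (f := fun i => |lam i|)
  have hL : 0 < ⨅ i, |lam i| := by
    rw [← hi]; exact abs_pos.2 (h.ne_zero i)
  refine ⟨⨅ i, |lam i|, hL, fun i => ciInf_le (Set.finite_range _).bddBelow i, ?_, ?_⟩
  · rw [condNumber, h.norm_eq hk]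
  · rw [condNumber, one_le_div hL]
    exact (ciInf_le (Set.finite_range _).bddBelow i).trans
      (le_ciSup (f := fun i => |lam i|) (Set.finite_range _).bddAbove i)

/-- Rewrites `ε/L` as `ψ (ε/S)` with `ψ = S/L`, and `√(m + log n)` as at most `√2 ϑ √m`; the factor
`√m` cancels against the lower bound on the singular value. -/
theorem IsSmallPerturbation.twoInfDist_rsvd_le_mul {n k m a : ℕ} {M : Matrix (Fin n) (Fin n) ℝ}
    {U : Matrix (Fin n) (Fin k) ℝ} {lam : Fin k → ℝ} {E : Matrix (Fin n) (Fin n) ℝ} {ε L : ℝ}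
    (h : IsSmallPerturbation M U lam E ε L) (hk : 0 < k) (hm : 0 < m) (hn : 1 ≤ n) {g : ℕ}
    (hg : 1 ≤ g) {G : Fin a → Matrix (Fin n) (Fin m) ℝ} {c T : ℝ} (hc : 0 < c) (hT : 0 ≤ T)
    (hG : IsGoodSketch M E G ε L g c (T * (m + Real.log n))) {Uhat : Matrix (Fin n) (Fin k) ℝ}
    (hU : IsRSVDOutput (M + E) g G Uhat) {l ld Cr Cx S : ℝ} (hl : 1 ≤ l) (hld : l ≤ ld)
    (hCr : 0 ≤ Cr) (hS : 0 < S) (hψ : 1 ≤ S / L)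
    (hκ : ∀ r ∈ Finset.Ico 1 g, twoInfNorm (E ^ r * U) ≤
      √k * (Cr * ε ^ r * l ^ r * twoInfNorm U))
    (hCx : √n * (ε / S) ^ (g - 1) ≤ Cx) (hlx : l * (ε / S) ≤ 1) :
    twoInfDist Uhat U ≤
      (3 * (√(2 * T) / c * 6 ^ g * Cx) + 6 + g * (Cr * 2 ^ (g + 1)) + 2 ^ g * Cx) *
        (ld * theta n m * (S / L) ^ g * √k * (ε / S) * twoInfNorm U) := by
  have hL := h.L_pos
  have hε := h.pos
  have hϑ : 1 ≤ theta n m := le_max_left _ _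
  have hτ : √(T * (m + Real.log n)) ≤ (√(2 * T) * theta n m) * √m := by
    have h1 := mul_le_mul_of_nonneg_left (add_log_le hm hn) hT
    calc √(T * (m + Real.log n)) ≤ √((2 * T) * (theta n m ^ 2 * m)) :=
          Real.sqrt_le_sqrt (by linarith)
      _ = _ := by
        rw [Real.sqrt_mul (x := 2 * T) (by positivity),
          Real.sqrt_mul (x := theta n m ^ 2) (by positivity), Real.sqrt_sq (by linarith), mul_assoc]
  have h1 := h.twoInfDist_rsvd_le hk hm hg hc hG hU hκ hτ
  have e : ε / L = S / L * (ε / S) := by field_simp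
  have hsk : 1 ≤ √(k : ℝ) := by
    rw [Real.one_le_sqrt]; exact_mod_cast hk
  have h2 := error_terms_le hg (x := ε / S) (by positivity) hψ hϑ hl hld hsk
    (sqrt_inv_le_twoInfNorm h.eigen.orthonormal hk) (Real.sqrt_pos.2 (by exact_mod_cast hn))
    (B := √(2 * T) / c) (by positivity) hCr hCx hlx
  refine le_trans (le_of_le_of_eq h1 ?_) h2
  have e1 : √(2 * T) * theta n m / c * (6 * (ε / L)) ^ g =
      √(2 * T) / c * ((6 * (S / L * (ε / S))) ^ g * theta n m) := by
    rw [e]; ring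
  have e2 : ∀ r : ℕ, √(k : ℝ) * (Cr * ε ^ r * l ^ r * twoInfNorm U) * (2 * (2 / L) ^ r) =
      √k * (Cr * l ^ r * twoInfNorm U) * (2 * (2 * (S / L * (ε / S))) ^ r) := by
    intro r
    rw [← e, show 2 * (ε / L) = ε * (2 / L) by ring, mul_pow]; ring
  simp only [e1, e2, ← e]

end Deterministic

end RSVD

/-! ### The main theorem -/

theorem theorem3 :
    ∃ (Ca : ℕ → ℕ → ℝ) (Cc : ℝ → ℝ),
      (∀ k₀ m₀ : ℕ, 0 < Ca k₀ m₀) ∧ (∀ cgap : ℝ, 0 < Cc cgap) ∧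
      ∀ (Ω : ℕ → Type*) [∀ n, MeasurableSpace (Ω n)]
        (P : ∀ n, Measure (Ω n)) [∀ n, IsProbabilityMeasure (P n)]
        -- rank, sketching dimension, number of sketches, number of power iterations
        (k m a : ℕ → ℕ) (g : ℕ)
        -- signal matrix, its eigenvectors and nonzero eigenvalues, noise matrix, sketching matrices
        (M : ∀ n, Matrix (Fin n) (Fin n) ℝ)
        (U : ∀ n, Matrix (Fin n) (Fin (k n)) ℝ) (lam : ∀ n, Fin (k n) → ℝ)
        (E : ∀ n, Ω n → Matrix (Fin n) (Fin n) ℝ)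
        (G : ∀ n, Fin (a n) → Ω n → Matrix (Fin n) (Fin (m n)) ℝ)
        -- noise level and constants
        (En : ℕ → ℝ) (β δ C : ℝ),
        (∀ᶠ n in atTop, 1 ≤ k n ∧ k n ≤ m n) →
        (∀ᶠ n in atTop, RSVD.IsReducedEigendecomposition (M n) (U n) (lam n)) →
        (∀ n, RSVD.IsRandomSymmetric (E n)) →
        (∀ n, RSVD.IsGaussianSketch (P n) (G n) (E n)) →
        RSVD.SignalToNoise P M E En β →
        RSVD.RowwiseConcentration P E En δ →
        RSVD.DimensionRegime Ca Cc k m C →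
        (fun n => RSVD.condNumber (lam n)) =o[atTop]
          (fun n => RSVD.specNorm (M n) / En n) →
        (∀ᶠ n : ℕ in atTop, ⌈C * Real.log (n : ℝ) / (m n : ℝ)⌉₊ ≤ a n) →
        (∃ c : ℕ, ∀ᶠ n in atTop, a n ≤ n ^ c) →
        1 + (2 * β)⁻¹ ≤ (g : ℝ) →
        ∃ c : ℝ, ∀ᶠ n in atTop,
          RSVD.HoldsWithProb (P n) (1 - 1 / (n : ℝ) ^ 5) (fun ω =>
            ∀ Uhat : Matrix (Fin n) (Fin (k n)) ℝ,
              RSVD.IsRSVDOutput (M n + E n ω) g (fun b => G n b ω) Uhat →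
              RSVD.twoInfDist Uhat (U n) ≤
                c * (Real.log n ^
                      RSVD.deltaStar β δ g (fun l => RSVD.twoInfNorm (U l)) *
                    RSVD.theta n (m n) * RSVD.condNumber (lam n) ^ g * √(k n : ℝ) *
                    (En n / RSVD.specNorm (M n)) * RSVD.twoInfNorm (U n))) := by
  refine ⟨RSVD.sketchConst, fun _ => 15, RSVD.sketchConst_pos, fun _ => by norm_num, ?_⟩
  intro Ω _ P _ k m a g M U lam E G En β δ C hkm hM hE hG hsnr hrow hreg hψ ha hpoly hg
  obtain ⟨c₀, hc₀, hshrink⟩ := RSVD.exists_shrinkSet_pow_le hkm hreg ha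
  obtain ⟨p, hp⟩ := hpoly
  obtain ⟨N₀, hnoise⟩ := hsnr.noise
  obtain ⟨N₁, Cr, hrows⟩ := hrow.rows
  have hβ := hsnr.beta_pos
  have hδ := hrow.one_lt
  have hg1 : 1 ≤ g := by
    have h1 : (0 : ℝ) < (2 * β)⁻¹ := by positivity
    have h2 : (1 : ℝ) < g := by linarith
    exact_mod_cast h2.le
  have hy0 : ∀ᶠ n in atTop, 0 ≤ RSVD.specNorm (M n) / En n := by
    filter_upwards [eventually_ge_atTop N₀] with n hn
    exact div_nonneg (norm_nonneg _) (hnoise n hn).1.le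
  obtain ⟨Cx, hCx⟩ := RSVD.exists_eventually_snr_le (δ := δ) hβ hg hy0 hsnr.snr
  have hlog : ∀ᶠ n : ℕ in atTop, max 1 (g : ℝ) ≤ Real.log n :=
    (Real.tendsto_log_atTop.comp tendsto_natCast_atTop_atTop).eventually_ge_atTop _
  -- `p` is the polynomial growth exponent of the number of sketches.
  set T : ℝ := 4 * (p + 8) with hT
  refine ⟨3 * (√(2 * T) / c₀ * 6 ^ g * Cx) + 6 + g * (|Cr| * 2 ^ (g + 1)) + 2 ^ g * Cx, ?_⟩
  filter_upwards [hkm, hM, hshrink, hp, hCx, hlog, hψ.bound (show (0 : ℝ) < 1 / 8 by norm_num),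
    eventually_ge_atTop N₀, eventually_ge_atTop N₁, eventually_ge_atTop (g + 3)] with
    n hkm hM hshrink hp hCx hlog hψ hN₀ hN₁ hn
  obtain ⟨hε, hnoise⟩ := hnoise n hN₀
  obtain ⟨hypos, hCx, hlx⟩ := hCx
  obtain ⟨L, hL, hLle, hcond, hcond1⟩ := hM.exists_condNumber_eq hkm.1
  rw [inv_div] at hCx hlx
  set S := RSVD.specNorm (M n) with hS
  -- `specNorm` and the L2 operator norm agree by definition.
  have hcond' : RSVD.condNumber (lam n) = S / L := hcond
  rw [hcond'] at hcond1 hψ ⊢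
  have hSpos : 0 < S := by
    by_contra! h
    exact absurd (div_nonpos_of_nonpos_of_nonneg h hε.le) (not_le.2 hypos)
  -- The assumption `ψ = o(S/E_n)`, used with constant `1/8`, is the spectral separation `8 E_n ≤
  -- S/ψ = L`.
  have h8 : 8 * En n ≤ L := by
    rw [Real.norm_of_nonneg (by positivity), Real.norm_of_nonneg hypos.le] at hψ
    have h1 : S / L ≤ S / (8 * En n) := hψ.trans_eq (by field_simp)
    exact (div_le_div_iff_of_pos_left hSpos hL (by positivity)).1 h1
  have hn1 : 1 ≤ n := by omega
  have hlog1 : 1 ≤ Real.log n := (le_max_left _ _).trans hlog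
  have hTpos : 0 < T := by positivity
  have hlogpos : 0 < Real.log n := by linarith
  have hgood := RSVD.holdsWithProb_isGoodSketch (hG n) (hE n) hM hε hLle h8 g c₀
    (t := T * (m n + Real.log n)) (by positivity)
  have hpow := RSVD.holdsWithProb_twoInfNorm_pow_mul_le hM.orthonormal hn1 hε
    ((le_max_right _ _).trans hlog) (hrows n hN₁)
  refine ((hnoise.and hgood).and hpow).mono ?_ ?_
  · have h1 := RSVD.chi_square_budget (m := m n) hn1 hp
    rw [← hT] at h1
    have hn0 : (0 : ℝ) < n := by exact_mod_cast hn1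
    have hn' : (g : ℝ) + 3 ≤ n := by exact_mod_cast hn
    -- The failures are, in order: the noise norm, the sketched tail rows, the lower bound of the
    -- sketches, and the rows of `E^r U`. Their sum `(2n + 1 + g) / n^7` is at most `n^(-5)` once `n
    -- ≥ g + 3`.
    have h2 : 1 / (n : ℝ) ^ 6 + (1 / (n : ℝ) ^ 7 + 1 / (n : ℝ) ^ 6) + g / (n : ℝ) ^ 7 ≤
        1 / (n : ℝ) ^ 5 := by
      have e : 1 / (n : ℝ) ^ 6 + (1 / (n : ℝ) ^ 7 + 1 / (n : ℝ) ^ 6) + g / (n : ℝ) ^ 7 =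
          (2 * n + 1 + g) / (n : ℝ) ^ 7 := by field_simp; ring
      have e' : 1 / (n : ℝ) ^ 5 = n ^ 2 / (n : ℝ) ^ 7 := by field_simp
      rw [e, e']
      gcongr
      nlinarith [(Nat.cast_nonneg g : (0 : ℝ) ≤ g)]
    linarith
  · rintro ω ⟨⟨h1, h2⟩, h3⟩ Uhat hU
    have hpert : RSVD.IsSmallPerturbation (M n) (U n) (lam n) (E n ω) (En n) L :=
      ⟨hM, (hE n).symm ω, hε, hLle, h8, h1⟩
    exact hpert.twoInfDist_rsvd_le_mul hkm.1 (by omega) hn1 hg1 hc₀ hTpos.le (h2 h1) hU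
      (Real.one_le_rpow hlog1 (by linarith))
      (Real.rpow_le_rpow_of_exponent_le hlog1 (RSVD.le_deltaStar (by linarith) hg1 _))
      (abs_nonneg Cr) hSpos hcond1 h3 hCx hlx
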